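/- Let $f:\mathbb{R}^2\times\mathbb{R}^n\to\mathbb{R}^2$ (vehicle dynamics), $\alpha:\mathbb{R}^2\times\mathbb{R}^2\to\mathbb{R}^n$ (control law) and $h:\mathbb{R}^2\to\mathbb{R}$ (energy cost) be smooth; the state is $x=(v,\beta)$ (speed, sideslip) and the closed-loop vehicle with reference $r$ is $\dot x=f(x,\alpha(x,r))$. Assume: 1. There is a smooth $l:\mathbb{R}^2\to\mathbb{R}^2$ such that $f(x,\alpha(x,r))=0$ if and only if $x=l(r)$. 2. For each constant $r$ the equilibrium $x=l(r)$ is locally exponentially stable, uniformly in $r$: there are $M,\lambda,\rho_0>0$, independent of $r$, such that every solution with $\|x(0)-l(r)\|<\rho_0$ satisfies $\|x(t)-l(r)\|\le M\|x(0)-l(r)\|e^{-\lambda t}$ for $t\ge 0$. 3. At $r^*\in\mathbb{R}^2$, $\nabla(h\circ l)(r^*)=0$ and $\nabla^2(h\circ l)(r^*)$ is positive definite. Fix positive constants $\omega_i',\omega_{li}',\omega_{hi}',k_i',\gamma_i'$ ($i\in\{v,\beta\}$) and $\epsilon$, where $\omega_v'\ne\omega_\beta'$ and $\sin(\omega_v'\tau),\sin(\omega_\beta'\tau)$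 have a least common period. For amplitudes $a=(a_v,a_\beta)$ put $p_i(\tau)=a_i\sin(\omega_i'\tau)$. With $\tau=\omega t$, the full closed-loop system in $x$ and $z=(\tilde r,q,\tilde\eta,m)\in\mathbb{R}^8$ is, for $i\in\{v,\beta\}$, $$\omega\frac{dx}{d\tau}=f\bigl(x,\alpha(x,r^*+\tilde r+p(\tau))\bigr),\qquad \frac{d\tilde r_i}{d\tau}=-\delta\frac{k_i'q_i}{\sqrt{m_i+\epsilon}},\qquad \frac{dq_i}{d\tau}=\delta\omega_{li}'\bigl((w-\tilde\eta_i)\sin(\omega_i'\tau)-q_i\bigr),$$ $$\frac{d\tilde\eta_i}{d\tau}=\delta\omega_{hi}'(w-\tilde\eta_i),\qquad \frac{dm_i}{d\tau}=\delta\gamma_i'(q_i^2-m_i),\qquad w=h(x)-h(l(r^*)).$$ Here $\tilde r=\hat r-r^*$ is the error of the speed and sideslip references relative to the optimum. The reduced system is the system for $z$ alone in which $x$ is replaced by $l(r^*+\tilde r+p(\tau))$. Then for every $\kappa\ge1$ there is $C>0$ such that for every $R>0$ there are $\rho,\bar a,\bar\delta,\bar\omega>0$ with the following property. Let $a_v,a_\beta>0$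 with $a_v\le\kappa a_\beta$, $a_\beta\le\kappa a_v$ and $\|a\|<\bar a$, let $0<\delta<\bar\delta$ and $0<\omega<\bar\omega$, and let $\|x_0-l(r^*)\|<\rho$, $\|z_0\|<\rho$. Then the full system with initial value $(x_0,z_0)$ and the reduced system with initial value $z_0$ have solutions on $[0,\infty)$, and all such solutions $(x,z)$ and $z^{\mathrm{red}}$ satisfy - (local stability) $\|x(\tau)-l(r^*)\|<R$ and $\|z(\tau)\|<R$ for all $\tau\ge0$; - (closeness to the reduced system) $\|z(\tau)-z^{\mathrm{red}}(\tau)\|\le C\omega$ for all $\tau\ge0$; - (convergence) there is $T$ such that $|\tilde r_v(\tau)|,|\tilde r_\beta(\tau)|\le C(\omega+\delta+\|a\|^2)$ for all $\tau\ge T$. -/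

import Mathlib

/-- The plane with the Euclidean norm. Index `0` is the speed, index `1` the sideslip. -/
abbrev Plane : Type := EuclideanSpace ℝ (Fin 2)

/-- State `z = (r̃, q, η̃, m)` of the extremum seeking controller, each block being the pair of its
speed and sideslip components: `r̃ = r̂ - r*` is the error of the unperturbed reference, `q` the
gradient estimate, `η̃ = η - (h ∘ l)(r*)` the shifted low-frequency part of the cost, `m` the
second moment estimate. -/
abbrev EscState : Type := Plane × Plane × Plane × Plane

/-- The fixed positive constants of the controller (the primed constants, for speed and sideslip,
and `ε`). In the original time `t`, the perturbation frequencies are `ω * freq i`, the cutoff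
frequencies of the filters `ω * δ * lowpass i`, `ω * δ * highpass i`, `ω * δ * momentRate i`, and
the integrator gains `ω * δ * gain i`. -/
structure EscConstants where
  freq : Fin 2 → ℝ
  lowpass : Fin 2 → ℝ
  highpass : Fin 2 → ℝ
  gain : Fin 2 → ℝ
  momentRate : Fin 2 → ℝ
  ε : ℝ
  freq_pos : ∀ i, 0 < freq i
  lowpass_pos : ∀ i, 0 < lowpass i
  highpass_pos : ∀ i, 0 < highpass i
  gain_pos : ∀ i, 0 < gain i
  momentRate_pos : ∀ i, 0 < momentRate i
  ε_pos : 0 < ε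

noncomputable section

/-- The sinusoidal perturbation in the time scale `τ = ω t`, with amplitudes `a`. -/
def perturbation (c : EscConstants) (a : Plane) (τ : ℝ) : Plane :=
  WithLp.toLp 2 fun i => a i * Real.sin (c.freq i * τ)

/-- The controller field `E` in the time scale `τ`, driven by the cost excess `w`, that is the
current cost minus the optimal cost `(h ∘ l)(r*)`. The controller obeys `dz/dτ = δ E`. -/
def escField (c : EscConstants) (τ w : ℝ) (z : EscState) : EscState :=
  let q := z.2.1
  let η := z.2.2.1
  let m := z.2.2.2
  (WithLp.toLp 2 fun i => -c.gain i * q i / Real.sqrt (m i + c.ε),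
    WithLp.toLp 2 fun i =>
      c.lowpass i * (w - η i) * Real.sin (c.freq i * τ) - c.lowpass i * q i,
    WithLp.toLp 2 fun i => -c.highpass i * η i + c.highpass i * w,
    WithLp.toLp 2 fun i => c.momentRate i * (-m i + q i ^ 2))

/-- `(x, z)` solves the full closed loop on `[0, ∞)` in the time scale `τ`:
`ω dx/dτ = F (x, r* + r̃ + p)` and `dz/dτ = δ E`, the measured cost being `h x`.
Here `F x r` is the closed-loop vector field of the vehicle with reference `r`. -/
def IsFullSolution (F : Plane → Plane → Plane) (h : Plane → ℝ) (l : Plane → Plane)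
    (rstar : Plane) (c : EscConstants) (a : Plane) (δ ω : ℝ)
    (x : ℝ → Plane) (z : ℝ → EscState) : Prop :=
  ∀ τ : ℝ, 0 ≤ τ →
    HasDerivWithinAt x (ω⁻¹ • F (x τ) (rstar + (z τ).1 + perturbation c a τ)) (Set.Ici 0) τ ∧
    HasDerivWithinAt z (δ • escField c τ (h (x τ) - h (l rstar)) (z τ)) (Set.Ici 0) τ

/-- `z` solves the reduced system on `[0, ∞)`: the vehicle is frozen at its equilibrium
`l (r* + r̃ + p)`. -/
def IsReducedSolution (h : Plane → ℝ) (l : Plane → Plane)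
    (rstar : Plane) (c : EscConstants) (a : Plane) (δ : ℝ) (z : ℝ → EscState) : Prop :=
  ∀ τ : ℝ, 0 ≤ τ →
    HasDerivWithinAt z
      (δ • escField c τ (h (l (rstar + (z τ).1 + perturbation c a τ)) - h (l rstar)) (z τ))
      (Set.Ici 0) τ

/-- The equilibria `x = l r` of `dx/dt = F x r` are locally exponentially stable, uniformly in the
constant reference `r`. Solutions on all compact intervals `[0, T]` are considered, so finite
escape is excluded near the equilibrium. -/
def LocallyExpStableUniformly (F : Plane → Plane → Plane) (l : Plane → Plane) : Prop :=
  ∃ M rate radius : ℝ, 0 < M ∧ 0 < rate ∧ 0 < radius ∧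
    ∀ (r : Plane) (T : ℝ) (x : ℝ → Plane),
      (∀ t ∈ Set.Icc 0 T, HasDerivWithinAt x (F (x t) r) (Set.Icc 0 T) t) →
      ‖x 0 - l r‖ < radius →
      ∀ t ∈ Set.Icc 0 T, ‖x t - l r‖ ≤ M * ‖x 0 - l r‖ * Real.exp (-rate * t)

end

open Set Filter Topology
open scoped NNReal

/-! Let `g s = h (l (r* + s)) - h (l r*)`. It has a critical zero at the origin, with positive
definite Hessian `H`. The core of the proof is one Lyapunov estimate for the gap of two controller
trajectories. It is applied twice: to a trajectory against the zero trajectory, which gives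
stability and convergence, and to the full against the reduced controller, which gives closeness.

Averaging. Let `ρ` be the gap of the references. The gap of the gradient estimates is driven by the
demodulated cost gap, whose first order part `H p ρ * sin (freq i * τ)` has mean `1/2 * a i * H e_i
ρ`; because the frequencies differ, the rest has a bounded primitive. `gapK` subtracts `δ` times the
primitives of the oscillating terms, so exact differential inequalities take the place of an
averaging limit (`PairAt.exists_gapK_gapS_deriv`). In `gapS` the gradient gap cancels at first
order, and up to errors `S_i' = -1/2 * δ * linGain i * a i * H e_i S`. The weights in `gapW`
symmetrize this into the dissipation `-1/2 * δ * ‖a‖ * H S S`. Thus the slow gap decays at rate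
`δ‖a‖`, whereas `gapK`, the moment gap and `gapU` decay at rate `δ`. `exists_lyapunov_weights`
combines them into one function, in which `gapU` carries an extra factor `δ`.

Boundary layer. Exponential stability passes to the linearization of the plant
(`norm_exp_smul_fderiv_le_of_exp_stable`) and yields a norm that decays without overshoot
(`exists_adapted_norm`). Measured in it, the distance `N` of `x` to the moving equilibrium satisfies
`D⁺N ≤ -(lam/ω) N + B * (speed of the reference)` (`exists_plantBounds`). The cost error is at most
a multiple of `N`. A term `Kn * δ * ω * N` in the Lyapunov function pays for it and leaves a forcing
of order `ω (‖a‖ + δ‖q‖)`.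

Against zero, the forcing is `g p`. Its quadratic part `1/2 * H p p` contributes no drift after
demodulation, since a product of three sines is a sum of sines and has a bounded primitive. What
remains is of order `‖a‖ (‖a‖² + δ + ω)`; dividing by the rate `‖a‖` leaves the radius `‖a‖² + δ +
ω` (`EscBounds.exists_single_stability`).

Full against reduced, the only external forcing is the layer. The coupling through the gradient
estimate of the reduced system is of size `δ (exp (-κδτ) + ‖a‖)` in units of `δ`: its persistent
part is small against the dissipation `‖a‖`, and its transient has an integral of order `δ`. Hence
the gap stays of order `ω` for all time (`EscBounds.exists_closeness`).

These estimates hold while the trajectories stay in a small ball. They improve that very bound, so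
`forall_lt_of_bootstrap` removes the proviso, and the same a priori bound gives global existence. -/

/-! ### Dini derivatives, fences and continuous induction. -/

/-- The upper right Dini derivative of `f` at `t` is at most `d`. -/
def DiniLE (f : ℝ → ℝ) (d t : ℝ) : Prop :=
  ∀ c, d < c → ∀ᶠ s in 𝓝[>] t, f s - f t ≤ c * (s - t)

namespace DiniLE

variable {f g : ℝ → ℝ} {d d' t : ℝ}

theorem mono (hf : DiniLE f d t) (h : d ≤ d') : DiniLE f d' t :=
  fun c hc => hf c (h.trans_lt hc)

theorem add (hf : DiniLE f d t) (hg : DiniLE g d' t) :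
    DiniLE (fun s => f s + g s) (d + d') t := by
  intro c hc
  have h1 := hf (d + (c - d - d') / 2) (by linarith)
  have h2 := hg (d' + (c - d - d') / 2) (by linarith)
  filter_upwards [h1, h2] with s h1 h2
  nlinarith

theorem const_mul (hf : DiniLE f d t) {k : ℝ} (hk : 0 ≤ k) :
    DiniLE (fun s => k * f s) (k * d) t := by
  rcases hk.eq_or_lt with rfl | hk
  · intro c hc
    filter_upwards [self_mem_nhdsWithin] with s hs
    have hs : t < s := hs
    have : 0 < c := by simpa using hc
    nlinarith [mul_pos this (sub_pos.2 hs)]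
  · intro c hc
    have h1 := hf (c / k) (by rw [lt_div_iff₀ hk]; linarith)
    filter_upwards [h1] with s h1
    have := mul_le_mul_of_nonneg_left h1 hk.le
    calc k * f s - k * f t = k * (f s - f t) := by ring
      _ ≤ k * (c / k * (s - t)) := this
      _ = c * (s - t) := by field_simp

end DiniLE

theorem HasDerivWithinAt.diniLE {f : ℝ → ℝ} {d t : ℝ} (hf : HasDerivWithinAt f d (Ici t) t) :
    DiniLE f d t := by
  intro c hc
  have h := (hasDerivWithinAt_iff_tendsto_slope' (lt_irrefl t)).1 (hf.mono Ioi_subset_Ici_self)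
  filter_upwards [h.eventually (gt_mem_nhds hc), self_mem_nhdsWithin] with s hs hst
  have hst : 0 < s - t := sub_pos.2 hst
  rw [slope_def_field, div_lt_iff₀ hst] at hs
  exact hs.le

/-- A norm decays along a curve whose velocity splits into a dissipative part and an error. -/
theorem DiniLE.norm_of_hasDerivWithinAt {E : Type*} [NormedAddCommGroup E]
    [InnerProductSpace ℝ E] {v : ℝ → E} {w b : E} {t k ε : ℝ}
    (hv : HasDerivWithinAt v (w + b) (Ici t) t)
    (hw : inner ℝ (v t) w ≤ -k * ‖v t‖ ^ 2) (hw0 : v t = 0 → w = 0) (hb : ‖b‖ ≤ ε) :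
    DiniLE (fun s => ‖v s‖) (-k * ‖v t‖ + ε) t := by
  -- At a zero of `v` the norm need not be differentiable; there `w` vanishes, and the slope of the
  -- norm is bounded by the norm of the velocity `b`.
  by_cases h0 : v t = 0
  · intro c hc
    have hlim := (hv.mono Ioi_subset_Ici_self).limsup_slope_norm_le (r := c) (by
      rw [hw0 h0, zero_add]; rw [h0] at hc; simp at hc; linarith)
    filter_upwards [hlim, self_mem_nhdsWithin] with s hs hst
    have hst : 0 < s - t := sub_pos.2 hst
    rw [Real.norm_of_nonneg hst.le, inv_mul_lt_iff₀ hst] at hs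
    linarith
  · have hpos : 0 < ‖v t‖ := norm_pos_iff.2 h0
    have h1 := (hv.norm_sq.sqrt (by positivity)).diniLE
    simp only [Real.sqrt_sq (norm_nonneg _)] at h1
    refine h1.mono ?_
    rw [div_le_iff₀ (by positivity), inner_add_right]
    have h2 : inner ℝ (v t) b ≤ ‖v t‖ * ε :=
      (real_inner_le_norm _ _).trans (by gcongr)
    nlinarith

/-- Fencing by a strict supersolution. -/
theorem le_of_diniLE_of_strict_supersolution {f B B' : ℝ → ℝ} {T : ℝ}
    (hf : ContinuousOn f (Icc 0 T)) (h0 : f 0 ≤ B 0)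
    (hB : ∀ t, HasDerivAt B (B' t) t)
    (hfB : ∀ t ∈ Ico 0 T, f t = B t → ∃ d, DiniLE f d t ∧ d < B' t) :
    ∀ t ∈ Icc 0 T, f t ≤ B t := by
  have hA : ContinuousOn (fun x => (f x, B x)) (Icc 0 T) :=
    hf.prodMk fun x _ => (hB x).continuousAt.continuousWithinAt
  have hclosed : IsClosed ({x | f x ≤ B x} ∩ Icc 0 T) := by
    rw [inter_comm]
    exact hA.preimage_isClosed_of_isClosed isClosed_Icc OrderClosedTopology.isClosed_le'
  -- Continuous induction on a closed set of times: strict inequality persists by continuity, so the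
  -- derivatives are compared only where `f` touches `B`.
  refine hclosed.Icc_subset_of_forall_exists_gt h0 ?_
  rintro x ⟨hxB : f x ≤ B x, xab⟩ y hy
  refine nonempty_of_mem (inter_mem ?_ (Ioc_mem_nhdsGT hy))
  rcases hxB.lt_or_eq with hlt | heq
  · have h1 : ∀ᶠ x in 𝓝[Icc 0 T] x, f x < B x :=
      hA x (Ico_subset_Icc_self xab) (IsOpen.mem_nhds (isOpen_lt continuous_fst continuous_snd) hlt)
    have h2 : ∀ᶠ x in 𝓝[>] x, f x < B x := nhdsWithin_le_of_mem (Icc_mem_nhdsGT_of_mem xab) h1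
    exact h2.mono fun y => le_of_lt
  · obtain ⟨d, hd, hdB⟩ := hfB x xab heq
    obtain ⟨r, hdr, hrB⟩ := exists_between hdB
    have h := (hasDerivWithinAt_iff_tendsto_slope' (lt_irrefl x)).1
      ((hB x).hasDerivWithinAt (s := Ioi x))
    filter_upwards [h.eventually (lt_mem_nhds hrB), hd r hdr, self_mem_nhdsWithin]
      with s h1 h2 hst
    have hst : 0 < s - x := sub_pos.2 hst
    rw [slope_def_field, lt_div_iff₀ hst] at h1
    change f s ≤ B s
    linarith

/-- A continuous function that stays below `b` up to any time until which it is at most `b` stays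
below `b` forever. -/
theorem forall_lt_of_bootstrap {F : ℝ → ℝ} {b : ℝ} (hF : ContinuousOn F (Ici 0))
    (hstep : ∀ T, 0 ≤ T → (∀ t ∈ Icc 0 T, F t ≤ b) → F T < b) (h0 : F 0 < b) :
    ∀ t, 0 ≤ t → F t < b := by
  by_contra! hcon
  obtain ⟨t₁, ht₁, hFt₁⟩ := hcon
  -- The infimum of this set is the first time at which the bound `b` is reached. Up to it `F ≤ b`
  -- holds, so `hstep` contradicts the value there.
  set S : Set ℝ := Ici 0 ∩ F ⁻¹' Ici b with hS
  have hSc : IsClosed S := hF.preimage_isClosed_of_isClosed isClosed_Ici isClosed_Ici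
  have hSb : BddBelow S := ⟨0, fun x hx => hx.1⟩
  have hmem : sInf S ∈ S := hSc.csInf_mem ⟨t₁, ht₁, hFt₁⟩ hSb
  have hlt : ∀ t ∈ Ico 0 (sInf S), F t < b := fun t ht => by
    by_contra! h
    exact absurd (csInf_le hSb ⟨ht.1, h⟩) (not_le.2 ht.2)
  have hpos : 0 < sInf S := by
    rcases (show 0 ≤ sInf S from hmem.1).eq_or_lt with h | h
    · rw [← h] at hmem
      exact absurd hmem.2 (not_le.2 h0)
    · exact h
  have hle : F (sInf S) ≤ b := by
    have h1 : Tendsto F (𝓝[Ico 0 (sInf S)] (sInf S)) (𝓝 (F (sInf S))) :=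
      (hF _ hmem.1).mono Ico_subset_Ici_self
    have : (𝓝[Ico 0 (sInf S)] (sInf S)).NeBot := by
      rw [← mem_closure_iff_nhdsWithin_neBot, closure_Ico hpos.ne]
      exact right_mem_Icc.2 hpos.le
    exact le_of_tendsto h1 (eventually_nhdsWithin_of_forall fun t ht => (hlt t ht).le)
  refine absurd hmem.2 (not_le.2 (hstep _ hmem.1 fun t ht => ?_))
  rcases ht.2.eq_or_lt with rfl | h
  · exact hle
  · exact (hlt t ⟨ht.1, h⟩).le

/-! ### Global existence of solutions. -/

section ODE

variable {E : Type*} [NormedAddCommGroup E] [NormedSpace ℝ E]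

/-- A time-dependent vector field that is bounded and Lipschitz, uniformly on compact time
intervals, has global forward solutions. -/
theorem exists_forall_hasDerivWithinAt_Ici_of_lipschitzWith [CompleteSpace E] {v : ℝ → E → E}
    (hlip : ∀ T : ℝ, ∃ K : ℝ≥0, ∀ t ∈ Icc 0 T, LipschitzWith K (v t))
    (hbdd : ∀ T : ℝ, ∃ L : ℝ≥0, ∀ t ∈ Icc 0 T, ∀ x, ‖v t x‖ ≤ L)
    (hcont : ∀ x, Continuous fun t => v t x) (x₀ : E) :
    ∃ x : ℝ → E, x 0 = x₀ ∧ ∀ t, 0 ≤ t → HasDerivWithinAt x (v t (x t)) (Ici 0) t := by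
  have hloc : ∀ n : ℕ, ∃ x : ℝ → E, x 0 = x₀ ∧
      ∀ t ∈ Icc (0 : ℝ) n, HasDerivWithinAt x (v t (x t)) (Icc (0 : ℝ) n) t := by
    intro n
    obtain ⟨K, hK⟩ := hlip n
    obtain ⟨L, hL⟩ := hbdd n
    have hn : (0 : ℝ) ≤ n := n.cast_nonneg
    -- A field bounded by `L` cannot leave the ball of radius `L * n` within time `n`, so a single
    -- Picard–Lindelöf step covers the whole interval.
    have hPL : IsPicardLindelof v (⟨0, left_mem_Icc.2 hn⟩ : Icc (0 : ℝ) n) x₀ (L * n) 0 L K :=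
      { lipschitzOnWith := fun t ht => (hK t ht).lipschitzOnWith
        continuousOn := fun x _ => (hcont x).continuousOn
        norm_le := fun t ht x _ => hL t ht x
        mul_max_le := by simp }
    exact hPL.exists_eq_forall_mem_Icc_hasDerivWithinAt₀
  choose X hX0 hX using hloc
  have huniq : ∀ n m : ℕ, n ≤ m → EqOn (X n) (X m) (Icc 0 n) := by
    intro n m hnm
    have hnm' : (n : ℝ) ≤ m := by exact_mod_cast hnm
    obtain ⟨K, hK⟩ := hlip n
    have key : ∀ k : ℕ, n ≤ k → ContinuousOn (X k) (Icc 0 n) ∧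
        ∀ t ∈ Ico (0 : ℝ) n, HasDerivWithinAt (X k) (v t (X k t)) (Ici t) t := by
      intro k hnk
      have hnk' : (n : ℝ) ≤ k := by exact_mod_cast hnk
      refine ⟨fun t ht => ((hX k t ⟨ht.1, ht.2.trans hnk'⟩).continuousWithinAt).mono
        (Icc_subset_Icc_right hnk'), fun t ht => ?_⟩
      refine (hX k t ⟨ht.1, ht.2.le.trans hnk'⟩).mono_of_mem_nhdsWithin ?_
      exact mem_of_superset (Icc_mem_nhdsGE_of_mem ⟨le_rfl, ht.2.trans_le hnk'⟩)
        (Icc_subset_Icc_left ht.1)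
    exact ODE_solution_unique_of_mem_Icc_right (s := fun _ => univ) (K := K)
      (fun t ht => (hK t ⟨ht.1, ht.2.le⟩).lipschitzOnWith) (key n le_rfl).1 (key n le_rfl).2
      (fun _ _ => mem_univ _) (key m hnm).1 (key m hnm).2 (fun _ _ => mem_univ _)
      (by rw [hX0, hX0])
  -- The index `⌊t⌋₊ + 1` keeps `t` strictly below the end of its interval, so that near `t` the
  -- glued function agrees with one fixed piece.
  refine ⟨fun t => X (⌊t⌋₊ + 1) t, by simp [hX0], fun t ht => ?_⟩
  have hlt : t < (⌊t⌋₊ + 1 : ℕ) := by exact_mod_cast Nat.lt_floor_add_one t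
  have heq : ∀ s ∈ Ico (0 : ℝ) (⌊t⌋₊ + 1 : ℕ), X (⌊s⌋₊ + 1) s = X (⌊t⌋₊ + 1) s := by
    intro s hs
    refine huniq _ _ ?_ ⟨hs.1, by exact_mod_cast (Nat.lt_floor_add_one s).le⟩
    have : ⌊s⌋₊ < ⌊t⌋₊ + 1 := (Nat.floor_lt hs.1).2 hs.2
    omega
  have hmem : Ico (0 : ℝ) (⌊t⌋₊ + 1 : ℕ) ∈ 𝓝[Ici 0] t := by
    rw [← Ici_inter_Iio]
    exact inter_mem self_mem_nhdsWithin (mem_nhdsWithin_of_mem_nhds (Iio_mem_nhds hlt))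
  refine ((hX (⌊t⌋₊ + 1) t ⟨ht, hlt.le⟩).mono_of_mem_nhdsWithin
    (mem_of_superset hmem Ico_subset_Icc_self)).congr_of_eventuallyEq ?_ rfl
  filter_upwards [hmem] with s hs using heq s hs

theorem ContDiffOn.exists_lipschitzOnWith_of_isCompact_of_convex {F : Type*}
    [NormedAddCommGroup F] [NormedSpace ℝ F] {f : E → F} {U s : Set E}
    (hf : ContDiffOn ℝ 1 f U) (hU : IsOpen U) (hsU : s ⊆ U) (hs : IsCompact s)
    (hc : Convex ℝ s) : ∃ K : ℝ≥0, LipschitzOnWith K f s := by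
  have hcont : ContinuousOn (fderiv ℝ f) s :=
    (hf.continuousOn_fderiv_of_isOpen hU le_rfl).mono hsU
  obtain ⟨C, hC⟩ := hs.exists_bound_of_continuousOn hcont
  refine ⟨C.toNNReal, hc.lipschitzOnWith_of_nnnorm_fderiv_le (𝕜 := ℝ) (fun x hx => ?_)
    fun x hx => ?_⟩
  · exact (hf.differentiableOn one_ne_zero).differentiableAt (hU.mem_nhds (hsU hx))
  · rw [← NNReal.coe_le_coe, coe_nnnorm]
    exact (hC x hx).trans (Real.le_coe_toNNReal C)

/-- A priori bounds give global solutions. -/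
theorem exists_forall_hasDerivWithinAt_Ici_of_apriori [FiniteDimensional ℝ E]
    {V : ℝ × E → E} {c x₀ : E} {R : ℝ} (hR : 0 < R)
    (hV : ContDiffOn ℝ 1 V (univ ×ˢ Metric.ball c (3 * R))) (hx₀ : ‖x₀ - c‖ < R)
    (hap : ∀ (T : ℝ) (x : ℝ → E), 0 ≤ T → x 0 = x₀ →
      (∀ t ∈ Icc 0 T, HasDerivWithinAt x (V (t, x t)) (Icc 0 T) t) →
      (∀ t ∈ Icc 0 T, ‖x t - c‖ ≤ R) → ‖x T - c‖ < R) :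
    ∃ x : ℝ → E, x 0 = x₀ ∧ ∀ t, 0 ≤ t → HasDerivWithinAt x (V (t, x t)) (Ici 0) t := by
  have : CompleteSpace E := FiniteDimensional.complete ℝ E
  -- The truncation `π` is the identity on the `R`-ball and maps everything into the `2R`-ball, so
  -- the field composed with `π` is bounded and Lipschitz on compact time intervals.
  let χ : ContDiffBump c := ⟨R, 2 * R, hR, by linarith⟩
  let π : E → E := fun x => c + χ x • (x - c)
  have hπball : ∀ x, π x ∈ Metric.closedBall c (2 * R) := by
    intro x
    rw [mem_closedBall_iff_norm, add_sub_cancel_left, norm_smul, Real.norm_of_nonneg χ.nonneg]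
    by_cases hx : ‖x - c‖ ≤ 2 * R
    · nlinarith [χ.le_one (x := x), χ.nonneg (x := x), norm_nonneg (x - c)]
    · rw [χ.zero_of_le_dist (by rw [dist_eq_norm]; exact (not_le.1 hx).le)]
      simp; positivity
  have hπid : ∀ x, ‖x - c‖ ≤ R → π x = x := by
    intro x hx
    simp [π, χ.one_of_mem_closedBall (mem_closedBall_iff_norm.2 hx)]
  obtain ⟨Kπ, hKπ⟩ : ∃ K : ℝ≥0, LipschitzWith K π := by
    have h1 : HasCompactSupport fun x => χ x • (x - c) := χ.hasCompactSupport.smul_right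
    have h2 : ContDiff ℝ 1 fun x => χ x • (x - c) := by
      exact χ.contDiff.smul (contDiff_id.sub contDiff_const)
    obtain ⟨K, hK⟩ := ContDiff.lipschitzWith_of_hasCompactSupport h1 h2 one_ne_zero
    exact ⟨K, fun x y => by simpa [π] using hK x y⟩
  have hsub : ∀ T : ℝ, Icc 0 T ×ˢ Metric.closedBall c (2 * R) ⊆
      (univ ×ˢ Metric.ball c (3 * R) : Set (ℝ × E)) := fun T =>
    prod_mono (subset_univ _) (Metric.closedBall_subset_ball (by linarith))
  have hcomp : ∀ T : ℝ, IsCompact (Icc 0 T ×ˢ Metric.closedBall c (2 * R)) := fun T =>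
    isCompact_Icc.prod (isCompact_closedBall _ _)
  obtain ⟨x, hx0, hx⟩ := exists_forall_hasDerivWithinAt_Ici_of_lipschitzWith
    (v := fun t x => V (t, π x)) (fun T => by
      obtain ⟨K, hK⟩ := hV.exists_lipschitzOnWith_of_isCompact_of_convex
        (isOpen_univ.prod Metric.isOpen_ball) (hsub T) (hcomp T)
        ((convex_Icc _ _).prod (convex_closedBall _ _))
      refine ⟨K * Kπ, fun t ht => LipschitzWith.of_dist_le_mul fun x y => ?_⟩
      calc dist (V (t, π x)) (V (t, π y)) ≤ K * dist (t, π x) (t, π y) :=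
            hK.dist_le_mul _ ⟨ht, hπball x⟩ _ ⟨ht, hπball y⟩
        _ = K * dist (π x) (π y) := by simp [Prod.dist_eq]
        _ ≤ K * (Kπ * dist x y) := by gcongr; exact hKπ.dist_le_mul x y
        _ = _ := by push_cast; ring)
    (fun T => by
      obtain ⟨L, hL⟩ := (hcomp T).exists_bound_of_continuousOn
        (hV.continuousOn.mono (hsub T))
      exact ⟨L.toNNReal, fun t ht x => (hL (t, π x) ⟨ht, hπball x⟩).trans
        (Real.le_coe_toNNReal L)⟩)
    (fun x => by
      refine hV.continuousOn.comp_continuous (by fun_prop) fun t => ⟨mem_univ _, ?_⟩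
      exact Metric.closedBall_subset_ball (by linarith) (hπball x)) x₀
  have hcont : ContinuousOn x (Ici 0) := fun t ht => (hx t ht).continuousWithinAt
  -- While the truncated solution stays in the closed `R`-ball it solves the original equation, so
  -- the a priori bound applies and keeps it strictly inside.
  have hlt := forall_lt_of_bootstrap (F := fun t => ‖x t - c‖) (b := R)
    (by fun_prop) (fun T hT hle => hap T x hT hx0
      (fun t ht => by
        have h1 := (hx t ht.1).mono (Icc_subset_Ici_self : Icc 0 T ⊆ Ici 0)
        rwa [hπid _ (hle t ht)] at h1) hle) (by simpa [hx0] using hx₀)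
  refine ⟨x, hx0, fun t ht => ?_⟩
  have h1 := hx t ht
  rwa [hπid _ (hlt t ht).le] at h1

end ODE

/-! ### Linearization of a stable equilibrium and an adapted norm. -/

theorem DiniLE.of_le {f g : ℝ → ℝ} {d t : ℝ} (hg : DiniLE g d t) (heq : f t = g t)
    (hle : ∀ s, t ≤ s → f s ≤ g s) : DiniLE f d t := by
  intro c hc
  filter_upwards [hg c hc, self_mem_nhdsWithin] with s hs hst
  have := hle s (le_of_lt hst)
  linarith

theorem HasDerivWithinAt.Ici_of_Icc {E : Type*} [NormedAddCommGroup E] [NormedSpace ℝ E]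
    {x : ℝ → E} {x' : E} {t T : ℝ} (h : HasDerivWithinAt x x' (Icc 0 T) t) (ht : t ∈ Ico 0 T) :
    HasDerivWithinAt x x' (Ici t) t :=
  h.mono_of_mem_nhdsWithin (mem_of_superset (Icc_mem_nhdsGE_of_mem ⟨le_rfl, ht.2⟩)
    (Icc_subset_Icc_left ht.1))

section Linearization

variable {E : Type*} [NormedAddCommGroup E] [NormedSpace ℝ E]

theorem hasDerivAt_exp_smul_apply [CompleteSpace E] (A : E →L[ℝ] E) (y : E) (t : ℝ) :
    HasDerivAt (fun s : ℝ => NormedSpace.exp (s • A) y) (A (NormedSpace.exp (t • A) y)) t := by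
  have h := hasDerivAt_exp_smul_const' (𝕂 := ℝ) A t
  exact h.clm_apply (hasDerivAt_const t y) |>.congr_deriv (by simp)

/-- Exponential stability of an equilibrium passes to the linearization. -/
theorem norm_exp_smul_fderiv_le_of_exp_stable [FiniteDimensional ℝ E] {F : E → E}
    (hF : ContDiff ℝ 1 F) {x₀ : E} (hx₀ : F x₀ = 0) {M rate radius : ℝ} (hM : 0 < M)
    (hrate : 0 < rate) (hradius : 0 < radius)
    (hstab : ∀ (T : ℝ) (x : ℝ → E),
      (∀ t ∈ Icc 0 T, HasDerivWithinAt x (F (x t)) (Icc 0 T) t) → ‖x 0 - x₀‖ < radius →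
      ∀ t ∈ Icc 0 T, ‖x t - x₀‖ ≤ M * ‖x 0 - x₀‖ * Real.exp (-rate * t))
    (y : E) {t : ℝ} (ht : 0 ≤ t) :
    ‖NormedSpace.exp (t • fderiv ℝ F x₀) y‖ ≤ M * ‖y‖ * Real.exp (-rate * t) := by
  have : CompleteSpace E := FiniteDimensional.complete ℝ E
  set A := fderiv ℝ F x₀ with hA
  have hexp1 : ∀ s : ℝ, 0 ≤ s → Real.exp (-rate * s) ≤ 1 := fun s hs =>
    Real.exp_le_one_iff.2 (by nlinarith)
  have key : ∀ ν : ℝ, 0 < ν → ‖NormedSpace.exp (t • A) y‖ ≤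
      M * ‖y‖ * Real.exp (-rate * t) + gronwallBound 0 ‖A‖₊ (ν * (M * ‖y‖) + 0) (t - 0) := by
    intro ν hν
    have hdiff : HasFDerivAt F A x₀ := (hF.differentiable one_ne_zero x₀).hasFDerivAt
    have hlo := (hasFDerivAt_iff_isLittleO.1 hdiff).def hν
    obtain ⟨η, hη, hηball⟩ := Metric.eventually_nhds_iff_ball.1 hlo
    -- So small that the solution from `x₀ + ε • y` starts within `radius` and, by stability, never
    -- leaves the `η`-ball on which `F` differs from its linearization by at most `ν * ‖x - x₀‖`.
    set ε : ℝ := min (η / 2) (radius / 2) / ((M + 1) * (‖y‖ + 1)) with hε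
    have hmin : 0 < min (η / 2) (radius / 2) := by positivity
    have hy0 := norm_nonneg y
    have hεpos : 0 < ε := by positivity
    have hεmul : ε * ((M + 1) * (‖y‖ + 1)) = min (η / 2) (radius / 2) := by
      rw [hε]; field_simp
    have hεle : ε * ((M + 1) * (‖y‖ + 1)) ≤ η / 2 := hεmul.trans_le (min_le_left _ _)
    have hεle' : ε * ((M + 1) * (‖y‖ + 1)) ≤ radius / 2 := hεmul.trans_le (min_le_right _ _)
    have hyM : ‖y‖ ≤ (M + 1) * (‖y‖ + 1) := by nlinarith
    have hyM' : M * ‖y‖ ≤ (M + 1) * (‖y‖ + 1) := by nlinarith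
    have hεy : ‖ε • y‖ = ε * ‖y‖ := by rw [norm_smul, Real.norm_of_nonneg hεpos.le]
    have hx0r : ‖(x₀ + ε • y) - x₀‖ < radius := by
      rw [add_sub_cancel_left, hεy]
      nlinarith [mul_le_mul_of_nonneg_left hyM hεpos.le]
    have hbound : ∀ (T : ℝ) (x : ℝ → E), x 0 = x₀ + ε • y →
        (∀ s ∈ Icc 0 T, HasDerivWithinAt x (F (x s)) (Icc 0 T) s) →
        ∀ s ∈ Icc 0 T, ‖x s - x₀‖ ≤ ε * (M * ‖y‖ * Real.exp (-rate * s)) := by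
      intro T x hx0 hx s hs
      have h1 := hstab T x hx (by rw [hx0]; exact hx0r) s hs
      rw [hx0, add_sub_cancel_left, hεy] at h1
      linarith
    have hbound' : ∀ (T : ℝ) (x : ℝ → E), x 0 = x₀ + ε • y →
        (∀ s ∈ Icc 0 T, HasDerivWithinAt x (F (x s)) (Icc 0 T) s) →
        ∀ s ∈ Icc 0 T, ‖x s - x₀‖ < η := by
      intro T x hx0 hx s hs
      refine (hbound T x hx0 hx s hs).trans_lt ?_
      have h2 : M * ‖y‖ * Real.exp (-rate * s) ≤ M * ‖y‖ :=
        mul_le_of_le_one_right (by positivity) (hexp1 s hs.1)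
      nlinarith [mul_le_mul_of_nonneg_left (h2.trans hyM') hεpos.le]
    obtain ⟨x, hx0, hx⟩ := exists_forall_hasDerivWithinAt_Ici_of_apriori (V := fun p => F p.2)
      (c := x₀) (x₀ := x₀ + ε • y) hη (hF.comp contDiff_snd).contDiffOn
      (by
        rw [add_sub_cancel_left, hεy]
        nlinarith [mul_le_mul_of_nonneg_left hyM hεpos.le])
      (fun T x hT hx0 hx _ => hbound' T x hx0 hx T (right_mem_Icc.2 hT))
    have hx' : ∀ s ∈ Icc 0 t, HasDerivWithinAt x (F (x s)) (Icc 0 t) s := fun s hs =>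
      (hx s hs.1).mono Icc_subset_Ici_self
    have hd : ∀ s ∈ Icc 0 t, ‖ε⁻¹ • (x s - x₀)‖ ≤ M * ‖y‖ * Real.exp (-rate * s) := by
      intro s hs
      rw [norm_smul, norm_inv, Real.norm_of_nonneg hεpos.le, inv_mul_le_iff₀ hεpos]
      exact hbound t x hx0 hx' s hs
    -- The rescaled deviation `ε⁻¹ • (x - x₀)` keeps the decay bound and solves the linear equation
    -- up to an error `ν * (M * ‖y‖)`, so Gronwall compares it with the linear flow.
    have hdist := dist_le_of_approx_trajectories_ODE (v := fun _ => A) (K := ‖A‖₊)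
      (f := fun s => ε⁻¹ • (x s - x₀)) (f' := fun s => ε⁻¹ • F (x s))
      (g := fun s => NormedSpace.exp (s • A) y) (g' := fun s => A (NormedSpace.exp (s • A) y))
      (a := 0) (b := t) (εf := ν * (M * ‖y‖)) (εg := 0) (δ := 0)
      (fun _ => A.lipschitz)
      (fun s hs => (((hx' s hs).sub_const x₀).const_smul ε⁻¹).continuousWithinAt)
      (fun s hs => (((hx' s ⟨hs.1, hs.2.le⟩).Ici_of_Icc hs).sub_const x₀).const_smul ε⁻¹)
      (fun s hs => by
        have hs' : s ∈ Icc 0 t := ⟨hs.1, hs.2.le⟩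
        have h1 := hηball (x s) (by
          rw [Metric.mem_ball, dist_eq_norm]; exact hbound' t x hx0 hx' s hs')
        rw [hx₀, sub_zero] at h1
        rw [dist_eq_norm, map_smul, ← smul_sub, norm_smul, norm_inv,
          Real.norm_of_nonneg hεpos.le, inv_mul_le_iff₀ hεpos]
        refine h1.trans ?_
        have h2 := hbound t x hx0 hx' s hs'
        have h3 : M * ‖y‖ * Real.exp (-rate * s) ≤ M * ‖y‖ :=
          mul_le_of_le_one_right (by positivity) (hexp1 s hs.1)
        have h4 := mul_le_mul_of_nonneg_left h3 hεpos.le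
        nlinarith)
      (fun s _ => (hasDerivAt_exp_smul_apply A y s).continuousAt.continuousWithinAt)
      (fun s _ => (hasDerivAt_exp_smul_apply A y s).hasDerivWithinAt)
      (fun s _ => by simp)
      (by simp [hx0, smul_smul, inv_mul_cancel₀ hεpos.ne'])
      t (right_mem_Icc.2 ht)
    have h1 := hd t (right_mem_Icc.2 ht)
    rw [dist_comm, dist_eq_norm] at hdist
    calc ‖NormedSpace.exp (t • A) y‖
        = ‖(NormedSpace.exp (t • A) y - ε⁻¹ • (x t - x₀)) + ε⁻¹ • (x t - x₀)‖ := by simp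
      _ ≤ _ := norm_add_le _ _
      _ ≤ _ := by linarith
  -- The time `t` is fixed, so the Gronwall error vanishes as `ν → 0`.
  have hlim : Tendsto (fun ν : ℝ => M * ‖y‖ * Real.exp (-rate * t) +
      gronwallBound 0 ‖A‖₊ (ν * (M * ‖y‖) + 0) (t - 0)) (𝓝[>] 0)
      (𝓝 (M * ‖y‖ * Real.exp (-rate * t) + gronwallBound 0 ‖A‖₊ (0 * (M * ‖y‖) + 0) (t - 0))) := by
    have hc : Continuous fun ν : ℝ => M * ‖y‖ * Real.exp (-rate * t) +
        gronwallBound 0 ‖A‖₊ (ν * (M * ‖y‖) + 0) (t - 0) :=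
      continuous_const.add ((gronwallBound_continuous_ε 0 ‖A‖₊ (t - 0)).comp (by fun_prop))
    exact (hc.tendsto 0).mono_left nhdsWithin_le_nhds
  have h := ge_of_tendsto hlim (eventually_nhdsWithin_of_forall fun ν hν => key ν hν)
  rwa [zero_mul, zero_add, gronwallBound_ε0_δ0, add_zero] at h

/-- A norm adapted to a linear flow that decays exponentially. -/
theorem exists_adapted_norm [CompleteSpace E] {A : E →L[ℝ] E} {M rate : ℝ}
    (hA : ∀ (y : E) (t : ℝ), 0 ≤ t →
      ‖NormedSpace.exp (t • A) y‖ ≤ M * ‖y‖ * Real.exp (-rate * t)) :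
    ∃ N : E → ℝ, (∀ y, ‖y‖ ≤ N y) ∧ (∀ y, N y ≤ M * ‖y‖) ∧ (∀ x y, N (x + y) ≤ N x + N y) ∧
      ∀ y t, 0 ≤ t → N (NormedSpace.exp (t • A) y) ≤ Real.exp (-rate * t) * N y := by
  -- The adapted norm is the supremum over `t ≥ 0` of `exp (rate * t) * ‖exp (t A) y‖`. Following
  -- the flow only shifts the parameter, which gives decay with constant one instead of `M`.
  let φ : E → Ici (0 : ℝ) → ℝ := fun y t =>
    Real.exp (rate * t) * ‖NormedSpace.exp ((t : ℝ) • A) y‖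
  have hφ : ∀ y t, φ y t ≤ M * ‖y‖ := by
    intro y t
    calc φ y t ≤ Real.exp (rate * t) * (M * ‖y‖ * Real.exp (-rate * t)) := by
          simp only [φ]; gcongr; exact hA y t t.2
      _ = M * ‖y‖ * (Real.exp (rate * t) * Real.exp (-rate * t)) := by ring
      _ = M * ‖y‖ := by rw [← Real.exp_add]; simp
  have hbdd : ∀ y, BddAbove (range (φ y)) := fun y => ⟨M * ‖y‖, by
    rintro _ ⟨t, rfl⟩; exact hφ y t⟩
  refine ⟨fun y => ⨆ t, φ y t, fun y => ?_, fun y => ciSup_le (hφ y), fun x y => ?_,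
    fun y t ht => ?_⟩
  · refine le_trans (le_of_eq ?_) (le_ciSup (hbdd y) ⟨0, le_refl (0 : ℝ)⟩)
    simp [φ]
  · refine ciSup_le fun t => ?_
    calc φ (x + y) t ≤ φ x t + φ y t := by
          simp only [φ, map_add, ← mul_add]; gcongr; exact norm_add_le _ _
      _ ≤ _ := add_le_add (le_ciSup (hbdd x) t) (le_ciSup (hbdd y) t)
  · refine ciSup_le fun s => ?_
    have hs : 0 ≤ (s : ℝ) + t := add_nonneg s.2 ht
    let : NormedAlgebra ℚ (E →L[ℝ] E) := .restrictScalars ℚ ℝ _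
    have hcomm : NormedSpace.exp ((s : ℝ) • A) (NormedSpace.exp (t • A) y) =
        NormedSpace.exp (((s : ℝ) + t) • A) y := by
      rw [add_smul, NormedSpace.exp_add_of_commute
        (((Commute.refl A).smul_left _).smul_right _)]
      rfl
    calc φ (NormedSpace.exp (t • A) y) s
        = Real.exp (-rate * t) * φ y ⟨(s : ℝ) + t, hs⟩ := by
          simp only [φ, hcomm]
          rw [← mul_assoc, ← Real.exp_add]
          congr 2; ring
      _ ≤ _ := by gcongr; exact le_ciSup (hbdd y) _

end Linearization

/-- `N` need not be differentiable, but a majorant that touches at `t` bounds its Dini derivative.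
Such a majorant comes from splitting `y s` into the linear flow started at `y t`, on which `N`
decays, and a remainder whose velocity at `t` is exactly `b`. -/
theorem DiniLE.of_adapted_norm {E : Type*} [NormedAddCommGroup E] [InnerProductSpace ℝ E]
    [CompleteSpace E] {A : E →L[ℝ] E} {M rate : ℝ} {N : E → ℝ} (hM : 0 ≤ M)
    (hNM : ∀ y, N y ≤ M * ‖y‖) (hadd : ∀ x y, N (x + y) ≤ N x + N y)
    (hdecay : ∀ y t, 0 ≤ t → N (NormedSpace.exp (t • A) y) ≤ Real.exp (-rate * t) * N y)
    {y : ℝ → E} {b : E} {t k : ℝ} (hk : 0 ≤ k)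
    (hy : HasDerivWithinAt y (k • A (y t) + b) (Ici t) t) :
    DiniLE (fun s => N (y s)) (-rate * k * N (y t) + M * ‖b‖) t := by
  have h1 : HasDerivWithinAt (fun s => y s - NormedSpace.exp ((k * (s - t)) • A) (y t))
      (0 + b) (Ici t) t := by
    have h2 : HasDerivAt (fun s : ℝ => k * (s - t)) k t := by
      simpa using ((hasDerivAt_id t).sub_const t).const_mul k
    have h3 : HasDerivAt (fun s : ℝ => NormedSpace.exp ((k * (s - t)) • A) (y t))
        (k • A (y t)) t := by
      have := HasDerivAt.scomp t (hasDerivAt_exp_smul_apply A (y t) (k * (t - t))) h2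
      simpa [Function.comp_def] using this
    exact (hy.sub h3.hasDerivWithinAt).congr_deriv (by abel)
  have h4 : DiniLE (fun s => ‖y s - NormedSpace.exp ((k * (s - t)) • A) (y t)‖) ‖b‖ t := by
    have := DiniLE.norm_of_hasDerivWithinAt (k := 0) (ε := ‖b‖) h1 (by simp) (by simp) le_rfl
    simpa using this
  have h5 : DiniLE (fun s => Real.exp (-rate * (k * (s - t))) * N (y t))
      (-rate * k * N (y t)) t := by
    have h2 : HasDerivAt (fun s : ℝ => Real.exp (-rate * (k * (s - t))) * N (y t))
        (-rate * k * N (y t)) t := by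
      have := (((((hasDerivAt_id t).sub_const t).const_mul k).const_mul (-rate)).exp).mul_const
        (N (y t))
      simpa using this
    exact h2.hasDerivWithinAt.diniLE
  refine (h5.add (h4.const_mul hM)).of_le (by simp) fun s hs => ?_
  calc N (y s) = N (NormedSpace.exp ((k * (s - t)) • A) (y t) +
        (y s - NormedSpace.exp ((k * (s - t)) • A) (y t))) := by simp
    _ ≤ _ := hadd _ _
    _ ≤ _ := add_le_add (hdecay _ _ (mul_nonneg hk (sub_nonneg.2 hs))) (hNM _)

/-! ### Bounded primitives of products of sines. -/

/-- `f` has a bounded primitive. -/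
def HasBoundedPrimitive (f : ℝ → ℝ) : Prop :=
  ∃ (F : ℝ → ℝ) (C : ℝ), (∀ t, HasDerivAt F (f t) t) ∧ ∀ t, |F t| ≤ C

namespace HasBoundedPrimitive

variable {f g : ℝ → ℝ}

theorem add (hf : HasBoundedPrimitive f) (hg : HasBoundedPrimitive g) :
    HasBoundedPrimitive fun t => f t + g t := by
  obtain ⟨F, C, hF, hC⟩ := hf
  obtain ⟨G, D, hG, hD⟩ := hg
  exact ⟨fun t => F t + G t, C + D, fun t => (hF t).add (hG t),
    fun t => (abs_add_le _ _).trans (add_le_add (hC t) (hD t))⟩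

theorem const_mul (hf : HasBoundedPrimitive f) (k : ℝ) :
    HasBoundedPrimitive fun t => k * f t := by
  obtain ⟨F, C, hF, hC⟩ := hf
  exact ⟨fun t => k * F t, |k| * C, fun t => (hF t).const_mul k,
    fun t => by rw [abs_mul]; gcongr; exact hC t⟩

theorem sin (k : ℝ) : HasBoundedPrimitive fun t => Real.sin (k * t) := by
  rcases eq_or_ne k 0 with rfl | hk
  · exact ⟨fun _ => 0, 0, fun t => by simpa using hasDerivAt_const t (0 : ℝ), by simp⟩
  · refine ⟨fun t => -k⁻¹ * Real.cos (k * t), |k⁻¹|, fun t => ?_, fun t => ?_⟩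
    · have := (((hasDerivAt_id t).const_mul k).cos).const_mul (-k⁻¹)
      refine this.congr_deriv ?_
      simp; field_simp
    · rw [abs_mul, abs_neg]
      exact mul_le_of_le_one_right (abs_nonneg _) (Real.abs_cos_le_one _)

theorem cos {k : ℝ} (hk : k ≠ 0) : HasBoundedPrimitive fun t => Real.cos (k * t) := by
  refine ⟨fun t => k⁻¹ * Real.sin (k * t), |k⁻¹|, fun t => ?_, fun t => ?_⟩
  · have := (((hasDerivAt_id t).const_mul k).sin).const_mul k⁻¹
    refine this.congr_deriv ?_
    simp; field_simp
  · rw [abs_mul]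
    exact mul_le_of_le_one_right (abs_nonneg _) (Real.abs_sin_le_one _)

theorem sin_mul_sin_self {k : ℝ} (hk : k ≠ 0) :
    HasBoundedPrimitive fun t => Real.sin (k * t) * Real.sin (k * t) - 1 / 2 := by
  convert (cos (k := 2 * k) (by simpa using hk)).const_mul (-1 / 2) using 2 with t
  rw [mul_assoc, Real.cos_two_mul]
  linear_combination Real.sin_sq_add_cos_sq (k * t)

theorem sin_mul_sin {k m : ℝ} (hk : 0 < k) (hm : 0 < m) (hkm : k ≠ m) :
    HasBoundedPrimitive fun t => Real.sin (k * t) * Real.sin (m * t) := by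
  convert ((cos (sub_ne_zero.2 hkm)).const_mul (1 / 2)).add
    ((cos (k := k + m) (by positivity)).const_mul (-1 / 2)) using 2 with t
  rw [sub_mul, add_mul, Real.cos_sub, Real.cos_add]
  ring

/-- A product of three sines is a combination of sines, without cosines. A vanishing combined
frequency is therefore harmless, since `sin 0 = 0`; this is why no condition on resonances appears.
-/
theorem sin_mul_sin_mul_sin (k m n : ℝ) : HasBoundedPrimitive fun t =>
    Real.sin (k * t) * Real.sin (m * t) * Real.sin (n * t) := by
  convert ((((sin (k + m - n)).add (sin (k - m + n))).add (sin (m + n - k))).add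
    ((sin (k + m + n)).const_mul (-1))).const_mul (1 / 4) using 2 with t
  simp only [sub_mul, add_mul, Real.sin_sub, Real.sin_add, Real.cos_add, Real.cos_sub]
  ring

end HasBoundedPrimitive

/-! ### Quantitative smoothness of the cost. -/

/-- Quantitative smoothness of a function `g` with a critical zero at the origin and Hessian `H`
there. -/
structure HessianBounds {E : Type*} [NormedAddCommGroup E] [NormedSpace ℝ E] (g : E → ℝ)
    (H : E →L[ℝ] E →L[ℝ] ℝ) (C : ℝ) : Prop where
  zero : g 0 = 0
  differentiable : Differentiable ℝ g
  fderiv_zero : fderiv ℝ g 0 = 0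
  fderiv_lip : ∀ s s', ‖s‖ ≤ 2 → ‖s'‖ ≤ 2 → ‖fderiv ℝ g s - fderiv ℝ g s'‖ ≤ C * ‖s - s'‖
  shift : ∀ s s' p R, ‖s‖ ≤ R → ‖s'‖ ≤ R → R ≤ 1 → ‖p‖ ≤ 1 →
    |g (s + p) - g (s' + p) - (g s - g s') - H p (s - s')| ≤ C * (R + ‖p‖) * ‖p‖ * ‖s - s'‖
  taylor : ∀ p, ‖p‖ ≤ 1 → |g p - 1 / 2 * H p p| ≤ C * ‖p‖ ^ 3
  norm_le : ‖H‖ ≤ C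

/-- All bounds follow from Lipschitz constants of the first two derivatives on the ball of radius
`2`, which contains `s + p` whenever `s` and `p` lie in the unit ball. -/
theorem exists_hessianBounds {E : Type*} [NormedAddCommGroup E] [NormedSpace ℝ E]
    [FiniteDimensional ℝ E] {g : E → ℝ} (hg : ContDiff ℝ 3 g) (h0 : g 0 = 0)
    (h1 : fderiv ℝ g 0 = 0) :
    ∃ C, 0 ≤ C ∧ HessianBounds g (fderiv ℝ (fderiv ℝ g) 0) C := by
  set H := fderiv ℝ (fderiv ℝ g) 0 with hH
  have hg1 : ContDiff ℝ 2 (fderiv ℝ g) := hg.fderiv_right (by norm_num)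
  have hg2 : ContDiff ℝ 1 (fderiv ℝ (fderiv ℝ g)) := hg1.fderiv_right (by norm_num)
  have hdiff : Differentiable ℝ g := hg.differentiable (by norm_num)
  have hdiff1 : Differentiable ℝ (fderiv ℝ g) := hg1.differentiable (by norm_num)
  obtain ⟨K, hK⟩ := (hg1.of_le (by norm_num) : ContDiff ℝ 1 _).contDiffOn
    |>.exists_lipschitzOnWith_of_isCompact_of_convex isOpen_univ (subset_univ _)
    (isCompact_closedBall (0 : E) 2) (convex_closedBall _ _)
  obtain ⟨K', hK'⟩ := hg2.contDiffOn
    |>.exists_lipschitzOnWith_of_isCompact_of_convex isOpen_univ (subset_univ _)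
    (isCompact_closedBall (0 : E) 2) (convex_closedBall _ _)
  set C : ℝ := K + K' + ‖H‖ with hC
  have hC0 : 0 ≤ C := by positivity
  have hKC : (K : ℝ) ≤ C := by
    have := norm_nonneg H; have := K'.coe_nonneg; linarith
  have hKC' : (K' : ℝ) ≤ C := by
    have := norm_nonneg H; have := K.coe_nonneg; linarith
  have hsecond : ∀ x, ‖x‖ ≤ 2 → ‖fderiv ℝ (fderiv ℝ g) x - H‖ ≤ C * ‖x‖ := by
    intro x hx
    have := hK'.norm_sub_le (x := x) (y := 0) (by simpa using hx) (by simp)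
    rw [sub_zero] at this
    exact this.trans (by gcongr)
  have hfirst : ∀ (x y : E) (r : ℝ), ‖x‖ ≤ r → ‖y‖ ≤ r → r ≤ 2 →
      ‖fderiv ℝ g y - fderiv ℝ g x - H (y - x)‖ ≤ C * r * ‖y - x‖ := by
    intro x y r hx hy hr
    have hd : ∀ z, DifferentiableAt ℝ (fun z => fderiv ℝ g z - H z) z := fun z =>
      (hdiff1 z).sub H.differentiableAt
    have := (convex_closedBall (0 : E) r).norm_image_sub_le_of_norm_fderiv_le (𝕜 := ℝ)
      (f := fun z => fderiv ℝ g z - H z) (C := C * r) (x := x) (y := y)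
      (fun z _ => hd z) (fun z hz => by
        have hz' : ‖z‖ ≤ r := by simpa using hz
        have h3 : fderiv ℝ (fun z => fderiv ℝ g z - H z) z = fderiv ℝ (fderiv ℝ g) z - H :=
          ((hdiff1 z).hasFDerivAt.sub H.hasFDerivAt).fderiv
        rw [h3]
        exact (hsecond z (hz'.trans hr)).trans (by gcongr))
      (by simpa using hx) (by simpa using hy)
    have heq : fderiv ℝ g y - fderiv ℝ g x - H (y - x) =
        fderiv ℝ g y - H y - (fderiv ℝ g x - H x) := by rw [map_sub]; abel
    rwa [heq]
  refine ⟨C, hC0, h0, hdiff, h1, ?_, ?_, ?_, ?_⟩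
  · intro s s' hs hs'
    exact (hK.norm_sub_le (by simpa using hs) (by simpa using hs')).trans (by gcongr)
  · intro s s' p R hs hs' hR hp
    -- The mean value inequality is applied in `z` to `g (z + p) - g z - H p z`: its derivative is a
    -- first order Taylor remainder of `fderiv ℝ g` in the increment `p`, small of order `(R + ‖p‖)
    -- * ‖p‖`.
    have hder : ∀ z, HasFDerivAt (fun z => g (z + p) - g z - H p z)
        (fderiv ℝ g (z + p) - fderiv ℝ g z - H p) z := fun z => by
      have h3 : HasFDerivAt (fun z => g (z + p)) (fderiv ℝ g (z + p)) z := by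
        have := (hdiff (z + p)).hasFDerivAt.comp z ((hasFDerivAt_id z).add_const p)
        simpa [Function.comp_def] using this
      exact (h3.sub (hdiff z).hasFDerivAt).sub (H p).hasFDerivAt
    have hR0 : 0 ≤ R := (norm_nonneg s).trans hs
    have := (convex_closedBall (0 : E) R).norm_image_sub_le_of_norm_hasFDerivWithin_le
      (f := fun z => g (z + p) - g z - H p z) (C := C * (R + ‖p‖) * ‖p‖) (x := s') (y := s)
      (fun z _ => (hder z).hasFDerivWithinAt) (fun z hz => by
        have hz' : ‖z‖ ≤ R := by simpa using hz
        have := hfirst z (z + p) (R + ‖p‖) (by linarith [norm_nonneg p])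
          ((norm_add_le _ _).trans (by linarith)) (by linarith)
        simpa using this)
      (by simpa using hs') (by simpa using hs)
    rw [Real.norm_eq_abs] at this
    convert this using 2
    rw [map_sub]; ring
  · intro p hp
    have hder : ∀ t : ℝ, HasDerivAt (fun t : ℝ => g (t • p) - 1 / 2 * (t ^ 2 * H p p))
        (fderiv ℝ g (t • p) p - t * H p p) t := fun t => by
      have h3 : HasDerivAt (fun t : ℝ => g (t • p)) (fderiv ℝ g (t • p) p) t := by
        have h4 : HasDerivAt (fun t : ℝ => t • p) p t := by
          simpa using (hasDerivAt_id t).smul_const p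
        exact (hdiff (t • p)).hasFDerivAt.comp_hasDerivAt t h4
      refine (h3.sub (((hasDerivAt_pow 2 t).mul_const (H p p)).const_mul (1 / 2))).congr_deriv ?_
      simp; ring
    have := (convex_Icc (0 : ℝ) 1).norm_image_sub_le_of_norm_hasDerivWithin_le
      (f := fun t : ℝ => g (t • p) - 1 / 2 * (t ^ 2 * H p p)) (C := C * ‖p‖ ^ 3)
      (fun t _ => (hder t).hasDerivWithinAt) (x := 0) (y := 1) (fun t ht => by
        have htp : ‖t • p‖ ≤ ‖p‖ := by
          rw [norm_smul, Real.norm_of_nonneg ht.1]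
          exact mul_le_of_le_one_left (norm_nonneg _) ht.2
        have h3 := hfirst 0 (t • p) ‖p‖ (by simp) htp (by linarith)
        rw [h1, sub_zero, sub_zero] at h3
        have h4 : fderiv ℝ g (t • p) p - t * H p p = (fderiv ℝ g (t • p) - H (t • p)) p := by
          simp
        rw [h4]
        calc _ ≤ ‖fderiv ℝ g (t • p) - H (t • p)‖ * ‖p‖ := ContinuousLinearMap.le_opNorm _ _
          _ ≤ C * ‖p‖ * ‖p‖ * ‖p‖ := by gcongr; exact h3.trans (by gcongr)
          _ = _ := by ring)
      (by simp) (by simp)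
    simpa [h0] using this
  · have := K.coe_nonneg; have := K'.coe_nonneg; linarith

/-! ### Componentwise estimates in the plane. -/

theorem Plane.norm_le_of_abs_le {v : Plane} {b : ℝ} (h : ∀ i, |v i| ≤ b) : ‖v‖ ≤ 2 * b := by
  have hb : 0 ≤ b := (abs_nonneg _).trans (h 0)
  rw [EuclideanSpace.norm_eq, Fin.sum_univ_two]
  refine Real.sqrt_le_iff.2 ⟨by positivity, ?_⟩
  have h0 := h 0
  have h1 := h 1
  simp only [Real.norm_eq_abs]
  nlinarith [abs_nonneg (v 0), abs_nonneg (v 1)]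

theorem Plane.abs_apply_le (v : Plane) (i : Fin 2) : |v i| ≤ ‖v‖ := PiLp.norm_apply_le v i

theorem Plane.eq_sum_single (v : Plane) :
    v = ∑ j, v j • EuclideanSpace.single j (1 : ℝ) := by
  ext i; fin_cases i <;> simp

theorem Plane.bilin_eq_sum (H : Plane →L[ℝ] Plane →L[ℝ] ℝ) (v w : Plane) :
    H v w = ∑ j, v j * H (EuclideanSpace.single j 1) w := by
  conv_lhs => rw [Plane.eq_sum_single v]
  simp

theorem Plane.abs_bilin_le (H : Plane →L[ℝ] Plane →L[ℝ] ℝ) {C : ℝ} (hH : ‖H‖ ≤ C) (v w : Plane) :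
    |H v w| ≤ C * ‖v‖ * ‖w‖ :=
  (H.le_opNorm₂ v w).trans (by gcongr)

/-- Componentwise form of the decay of the norm of a plane curve. -/
theorem DiniLE.plane_norm {v : ℝ → Plane} {w b : Plane} {t k ε : ℝ}
    (hv : ∀ i, HasDerivWithinAt (fun s => v s i) (w i + b i) (Ici t) t)
    (hw : ∑ i, v t i * w i ≤ -k * ‖v t‖ ^ 2) (hw0 : v t = 0 → w = 0) (hb : ∀ i, |b i| ≤ ε) :
    DiniLE (fun s => ‖v s‖) (-k * ‖v t‖ + 2 * ε) t := by
  refine DiniLE.norm_of_hasDerivWithinAt (w := w) (b := b) ?_ ?_ hw0 (Plane.norm_le_of_abs_le hb)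
  · rw [hasDerivWithinAt_iff_hasFDerivWithinAt, hasFDerivWithinAt_euclidean]
    intro i
    exact (hv i).hasFDerivWithinAt.congr_fderiv (by ext; simp)
  · refine le_trans (le_of_eq ?_) hw
    simp [PiLp.inner_apply, mul_comm]

/-- Decay with a diagonal rate matrix. -/
theorem DiniLE.plane_norm_diag {v : ℝ → Plane} {d b : Fin 2 → ℝ} {t k δ ε : ℝ} (hδ : 0 ≤ δ)
    (hd : ∀ i, k ≤ d i)
    (hv : ∀ i, HasDerivWithinAt (fun s => v s i) (-(δ * d i * v t i) + b i) (Ici t) t)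
    (hb : ∀ i, |b i| ≤ δ * ε) :
    DiniLE (fun s => ‖v s‖) (δ * (-k * ‖v t‖ + 2 * ε)) t := by
  have h := DiniLE.plane_norm (w := WithLp.toLp 2 fun i => -(δ * d i * v t i))
    (b := WithLp.toLp 2 b) (k := δ * k) (ε := δ * ε) hv ?_ ?_ hb
  · exact h.mono (le_of_eq (by ring))
  · rw [EuclideanSpace.real_norm_sq_eq, Finset.mul_sum]
    refine Finset.sum_le_sum fun i _ => ?_
    have := mul_le_mul_of_nonneg_left (hd i) (mul_nonneg hδ (sq_nonneg (v t i)))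
    simp only
    nlinarith
  · intro h0
    ext i
    simp [h0]

/-- The components of a controller trajectory. -/
theorem hasDerivWithinAt_escState_components {c : EscConstants} {z : ℝ → EscState}
    {δ w τ : ℝ} {s : Set ℝ} (hz : HasDerivWithinAt z (δ • escField c τ w (z τ)) s τ) (i : Fin 2) :
    HasDerivWithinAt (fun t => (z t).2.1 i)
        (δ * c.lowpass i * ((w - (z τ).2.2.1 i) * Real.sin (c.freq i * τ) - (z τ).2.1 i)) s τ ∧
      HasDerivWithinAt (fun t => (z t).2.2.1 i) (δ * c.highpass i * (w - (z τ).2.2.1 i)) s τ ∧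
      HasDerivWithinAt (fun t => (z t).2.2.2 i)
        (δ * c.momentRate i * ((z τ).2.1 i ^ 2 - (z τ).2.2.2 i)) s τ := by
  have key : ∀ L : EscState →L[ℝ] ℝ,
      HasDerivWithinAt (fun t => L (z t)) (L (δ • escField c τ w (z τ))) s τ := fun L =>
    L.hasFDerivAt.comp_hasDerivWithinAt τ hz
  let S := ContinuousLinearMap.snd ℝ Plane (Plane × Plane × Plane)
  let S' := ContinuousLinearMap.snd ℝ Plane (Plane × Plane)
  let π : Plane →L[ℝ] ℝ := EuclideanSpace.proj i
  refine ⟨?_, ?_, ?_⟩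
  · exact (key (π ∘L ContinuousLinearMap.fst ℝ Plane (Plane × Plane) ∘L S)).congr_deriv
      (by simp [π, S, escField]; ring)
  · exact (key (π ∘L ContinuousLinearMap.fst ℝ Plane Plane ∘L S' ∘L S)).congr_deriv
      (by simp [π, S, S', escField]; ring)
  · exact (key (π ∘L ContinuousLinearMap.snd ℝ Plane Plane ∘L S' ∘L S)).congr_deriv
      (by simp [π, S, S', escField]; ring)

theorem hasDerivWithinAt_escState_fst {c : EscConstants} {z : ℝ → EscState}
    {δ w τ : ℝ} {s : Set ℝ} (hz : HasDerivWithinAt z (δ • escField c τ w (z τ)) s τ) :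
    HasDerivWithinAt (fun t => (z t).1) (δ • (escField c τ w (z τ)).1) s τ :=
  (ContinuousLinearMap.fst ℝ Plane (Plane × Plane × Plane)).hasFDerivAt.comp_hasDerivWithinAt τ hz

theorem norm_perturbation_le (c : EscConstants) (a : Plane) (τ : ℝ) :
    ‖perturbation c a τ‖ ≤ ‖a‖ := by
  rw [EuclideanSpace.norm_eq, EuclideanSpace.norm_eq]
  refine Real.sqrt_le_sqrt (Finset.sum_le_sum fun i _ => ?_)
  gcongr
  simp only [perturbation, norm_mul]
  exact mul_le_of_le_one_right (norm_nonneg _) (Real.abs_sin_le_one _)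

/-! ### Gap coordinates for two controller trajectories. -/

noncomputable section

/-- Integrator gain of the linearized controller. -/
def EscConstants.linGain (c : EscConstants) (i : Fin 2) : ℝ := c.gain i / Real.sqrt c.ε

/-- Weights that make the averaged slow dynamics dissipative. -/
def EscConstants.weight (c : EscConstants) (a : Plane) (i : Fin 2) : ℝ :=
  Real.sqrt (‖a‖ / (c.linGain i * a i))

/-- Uniform bounds, by one constant, for the data of the controller, for the cost `g` in the
error coordinates with Hessian `H`, and for the primitives `J` of the products of the
demodulation signals. -/
structure EscBounds (c : EscConstants) (g : Plane → ℝ) (H : Plane →L[ℝ] Plane →L[ℝ] ℝ)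
    (J : Fin 2 → Fin 2 → ℝ → ℝ) (C : ℝ) : Prop where
  one_le : 1 ≤ C
  hess : HessianBounds g H C
  coercive : ∀ v, C⁻¹ * ‖v‖ ^ 2 ≤ H v v
  lowpass_le : ∀ i, c.lowpass i ≤ C
  highpass_le : ∀ i, c.highpass i ≤ C
  momentRate_le : ∀ i, c.momentRate i ≤ C
  linGain_le : ∀ i, c.linGain i ≤ C
  freq_le : ∀ i, c.freq i ≤ C
  le_lowpass : ∀ i, C⁻¹ ≤ c.lowpass i
  le_highpass : ∀ i, C⁻¹ ≤ c.highpass i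
  le_momentRate : ∀ i, C⁻¹ ≤ c.momentRate i
  freq_inv_le : ∀ i, (c.freq i)⁻¹ ≤ C
  lowpass_inv_le : ∀ i, (c.lowpass i)⁻¹ ≤ C
  normalization : ∀ i R q q' m m', R ≤ C⁻¹ → |m| ≤ R → |m'| ≤ R →
    |c.gain i * q / Real.sqrt (m + c.ε) - c.gain i * q' / Real.sqrt (m' + c.ε)
      - c.linGain i * (q - q')| ≤ C * (R * |q - q'| + |q'| * |m - m'|)
  primitive : ∀ i j τ, HasDerivAt (J i j)
    (Real.sin (c.freq j * τ) * Real.sin (c.freq i * τ) - if i = j then 1 / 2 else 0) τ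
  primitive_le : ∀ i j τ, |J i j τ| ≤ C

/-- Gap of `cost - η` between two controller trajectories. -/
def gapU (g : Plane → ℝ) (z zh : ℝ → EscState) (τ : ℝ) : Plane :=
  WithLp.toLp 2 fun i => g (z τ).1 - g (zh τ).1 - ((z τ).2.2.1 i - (zh τ).2.2.1 i)

/-- Gap of the gradient estimates of two controller trajectories, freed of its oscillation. -/
def gapK (c : EscConstants) (g : Plane → ℝ) (H : Plane →L[ℝ] Plane →L[ℝ] ℝ)
    (J : Fin 2 → Fin 2 → ℝ → ℝ) (a : Plane) (δ : ℝ) (z zh : ℝ → EscState) (Φ : ℝ → Plane)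
    (τ : ℝ) : Plane :=
  WithLp.toLp 2 fun i => (z τ).2.1 i - (zh τ).2.1 i
    + δ * (c.lowpass i * (c.freq i)⁻¹) * (gapU g z zh τ i * Real.cos (c.freq i * τ))
    - δ * c.lowpass i *
      ∑ j, a j * (J i j τ * H (EuclideanSpace.single j 1) ((z τ).1 - (zh τ).1))
    - δ * c.lowpass i * Φ τ i

/-- The slow combination of the gaps of the references and of the gradient estimates. -/
def gapS (c : EscConstants) (g : Plane → ℝ) (H : Plane →L[ℝ] Plane →L[ℝ] ℝ)
    (J : Fin 2 → Fin 2 → ℝ → ℝ) (a : Plane) (δ : ℝ) (z zh : ℝ → EscState) (Φ : ℝ → Plane)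
    (τ : ℝ) : Plane :=
  WithLp.toLp 2 fun i => (z τ).1 i - (zh τ).1 i
    - c.linGain i * (c.lowpass i)⁻¹ * gapK c g H J a δ z zh Φ τ i

/-- The weighted slow gap. -/
def gapW (c : EscConstants) (g : Plane → ℝ) (H : Plane →L[ℝ] Plane →L[ℝ] ℝ)
    (J : Fin 2 → Fin 2 → ℝ → ℝ) (a : Plane) (δ : ℝ) (z zh : ℝ → EscState) (Φ : ℝ → Plane)
    (τ : ℝ) : Plane :=
  WithLp.toLp 2 fun i => c.weight a i * gapS c g H J a δ z zh Φ τ i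

end

/-- Two controller trajectories in the ball of radius `R`, driven by the cost errors `e` and `eh`;
the demodulated error gap is `ε` up to the derivative of `Φ`. -/
structure PairAt (c : EscConstants) (g : Plane → ℝ) (a : Plane) (δ R : ℝ) (z zh : ℝ → EscState)
    (e eh : ℝ) (Φ : ℝ → Plane) (ε : Plane) (τ : ℝ) : Prop where
  left : HasDerivWithinAt z
    (δ • escField c τ (g ((z τ).1 + perturbation c a τ) + e) (z τ)) (Ici τ) τ
  right : HasDerivWithinAt zh
    (δ • escField c τ (g ((zh τ).1 + perturbation c a τ) + eh) (zh τ)) (Ici τ) τ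
  forcing : ∀ i, HasDerivWithinAt (fun s => Φ s i)
    ((e - eh) * Real.sin (c.freq i * τ) - ε i) (Ici τ) τ
  left_le : ‖z τ‖ ≤ R
  right_le : ‖zh τ‖ ≤ R

/-! ### Equations of motion of the gaps. -/

section Pair

variable {c : EscConstants} {g : Plane → ℝ} {H : Plane →L[ℝ] Plane →L[ℝ] ℝ}
  {J : Fin 2 → Fin 2 → ℝ → ℝ} {C : ℝ} {a : Plane} {δ R : ℝ} {z zh : ℝ → EscState} {e eh : ℝ}
  {Φ : ℝ → Plane} {ε : Plane} {τ : ℝ}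

theorem EscState.norms_le {z : EscState} {R : ℝ} (h : ‖z‖ ≤ R) :
    ‖z.1‖ ≤ R ∧ ‖z.2.1‖ ≤ R ∧ ‖z.2.2.1‖ ≤ R ∧ ‖z.2.2.2‖ ≤ R := by
  simp only [Prod.norm_def, sup_le_iff] at h
  exact ⟨h.1, h.2.1, h.2.2.1, h.2.2.2⟩

theorem EscBounds.pos (hb : EscBounds c g H J C) : 0 < C := one_pos.trans_le hb.one_le

theorem EscBounds.linGain_pos (c : EscConstants) (i : Fin 2) : 0 < c.linGain i :=
  div_pos (c.gain_pos i) (Real.sqrt_pos.2 c.ε_pos)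

/-- The velocity of the reference error is controlled by the gradient estimate. -/
theorem EscBounds.norm_fst_le (hb : EscBounds c g H J C) (hR : R ≤ C⁻¹) (z : EscState)
    (hz : ‖z‖ ≤ R) (w : ℝ) : ‖(escField c τ w z).1‖ ≤ 4 * C * ‖z.2.1‖ := by
  obtain ⟨-, -, -, hm⟩ := EscState.norms_le hz
  have hC := hb.one_le
  have hR1 : R ≤ 1 := hR.trans (inv_le_one_of_one_le₀ hC)
  have hR0 : 0 ≤ R := (norm_nonneg _).trans hz
  have := Plane.norm_le_of_abs_le (v := (escField c τ w z).1) (b := 2 * C * ‖z.2.1‖) fun i => by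
    have h1 := hb.normalization i R (z.2.1 i) 0 (z.2.2.2 i) 0 hR
      ((Plane.abs_apply_le _ i).trans hm) (by simpa using hR0)
    simp only [mul_zero, zero_div, sub_zero, abs_zero, zero_mul, add_zero] at h1
    have h2 := Plane.abs_apply_le z.2.1 i
    have h3 := EscBounds.linGain_pos c i
    have h4 : |c.linGain i * z.2.1 i| ≤ C * ‖z.2.1‖ := by
      rw [abs_mul, abs_of_pos h3]; gcongr; exact hb.linGain_le i
    have h5 : C * (R * |z.2.1 i|) ≤ C * ‖z.2.1‖ := by
      gcongr; nlinarith [abs_nonneg (z.2.1 i)]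
    have h6 : (escField c τ w z).1 i = -(c.gain i * z.2.1 i / √(z.2.2.2 i + c.ε)) := by
      simp [escField, neg_div]
    rw [h6, abs_neg]
    have h7 := abs_sub_abs_le_abs_sub (c.gain i * z.2.1 i / √(z.2.2.2 i + c.ε))
      (c.linGain i * z.2.1 i)
    linarith
  linarith

namespace PairAt

/-- The normalization error in the velocity of the reference gap. -/
theorem abs_fst_gap_le (h : PairAt c g a δ R z zh e eh Φ ε τ) (hb : EscBounds c g H J C)
    (hR : R ≤ C⁻¹) (w w' : ℝ) (i : Fin 2) :
    |(escField c τ w (z τ)).1 i - (escField c τ w' (zh τ)).1 i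
        + c.linGain i * ((z τ).2.1 i - (zh τ).2.1 i)| ≤
      C * (R * ‖(z τ).2.1 - (zh τ).2.1‖ + ‖(zh τ).2.1‖ * ‖(z τ).2.2.2 - (zh τ).2.2.2‖) := by
  obtain ⟨-, -, -, hm⟩ := EscState.norms_le h.left_le
  obtain ⟨-, -, -, hm'⟩ := EscState.norms_le h.right_le
  have hR0 : 0 ≤ R := (norm_nonneg _).trans h.left_le
  have h1 := hb.normalization i R ((z τ).2.1 i) ((zh τ).2.1 i) ((z τ).2.2.2 i) ((zh τ).2.2.2 i) hR
      ((Plane.abs_apply_le _ i).trans hm) ((Plane.abs_apply_le _ i).trans hm')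
  have hC := hb.pos
  have h6 : (escField c τ w (z τ)).1 i - (escField c τ w' (zh τ)).1 i
        + c.linGain i * ((z τ).2.1 i - (zh τ).2.1 i) =
      -(c.gain i * (z τ).2.1 i / √((z τ).2.2.2 i + c.ε) -
        c.gain i * (zh τ).2.1 i / √((zh τ).2.2.2 i + c.ε) -
        c.linGain i * ((z τ).2.1 i - (zh τ).2.1 i)) := by
    simp [escField]; ring
  rw [h6, abs_neg]
  refine h1.trans ?_
  have h2 := Plane.abs_apply_le ((z τ).2.1 - (zh τ).2.1) i
  have h3 := Plane.abs_apply_le ((z τ).2.2.2 - (zh τ).2.2.2) i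
  have h4 := Plane.abs_apply_le ((zh τ).2.1) i
  simp only [PiLp.sub_apply] at h2 h3
  gcongr

/-- The velocity of the reference gap. -/
theorem norm_fst_gap_le (h : PairAt c g a δ R z zh e eh Φ ε τ) (hb : EscBounds c g H J C)
    (hR : R ≤ C⁻¹) (w w' : ℝ) :
    ‖(escField c τ w (z τ)).1 - (escField c τ w' (zh τ)).1‖ ≤
      4 * C * (‖(z τ).2.1 - (zh τ).2.1‖ + ‖(zh τ).2.1‖ * ‖(z τ).2.2.2 - (zh τ).2.2.2‖) := by
  have hC := hb.one_le
  have hR1 : R ≤ 1 := hR.trans (inv_le_one_of_one_le₀ hC)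
  set nk := ‖(z τ).2.1 - (zh τ).2.1‖ with hnk
  set nqm := ‖(zh τ).2.1‖ * ‖(z τ).2.2.2 - (zh τ).2.2.2‖ with hnqm
  have hnk0 : 0 ≤ nk := norm_nonneg _
  have hnqm0 : 0 ≤ nqm := by positivity
  have := Plane.norm_le_of_abs_le (v := (escField c τ w (z τ)).1 - (escField c τ w' (zh τ)).1)
    (b := 2 * C * (nk + nqm)) fun i => by
      have h1 := h.abs_fst_gap_le hb hR w w' i
      have h2 := Plane.abs_apply_le ((z τ).2.1 - (zh τ).2.1) i
      have h4 : |c.linGain i * ((z τ).2.1 i - (zh τ).2.1 i)| ≤ C * nk := by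
        rw [abs_mul, abs_of_pos (EscBounds.linGain_pos c i)]
        gcongr
        · exact hb.linGain_le i
        · simpa using h2
      have h5 := abs_sub_abs_le_abs_sub ((escField c τ w (z τ)).1 i - (escField c τ w' (zh τ)).1 i)
        (-(c.linGain i * ((z τ).2.1 i - (zh τ).2.1 i)))
      rw [sub_neg_eq_add, abs_neg] at h5
      rw [PiLp.sub_apply]
      have h6 : C * (R * nk) ≤ C * nk := by gcongr; nlinarith
      nlinarith [mul_nonneg hb.pos.le hnqm0]
  linarith

/-- Velocity of the gap of the unperturbed costs. -/
theorem exists_cost_gap_deriv (h : PairAt c g a δ R z zh e eh Φ ε τ) (hb : EscBounds c g H J C)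
    (hR : R ≤ C⁻¹) (hδ : 0 ≤ δ) :
    ∃ G' : ℝ, HasDerivWithinAt (fun t => g (z t).1 - g (zh t).1) G' (Ici τ) τ ∧
      |G'| ≤ 4 * C ^ 2 * δ * (R * ‖(z τ).2.1 - (zh τ).2.1‖ +
        R * ‖(z τ).2.2.2 - (zh τ).2.2.2‖ + ‖(zh τ).2.1‖ * ‖(z τ).1 - (zh τ).1‖) := by
  have hC := hb.one_le
  have hC0 := hb.pos
  have hR1 : R ≤ 1 := hR.trans (inv_le_one_of_one_le₀ hC)
  have hR0 : 0 ≤ R := (norm_nonneg _).trans h.left_le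
  obtain ⟨hr, -, -, -⟩ := EscState.norms_le h.left_le
  obtain ⟨hr', hq', -, -⟩ := EscState.norms_le h.right_le
  set v := (escField c τ (g ((z τ).1 + perturbation c a τ) + e) (z τ)).1 with hv
  set v' := (escField c τ (g ((zh τ).1 + perturbation c a τ) + eh) (zh τ)).1 with hv'
  have h1 := ((hb.hess.differentiable (z τ).1).hasFDerivAt.comp_hasDerivWithinAt τ
    (hasDerivWithinAt_escState_fst h.left)).sub
    ((hb.hess.differentiable (zh τ).1).hasFDerivAt.comp_hasDerivWithinAt τ
    (hasDerivWithinAt_escState_fst h.right))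
  refine ⟨_, h1, ?_⟩
  -- Telescoping: the first summand is small because the gradient of `g` is of order `R` near its
  -- critical point, the second because the two gradients differ by at most a multiple of the
  -- reference gap.
  have h2 : fderiv ℝ g (z τ).1 (δ • v) - fderiv ℝ g (zh τ).1 (δ • v') =
      δ * (fderiv ℝ g (z τ).1 (v - v') + (fderiv ℝ g (z τ).1 - fderiv ℝ g (zh τ).1) v') := by
    simp; ring
  rw [h2, abs_mul, abs_of_nonneg hδ]
  have h3 : ‖fderiv ℝ g (z τ).1‖ ≤ C * R := by
    have := hb.hess.fderiv_lip (z τ).1 0 (by linarith) (by simp)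
    rw [hb.hess.fderiv_zero, sub_zero, sub_zero] at this
    exact this.trans (by gcongr)
  have h4 := hb.hess.fderiv_lip (z τ).1 (zh τ).1 (by linarith) (by linarith)
  have h5 : |fderiv ℝ g (z τ).1 (v - v')| ≤ C * R * (4 * C * (‖(z τ).2.1 - (zh τ).2.1‖ +
      ‖(z τ).2.2.2 - (zh τ).2.2.2‖)) := by
    refine ((fderiv ℝ g (z τ).1).le_opNorm _).trans ?_
    gcongr
    refine (h.norm_fst_gap_le hb hR _ _).trans ?_
    gcongr
    exact mul_le_of_le_one_left (norm_nonneg _) (hq'.trans hR1)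
  have h6 : |(fderiv ℝ g (z τ).1 - fderiv ℝ g (zh τ).1) v'| ≤
      C * ‖(z τ).1 - (zh τ).1‖ * (4 * C * ‖(zh τ).2.1‖) := by
    refine ((fderiv ℝ g (z τ).1 - fderiv ℝ g (zh τ).1).le_opNorm _).trans ?_
    gcongr
    exact hb.norm_fst_le hR _ h.right_le _
  have h7 := abs_add_le (fderiv ℝ g (z τ).1 (v - v'))
    ((fderiv ℝ g (z τ).1 - fderiv ℝ g (zh τ).1) v')
  calc δ * _ ≤ δ * (C * R * (4 * C * (‖(z τ).2.1 - (zh τ).2.1‖ +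
      ‖(z τ).2.2.2 - (zh τ).2.2.2‖)) + C * ‖(z τ).1 - (zh τ).1‖ * (4 * C * ‖(zh τ).2.1‖)) := by
        gcongr; linarith
    _ = _ := by ring

end PairAt

end Pair

section Pair

variable {c : EscConstants} {g : Plane → ℝ} {H : Plane →L[ℝ] Plane →L[ℝ] ℝ}
  {J : Fin 2 → Fin 2 → ℝ → ℝ} {C : ℝ} {a : Plane} {δ R : ℝ} {z zh : ℝ → EscState} {e eh : ℝ}
  {Φ : ℝ → Plane} {ε : Plane} {τ : ℝ}

theorem EscBounds.abs_primitive_sum_le (hb : EscBounds c g H J C) (a v : Plane) (i : Fin 2)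
    (τ : ℝ) :
    |∑ j, a j * (J i j τ * H (EuclideanSpace.single j 1) v)| ≤ 2 * C ^ 2 * (‖a‖ * ‖v‖) := by
  have hC := hb.pos
  have key : ∀ j, |a j * (J i j τ * H (EuclideanSpace.single j 1) v)| ≤ ‖a‖ * (C * (C * ‖v‖)) := by
    intro j
    rw [abs_mul, abs_mul]
    have h1 := Plane.abs_bilin_le H hb.hess.norm_le (EuclideanSpace.single j 1) v
    rw [PiLp.norm_single, norm_one, mul_one] at h1
    gcongr
    · exact Plane.abs_apply_le a j
    · exact hb.primitive_le i j τ
  rw [Fin.sum_univ_two]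
  refine (abs_add_le _ _).trans ?_
  nlinarith [key 0, key 1]

theorem abs_mul_le_of_le {x y b : ℝ} (hx : |x| ≤ b) (hy : |y| ≤ 1) : |x * y| ≤ b := by
  rw [abs_mul]
  nlinarith [abs_nonneg x, abs_nonneg y]

namespace PairAt

/-- Second order remainder of the cost gap. -/
theorem abs_shift_le (h : PairAt c g a δ R z zh e eh Φ ε τ) (hb : EscBounds c g H J C)
    (hδ : 0 ≤ δ) (hθ : R + ‖a‖ + δ ≤ C⁻¹) :
    |g ((z τ).1 + perturbation c a τ) - g ((zh τ).1 + perturbation c a τ)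
      - (g (z τ).1 - g (zh τ).1) - H (perturbation c a τ) ((z τ).1 - (zh τ).1)| ≤
      C * ((R + ‖a‖ + δ) * (‖a‖ * ‖(z τ).1 - (zh τ).1‖)) := by
  have hC := hb.pos
  have hC1 : C⁻¹ ≤ 1 := inv_le_one_of_one_le₀ hb.one_le
  have hR0 : 0 ≤ R := (norm_nonneg _).trans h.left_le
  have ha := norm_nonneg a
  have hp := norm_perturbation_le c a τ
  refine (hb.hess.shift _ _ _ R (EscState.norms_le h.left_le).1 (EscState.norms_le h.right_le).1
    (by linarith) (by linarith)).trans ?_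
  rw [mul_assoc, mul_assoc]
  have h1 : R + ‖perturbation c a τ‖ ≤ R + ‖a‖ + δ := by linarith
  have h2 : ‖perturbation c a τ‖ * ‖(z τ).1 - (zh τ).1‖ ≤ ‖a‖ * ‖(z τ).1 - (zh τ).1‖ := by gcongr
  exact mul_le_mul_of_nonneg_left (mul_le_mul h1 h2 (by positivity) (by positivity)) hC.le

/-- The washout filter makes `gapU` decay on its own. Taking the unperturbed costs in `gapU` leaves
as forcing the slow drift of `g`, the first order effect of the perturbation, a shift remainder and
the error gap. -/
theorem exists_gapU_deriv (h : PairAt c g a δ R z zh e eh Φ ε τ) (hb : EscBounds c g H J C)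
    (hδ : 0 ≤ δ) (hθ : R + ‖a‖ + δ ≤ C⁻¹) :
    ∃ E : Fin 2 → ℝ, ∀ i, HasDerivWithinAt (fun t => gapU g z zh t i)
        (-(δ * c.highpass i * gapU g z zh τ i) + E i) (Ici τ) τ ∧
      |E i| ≤ δ * (4 * C ^ 2 * (R * ‖(z τ).2.1 - (zh τ).2.1‖ + R * ‖(z τ).2.2.2 - (zh τ).2.2.2‖ +
        ‖(zh τ).2.1‖ * ‖(z τ).1 - (zh τ).1‖ + ‖a‖ * ‖(z τ).1 - (zh τ).1‖ + |e - eh|)) := by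
  have hC := hb.one_le
  have hC0 := hb.pos
  have hC1 : C⁻¹ ≤ 1 := inv_le_one_of_one_le₀ hb.one_le
  have hR0 : 0 ≤ R := (norm_nonneg _).trans h.left_le
  have ha := norm_nonneg a
  obtain ⟨G', hG', hG'le⟩ := h.exists_cost_gap_deriv hb (by linarith) hδ
  have hshift := h.abs_shift_le hb hδ hθ
  set p := perturbation c a τ with hp
  set ρ := (z τ).1 - (zh τ).1 with hρ
  set E1 := g ((z τ).1 + p) - g ((zh τ).1 + p) - (g (z τ).1 - g (zh τ).1) - H p ρ with hE1
  refine ⟨fun i => G' - δ * c.highpass i * (H p ρ + E1 + (e - eh)), fun i => ⟨?_, ?_⟩⟩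
  · refine (hG'.sub ((hasDerivWithinAt_escState_components h.left i).2.1.sub
      (hasDerivWithinAt_escState_components h.right i).2.1)).congr_deriv ?_
    simp only [gapU, hE1]
    ring
  · have h1 : |H p ρ| ≤ C * (‖a‖ * ‖ρ‖) := by
      refine (Plane.abs_bilin_le H hb.hess.norm_le p ρ).trans ?_
      rw [mul_assoc]; gcongr; exact norm_perturbation_le c a τ
    have h2 : |E1| ≤ C * (‖a‖ * ‖ρ‖) := by
      refine hshift.trans (mul_le_mul_of_nonneg_left ?_ hC0.le)
      exact mul_le_of_le_one_left (by positivity) (hθ.trans hC1)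
    have h3 : |δ * c.highpass i * (H p ρ + E1 + (e - eh))| ≤
        δ * C * (2 * C * (‖a‖ * ‖ρ‖) + |e - eh|) := by
      rw [abs_mul, abs_of_nonneg (mul_nonneg hδ (c.highpass_pos i).le)]
      have h4 : |H p ρ + E1 + (e - eh)| ≤ 2 * C * (‖a‖ * ‖ρ‖) + |e - eh| := by
        refine (abs_add_le _ _).trans ?_
        have := abs_add_le (H p ρ) E1
        linarith
      gcongr
      exact hb.highpass_le i
    refine (abs_sub _ _).trans ((add_le_add hG'le h3).trans ?_)
    have h5 : 0 ≤ δ * (‖a‖ * ‖ρ‖) := by positivity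
    have h6 : 0 ≤ δ * |e - eh| := by positivity
    have h7 : C ≤ 4 * C ^ 2 := by nlinarith
    have h8 := mul_le_mul_of_nonneg_right h7 h6
    have h9 : 0 ≤ C ^ 2 * (δ * (‖a‖ * ‖ρ‖)) := by positivity
    nlinarith

/-- The change of variables is close to the identity: every correction in `gapK` is `δ` times a
bounded oscillation, so passing between the gradient gap and `gapK` costs only terms of order `δ`.
-/
theorem abs_sub_gapK_le (hb : EscBounds c g H J C) (hδ : 0 ≤ δ) (i : Fin 2) :
    |(z τ).2.1 i - (zh τ).2.1 i - gapK c g H J a δ z zh Φ τ i| ≤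
      2 * C ^ 3 * (δ * (‖gapU g z zh τ‖ + ‖a‖ * ‖(z τ).1 - (zh τ).1‖ + ‖Φ τ‖)) := by
  have hC := hb.one_le
  have hC0 := hb.pos
  set S := ∑ j, a j * (J i j τ * H (EuclideanSpace.single j 1) ((z τ).1 - (zh τ).1)) with hS
  have h1 : |gapU g z zh τ i * Real.cos (c.freq i * τ)| ≤ ‖gapU g z zh τ‖ :=
    abs_mul_le_of_le (Plane.abs_apply_le _ i) (Real.abs_cos_le_one _)
  have h2 : |S| ≤ 2 * C ^ 2 * (‖a‖ * ‖(z τ).1 - (zh τ).1‖) :=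
    hb.abs_primitive_sum_le a _ i τ
  have h3 := Plane.abs_apply_le (Φ τ) i
  have hL := hb.lowpass_le i
  have hL0 := (c.lowpass_pos i).le
  have hf0 := inv_nonneg.2 (c.freq_pos i).le
  have heq : (z τ).2.1 i - (zh τ).2.1 i - gapK c g H J a δ z zh Φ τ i =
      δ * (c.lowpass i * (S + Φ τ i - (c.freq i)⁻¹ *
        (gapU g z zh τ i * Real.cos (c.freq i * τ)))) := by
    simp only [gapK, hS]; ring
  rw [heq, abs_mul, abs_mul, abs_of_nonneg hδ, abs_of_nonneg hL0]
  have h4 : |(c.freq i)⁻¹ * (gapU g z zh τ i * Real.cos (c.freq i * τ))| ≤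
      C * ‖gapU g z zh τ‖ := by
    rw [abs_mul, abs_of_nonneg hf0]; gcongr; exact hb.freq_inv_le i
  have h5 : |S + Φ τ i - (c.freq i)⁻¹ * (gapU g z zh τ i * Real.cos (c.freq i * τ))| ≤
      2 * C ^ 2 * (‖gapU g z zh τ‖ + ‖a‖ * ‖(z τ).1 - (zh τ).1‖ + ‖Φ τ‖) := by
    refine (abs_sub _ _).trans ?_
    have h6 := abs_add_le S (Φ τ i)
    have h7 : C * ‖gapU g z zh τ‖ ≤ 2 * C ^ 2 * ‖gapU g z zh τ‖ := by gcongr; nlinarith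
    have h8 : 1 * ‖Φ τ‖ ≤ 2 * C ^ 2 * ‖Φ τ‖ := by gcongr; nlinarith
    linarith
  calc δ * (c.lowpass i * |S + Φ τ i - _|) ≤ δ * (C * (2 * C ^ 2 *
        (‖gapU g z zh τ‖ + ‖a‖ * ‖(z τ).1 - (zh τ).1‖ + ‖Φ τ‖))) := by gcongr
    _ = _ := by ring

theorem norm_sub_gapK_le (hb : EscBounds c g H J C) (hδ : 0 ≤ δ) :
    ‖(z τ).2.1 - (zh τ).2.1 - gapK c g H J a δ z zh Φ τ‖ ≤
      4 * C ^ 3 * (δ * (‖gapU g z zh τ‖ + ‖a‖ * ‖(z τ).1 - (zh τ).1‖ + ‖Φ τ‖)) := by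
  have := Plane.norm_le_of_abs_le (v := (z τ).2.1 - (zh τ).2.1 - gapK c g H J a δ z zh Φ τ)
    fun i => abs_sub_gapK_le (a := a) (z := z) (zh := zh) (Φ := Φ) (τ := τ) hb hδ i
  linarith

/-- The averaging step. The demodulated signal consists of `gapU * sin`, of `H p ρ * sin` and of the
error gap. The three corrections in `gapK` cancel the first, the part of the second without mean,
and the part of the third that is a derivative; only the mean `1/2 * a i * H e_i ρ` and the residual
`Es` survive. In `gapS` the gradient gap cancels between the velocity of the references and that of
`gapK`. The slow variable is then driven directly by the averaged Hessian term. -/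
theorem exists_gapK_gapS_deriv (h : PairAt c g a δ R z zh e eh Φ ε τ)
    (hb : EscBounds c g H J C) (hδ : 0 ≤ δ) (hθ : R + ‖a‖ + δ ≤ C⁻¹) :
    ∃ (E E2 Es : Fin 2 → ℝ) (E1 : ℝ) (ρ' : Plane), ∀ i,
      HasDerivWithinAt (fun t => gapK c g H J a δ z zh Φ t i)
        (-(δ * c.lowpass i * gapK c g H J a δ z zh Φ τ i) + δ * c.lowpass i *
          (1 / 2 * a i * H (EuclideanSpace.single i 1) ((z τ).1 - (zh τ).1)
            - ((z τ).2.1 i - (zh τ).2.1 i - gapK c g H J a δ z zh Φ τ i)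
            + Es i)) (Ici τ) τ ∧
      HasDerivWithinAt (fun t => gapS c g H J a δ z zh Φ t i)
        (-(1 / 2 * δ * c.linGain i * a i * H (EuclideanSpace.single i 1) ((z τ).1 - (zh τ).1))
          + δ * (E2 i - c.linGain i * Es i)) (Ici τ) τ ∧
      |E2 i| ≤ C * (R * ‖(z τ).2.1 - (zh τ).2.1‖ +
        ‖(zh τ).2.1‖ * ‖(z τ).2.2.2 - (zh τ).2.2.2‖) ∧
      Es i = E1 * Real.sin (c.freq i * τ) + ε i
        + (c.freq i)⁻¹ * ((-(δ * c.highpass i * gapU g z zh τ i) + E i) * Real.cos (c.freq i * τ))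
        - ∑ j, a j * (J i j τ * H (EuclideanSpace.single j 1) ρ') ∧
      |E1| ≤ C * ((R + ‖a‖ + δ) * (‖a‖ * ‖(z τ).1 - (zh τ).1‖)) ∧
      |E i| ≤ δ * (4 * C ^ 2 * (R * ‖(z τ).2.1 - (zh τ).2.1‖ + R * ‖(z τ).2.2.2 - (zh τ).2.2.2‖ +
        ‖(zh τ).2.1‖ * ‖(z τ).1 - (zh τ).1‖ + ‖a‖ * ‖(z τ).1 - (zh τ).1‖ + |e - eh|)) ∧
      ‖ρ'‖ ≤ δ * (4 * C * (‖(z τ).2.1 - (zh τ).2.1‖ +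
        ‖(zh τ).2.1‖ * ‖(z τ).2.2.2 - (zh τ).2.2.2‖)) := by
  have hC0 := hb.pos
  have hR : R ≤ C⁻¹ := by linarith [norm_nonneg a]
  obtain ⟨E, hE⟩ := h.exists_gapU_deriv hb hδ hθ
  have hshift := h.abs_shift_le hb hδ hθ
  set p := perturbation c a τ with hp
  set w := g ((z τ).1 + p) + e with hw
  set w' := g ((zh τ).1 + p) + eh with hw'
  set ρ := (z τ).1 - (zh τ).1 with hρ
  set E1 := g ((z τ).1 + p) - g ((zh τ).1 + p) - (g (z τ).1 - g (zh τ).1) - H p ρ with hE1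
  set ρ' := δ • ((escField c τ w (z τ)).1 - (escField c τ w' (zh τ)).1) with hρ'
  have hρder : HasDerivWithinAt (fun t => (z t).1 - (zh t).1) ρ' (Ici τ) τ := by
    refine ((hasDerivWithinAt_escState_fst h.left).sub
      (hasDerivWithinAt_escState_fst h.right)).congr_deriv ?_
    rw [hρ', smul_sub]
  let E2 : Fin 2 → ℝ := fun i => (escField c τ w (z τ)).1 i - (escField c τ w' (zh τ)).1 i
        + c.linGain i * ((z τ).2.1 i - (zh τ).2.1 i)
  let Es : Fin 2 → ℝ := fun i => E1 * Real.sin (c.freq i * τ) + ε i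
        + (c.freq i)⁻¹ * ((-(δ * c.highpass i * gapU g z zh τ i) + E i) * Real.cos (c.freq i * τ))
        - ∑ j, a j * (J i j τ * H (EuclideanSpace.single j 1) ρ')
  refine ⟨E, E2, Es, E1, ρ', fun i => ?_⟩
  have hK : HasDerivWithinAt (fun t => gapK c g H J a δ z zh Φ t i)
        (-(δ * c.lowpass i * gapK c g H J a δ z zh Φ τ i) + δ * c.lowpass i *
          (1 / 2 * a i * H (EuclideanSpace.single i 1) ρ
            - ((z τ).2.1 i - (zh τ).2.1 i - gapK c g H J a δ z zh Φ τ i)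
            + Es i)) (Ici τ) τ := by
    have hcos : HasDerivWithinAt (fun t => Real.cos (c.freq i * t))
        (-(c.freq i * Real.sin (c.freq i * τ))) (Ici τ) τ := by
      have := (((hasDerivAt_id τ).const_mul (c.freq i)).cos).hasDerivWithinAt (s := Ici τ)
      exact this.congr_deriv (by simp [mul_comm])
    have hJ : ∀ j, HasDerivWithinAt
        (fun t => a j * (J i j t * H (EuclideanSpace.single j 1) ((z t).1 - (zh t).1)))
        (a j * ((Real.sin (c.freq j * τ) * Real.sin (c.freq i * τ) - if i = j then 1 / 2 else 0) *
          H (EuclideanSpace.single j 1) ρ + J i j τ * H (EuclideanSpace.single j 1) ρ'))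
        (Ici τ) τ := fun j =>
      (((hb.primitive i j τ).hasDerivWithinAt).mul
        ((H (EuclideanSpace.single j 1)).hasFDerivAt.comp_hasDerivWithinAt τ hρder)).const_mul (a j)
    have hsum := HasDerivWithinAt.fun_sum (u := Finset.univ) fun j _ => hJ j
    have hq := (hasDerivWithinAt_escState_components h.left i).1.sub
      (hasDerivWithinAt_escState_components h.right i).1
    have hpH : H p ρ = ∑ j, a j * Real.sin (c.freq j * τ) * H (EuclideanSpace.single j 1) ρ :=
      Plane.bilin_eq_sum H p ρ
    have hu := ((hE i).1.mul hcos).const_mul (δ * (c.lowpass i * (c.freq i)⁻¹))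
    refine (((hq.add hu).sub (hsum.const_mul (δ * c.lowpass i))).sub
      ((h.forcing i).const_mul (δ * c.lowpass i))).congr_deriv ?_
    -- By the definition of the primitives `J`, only the diagonal product of demodulation signals
    -- has a mean; the terms containing `ρ'` come from differentiating the corrections.
    have hsplit : ∑ j, a j * ((Real.sin (c.freq j * τ) * Real.sin (c.freq i * τ)
          - if i = j then 1 / 2 else 0) *
          H (EuclideanSpace.single j 1) ρ + J i j τ * H (EuclideanSpace.single j 1) ρ') =
        H p ρ * Real.sin (c.freq i * τ) - 1 / 2 * a i * H (EuclideanSpace.single i 1) ρ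
          + ∑ j, a j * (J i j τ * H (EuclideanSpace.single j 1) ρ') := by
      rw [hpH]
      simp only [Fin.sum_univ_two]
      fin_cases i <;> simp <;> ring
    rw [hsplit]
    have hf : (c.freq i)⁻¹ * c.freq i = 1 := inv_mul_cancel₀ (c.freq_pos i).ne'
    have hU : gapU g z zh τ i = g (z τ).1 - g (zh τ).1 - ((z τ).2.2.1 i - (zh τ).2.2.1 i) := rfl
    have hu1 : δ * (c.lowpass i * (c.freq i)⁻¹) *
        (gapU g z zh τ i * -(c.freq i * Real.sin (c.freq i * τ))) =
        -(δ * c.lowpass i * gapU g z zh τ i * Real.sin (c.freq i * τ)) := by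
      linear_combination -(δ * c.lowpass i * gapU g z zh τ i * Real.sin (c.freq i * τ)) * hf
    simp only [Es]
    rw [mul_add (δ * (c.lowpass i * (c.freq i)⁻¹)), hu1, hU]
    simp only [hE1]
    ring
  refine ⟨hK, ?_, h.abs_fst_gap_le hb hR w w' i, rfl, hshift, (hE i).2, ?_⟩
  · have hρi : HasDerivWithinAt (fun t => (z t).1 i - (zh t).1 i) (ρ' i) (Ici τ) τ :=
      (EuclideanSpace.proj (𝕜 := ℝ) i).hasFDerivAt.comp_hasDerivWithinAt τ hρder
    refine (hρi.sub (hK.const_mul (c.linGain i * (c.lowpass i)⁻¹))).congr_deriv ?_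
    have hL : (c.lowpass i)⁻¹ * c.lowpass i = 1 := inv_mul_cancel₀ (c.lowpass_pos i).ne'
    have hρ'i : ρ' i = δ * (E2 i - c.linGain i * ((z τ).2.1 i - (zh τ).2.1 i)) := by
      simp [hρ', E2]
    rw [hρ'i]
    linear_combination (-(c.linGain i) * (-(δ * gapK c g H J a δ z zh Φ τ i) + δ *
      (1 / 2 * a i * H (EuclideanSpace.single i 1) ρ
        - ((z τ).2.1 i - (zh τ).2.1 i - gapK c g H J a δ z zh Φ τ i) + Es i))) * hL
  · rw [hρ', norm_smul, Real.norm_of_nonneg hδ]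
    gcongr
    exact h.norm_fst_gap_le hb hR w w'

end PairAt

end Pair

/-! ### Dini estimates for the gap variables. -/

noncomputable section

/-- The forcing of a pair of controller trajectories. -/
def pairForcing (δ e eh : ℝ) (Φ : ℝ → Plane) (ε : Plane) (τ : ℝ) : ℝ :=
  ‖ε‖ + δ * ‖Φ τ‖ + δ * |e - eh|

/-- The errors left in the averaged dynamics of the gap of two controller trajectories. -/
def pairError (c : EscConstants) (g : Plane → ℝ) (H : Plane →L[ℝ] Plane →L[ℝ] ℝ)
    (J : Fin 2 → Fin 2 → ℝ → ℝ) (a : Plane) (δ R : ℝ) (z zh : ℝ → EscState) (e eh : ℝ)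
    (Φ : ℝ → Plane) (ε : Plane) (τ : ℝ) : ℝ :=
  (R + ‖a‖ + δ) * (‖gapK c g H J a δ z zh Φ τ‖ + ‖(z τ).2.2.2 - (zh τ).2.2.2‖
      + ‖a‖ * ‖(z τ).1 - (zh τ).1‖)
    + δ * ‖gapU g z zh τ‖ + δ * (‖(zh τ).2.1‖ * ‖(z τ).1 - (zh τ).1‖)
    + pairForcing δ e eh Φ ε τ

end

section Pair

variable {c : EscConstants} {g : Plane → ℝ} {H : Plane →L[ℝ] Plane →L[ℝ] ℝ}
  {J : Fin 2 → Fin 2 → ℝ → ℝ} {C : ℝ} {a : Plane} {δ R : ℝ} {z zh : ℝ → EscState} {e eh : ℝ}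
  {Φ : ℝ → Plane} {ε : Plane} {τ : ℝ}

namespace PairAt

theorem norm_gap_q_le (hb : EscBounds c g H J C) (hδ : 0 ≤ δ) :
    ‖(z τ).2.1 - (zh τ).2.1‖ ≤ ‖gapK c g H J a δ z zh Φ τ‖ +
      4 * C ^ 3 * (δ * (‖gapU g z zh τ‖ + ‖a‖ * ‖(z τ).1 - (zh τ).1‖ + ‖Φ τ‖)) := by
  have h1 := norm_sub_gapK_le (a := a) (z := z) (zh := zh) (Φ := Φ) (τ := τ) hb hδ
  have h2 := norm_le_insert' ((z τ).2.1 - (zh τ).2.1) (gapK c g H J a δ z zh Φ τ)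
  linarith

/-- The elementary estimates by the pair error. -/
theorem error_estimates (h : PairAt c g a δ R z zh e eh Φ ε τ) (hb : EscBounds c g H J C)
    (hδ : 0 ≤ δ) (hθ : R + ‖a‖ + δ ≤ C⁻¹) :
    (R + ‖a‖ + δ) * ‖(z τ).2.1 - (zh τ).2.1‖ ≤
        5 * C ^ 3 * pairError c g H J a δ R z zh e eh Φ ε τ ∧
      ‖(zh τ).2.1‖ * ‖(z τ).2.2.2 - (zh τ).2.2.2‖ ≤ pairError c g H J a δ R z zh e eh Φ ε τ ∧
      δ * (R * ‖(z τ).2.1 - (zh τ).2.1‖ + R * ‖(z τ).2.2.2 - (zh τ).2.2.2‖ +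
        ‖(zh τ).2.1‖ * ‖(z τ).1 - (zh τ).1‖ + ‖a‖ * ‖(z τ).1 - (zh τ).1‖ + |e - eh|) ≤
        6 * C ^ 3 * pairError c g H J a δ R z zh e eh Φ ε τ ∧
      δ * (‖gapU g z zh τ‖ + ‖a‖ * ‖(z τ).1 - (zh τ).1‖ + ‖Φ τ‖) ≤
        pairError c g H J a δ R z zh e eh Φ ε τ ∧
      (R + ‖a‖ + δ) * (‖a‖ * ‖(z τ).1 - (zh τ).1‖) + ‖ε‖ ≤
        pairError c g H J a δ R z zh e eh Φ ε τ ∧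
      ‖a‖ * ‖gapK c g H J a δ z zh Φ τ‖ ≤ pairError c g H J a δ R z zh e eh Φ ε τ := by
  have hC := hb.one_le
  have hC1 : C⁻¹ ≤ 1 := inv_le_one_of_one_le₀ hC
  have hR0 : 0 ≤ R := (norm_nonneg _).trans h.left_le
  have hnk := norm_gap_q_le (a := a) (z := z) (zh := zh) (Φ := Φ) (τ := τ) hb hδ
  have hq := (EscState.norms_le h.right_le).2.1
  unfold pairError pairForcing
  have hA := norm_nonneg a
  generalize ‖a‖ = A at *
  have hk0 := norm_nonneg ((z τ).2.1 - (zh τ).2.1)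
  generalize ‖(z τ).2.1 - (zh τ).2.1‖ = nk at *
  have hkt0 := norm_nonneg (gapK c g H J a δ z zh Φ τ)
  generalize ‖gapK c g H J a δ z zh Φ τ‖ = nkt at *
  have hu0 := norm_nonneg (gapU g z zh τ)
  generalize ‖gapU g z zh τ‖ = nu at *
  have hr0 := norm_nonneg ((z τ).1 - (zh τ).1)
  generalize ‖(z τ).1 - (zh τ).1‖ = nr at *
  have hm0 := norm_nonneg ((z τ).2.2.2 - (zh τ).2.2.2)
  generalize ‖(z τ).2.2.2 - (zh τ).2.2.2‖ = nm at *
  have hq0 := norm_nonneg (zh τ).2.1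
  generalize ‖(zh τ).2.1‖ = nq at *
  have hΦ0 := norm_nonneg (Φ τ)
  generalize ‖Φ τ‖ = nΦ at *
  have hε0 := norm_nonneg ε
  generalize ‖ε‖ = nε at *
  have he0 := abs_nonneg (e - eh)
  generalize |e - eh| = dE at *
  have hθ1 : R + A + δ ≤ 1 := hθ.trans hC1
  have hθ0 : 0 ≤ R + A + δ := by positivity
  have hδθ : δ ≤ R + A + δ := by linarith
  have hRθ : R ≤ R + A + δ := by linarith
  have hAθ : A ≤ R + A + δ := by linarith
  generalize R + A + δ = θ at *
  have hδ1 : δ ≤ 1 := hδθ.trans hθ1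
  have hAr : 0 ≤ A * nr := by positivity
  have hqr : 0 ≤ nq * nr := by positivity
  have t1 : 0 ≤ θ * nkt := by positivity
  have t2 : 0 ≤ θ * nm := by positivity
  have t3 : 0 ≤ θ * (A * nr) := by positivity
  have t4 : 0 ≤ δ * nu := by positivity
  have t5 : 0 ≤ δ * (nq * nr) := by positivity
  have t6 : 0 ≤ δ * nΦ := by positivity
  have t7 : 0 ≤ δ * dE := by positivity
  have hC3 : 1 ≤ C ^ 3 := one_le_pow₀ hC
  set X := θ * (nkt + nm + A * nr) + δ * nu + δ * (nq * nr) + (nε + δ * nΦ + δ * dE) with hX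
  have hXe : X = θ * nkt + θ * nm + θ * (A * nr) + δ * nu + δ * (nq * nr) + nε + δ * nΦ
      + δ * dE := by rw [hX]; ring
  have hX0 : 0 ≤ X := by rw [hXe]; positivity
  have hCX : X ≤ C ^ 3 * X := le_mul_of_one_le_left hX0 hC3
  have s1 : δ * (A * nr) ≤ θ * (A * nr) := by gcongr
  have s4 : δ * (nu + A * nr + nΦ) ≤ X := by rw [hXe]; nlinarith
  have s0 : θ * nk ≤ 5 * C ^ 3 * X := by
    have h1 : θ * (4 * C ^ 3 * (δ * (nu + A * nr + nΦ))) ≤ 4 * C ^ 3 * X := by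
      refine (mul_le_of_le_one_left (by positivity) hθ1).trans ?_
      gcongr
    have h2 := mul_le_mul_of_nonneg_left hnk hθ0
    have h3 : θ * nkt ≤ X := by rw [hXe]; linarith
    rw [mul_add] at h2
    linarith
  have s2 : nq * nm ≤ θ * nm := by gcongr; linarith
  refine ⟨s0, by rw [hXe]; linarith, ?_, s4, by rw [hXe]; linarith, ?_⟩
  · have h1 : δ * (R * nk) ≤ θ * nk :=
      (mul_le_of_le_one_left (by positivity) hδ1).trans (by gcongr)
    have h2 : δ * (R * nm) ≤ θ * nm :=
      (mul_le_of_le_one_left (by positivity) hδ1).trans (by gcongr)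
    have h3 : δ * (R * nm) + δ * (nq * nr) + δ * (A * nr) + δ * dE ≤ X := by
      rw [hXe]; linarith
    linarith
  · have h1 : A * nkt ≤ θ * nkt := by gcongr
    rw [hXe]; linarith

theorem pairError_nonneg (h : PairAt c g a δ R z zh e eh Φ ε τ) (hδ : 0 ≤ δ) :
    0 ≤ pairError c g H J a δ R z zh e eh Φ ε τ := by
  have hR0 : 0 ≤ R := (norm_nonneg _).trans h.left_le
  unfold pairError pairForcing
  positivity

/-- The difference of the squares of the gradient estimates factors, and one factor is at most `2 *
R`. The moment gap is therefore driven by a small multiple of the gradient gap. -/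
theorem diniLE_gap_m (h : PairAt c g a δ R z zh e eh Φ ε τ) (hb : EscBounds c g H J C)
    (hδ : 0 ≤ δ) (hθ : R + ‖a‖ + δ ≤ C⁻¹) :
    DiniLE (fun t => ‖(z t).2.2.2 - (zh t).2.2.2‖)
      (δ * (-C⁻¹ * ‖(z τ).2.2.2 - (zh τ).2.2.2‖ +
        2 * (10 * C ^ 4 * pairError c g H J a δ R z zh e eh Φ ε τ))) τ := by
  have hC0 := hb.pos
  have hR0 : 0 ≤ R := (norm_nonneg _).trans h.left_le
  refine DiniLE.plane_norm_diag (d := c.momentRate) (b := fun i => δ * c.momentRate i *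
    (((z τ).2.1 i + (zh τ).2.1 i) * ((z τ).2.1 i - (zh τ).2.1 i))) hδ hb.le_momentRate
    (fun i => ?_) fun i => ?_
  · refine ((hasDerivWithinAt_escState_components h.left i).2.2.sub
      (hasDerivWithinAt_escState_components h.right i).2.2).congr_deriv ?_
    simp only [PiLp.sub_apply]
    ring
  · rw [mul_assoc, abs_mul, abs_of_nonneg hδ, abs_mul, abs_of_pos (c.momentRate_pos i), abs_mul]
    have h1 := (h.error_estimates hb hδ hθ).1
    have h2 := Plane.abs_apply_le ((z τ).2.1 - (zh τ).2.1) i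
    have h3 : |(z τ).2.1 i + (zh τ).2.1 i| ≤ 2 * R := by
      have := (Plane.abs_apply_le (z τ).2.1 i).trans (EscState.norms_le h.left_le).2.1
      have := (Plane.abs_apply_le (zh τ).2.1 i).trans (EscState.norms_le h.right_le).2.1
      exact (abs_add_le _ _).trans (by linarith)
    simp only [PiLp.sub_apply] at h2
    have h4 : R * ‖(z τ).2.1 - (zh τ).2.1‖ ≤ (R + ‖a‖ + δ) * ‖(z τ).2.1 - (zh τ).2.1‖ := by
      gcongr; linarith [norm_nonneg a]
    calc δ * (c.momentRate i * _) ≤ δ * (C * (2 * R * ‖(z τ).2.1 - (zh τ).2.1‖)) := by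
          gcongr; exact hb.momentRate_le i
      _ = δ * (2 * C * (R * ‖(z τ).2.1 - (zh τ).2.1‖)) := by ring
      _ ≤ δ * (2 * C * (5 * C ^ 3 * pairError c g H J a δ R z zh e eh Φ ε τ)) := by
          exact mul_le_mul_of_nonneg_left
            (mul_le_mul_of_nonneg_left (h4.trans h1) (by positivity)) hδ
      _ = _ := by ring

/-- Unlike for the other variables, the forcing is not of the order of `pairError`: the terms with
the reference gap and `|e - eh|` lack a factor `δ`. This is affordable because `gapU` acts back on
the others only through `δ * gapU`. -/
theorem diniLE_gapU (h : PairAt c g a δ R z zh e eh Φ ε τ) (hb : EscBounds c g H J C)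
    (hδ : 0 ≤ δ) (hθ : R + ‖a‖ + δ ≤ C⁻¹) :
    DiniLE (fun t => ‖gapU g z zh t‖)
      (δ * (-C⁻¹ * ‖gapU g z zh τ‖ + 2 * (20 * C ^ 5 *
        ((R + ‖a‖ + δ) * (‖gapK c g H J a δ z zh Φ τ‖ + ‖(z τ).2.2.2 - (zh τ).2.2.2‖) +
          ‖(zh τ).2.1‖ * ‖(z τ).1 - (zh τ).1‖ + ‖a‖ * ‖(z τ).1 - (zh τ).1‖ + |e - eh| +
          δ * ‖Φ τ‖ + (R + ‖a‖ + δ) * (δ * ‖gapU g z zh τ‖))))) τ := by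
  have hC := hb.one_le
  have hC0 := hb.pos
  have hR0 : 0 ≤ R := (norm_nonneg _).trans h.left_le
  obtain ⟨E, hE⟩ := h.exists_gapU_deriv hb hδ hθ
  refine DiniLE.plane_norm_diag (d := c.highpass) (b := E) hδ hb.le_highpass
    (fun i => (hE i).1) fun i => (hE i).2.trans (mul_le_mul_of_nonneg_left ?_ hδ)
  have hC1 : C⁻¹ ≤ 1 := inv_le_one_of_one_le₀ hC
  have hθ1 : R + ‖a‖ + δ ≤ 1 := hθ.trans hC1
  have hnk := norm_gap_q_le (a := a) (z := z) (zh := zh) (Φ := Φ) (τ := τ) hb hδ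
  have hRθ : R ≤ R + ‖a‖ + δ := by linarith [norm_nonneg a]
  have hθ0 : 0 ≤ R + ‖a‖ + δ := hR0.trans hRθ
  have hδ1 : δ ≤ 1 := by linarith [norm_nonneg a]
  have hC3 : 1 ≤ C ^ 3 := one_le_pow₀ hC
  have hA0 := norm_nonneg a
  have hr0 := norm_nonneg ((z τ).1 - (zh τ).1)
  generalize R + ‖a‖ + δ = θ at *
  set nk := ‖(z τ).2.1 - (zh τ).2.1‖ with hnkdef
  set nkt := ‖gapK c g H J a δ z zh Φ τ‖ with hnktdef
  set nu := ‖gapU g z zh τ‖ with hnudef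
  set nm := ‖(z τ).2.2.2 - (zh τ).2.2.2‖ with hnmdef
  have hnk0 : 0 ≤ nk := norm_nonneg _
  have hnkt0 : 0 ≤ nkt := norm_nonneg _
  have hnu0 : 0 ≤ nu := norm_nonneg _
  have hnm0 : 0 ≤ nm := norm_nonneg _
  have hΦ0 := norm_nonneg (Φ τ)
  have he0 := abs_nonneg (e - eh)
  have hqr : 0 ≤ ‖(zh τ).2.1‖ * ‖(z τ).1 - (zh τ).1‖ := by positivity
  have hAr : 0 ≤ ‖a‖ * ‖(z τ).1 - (zh τ).1‖ := by positivity
  generalize ‖(zh τ).2.1‖ * ‖(z τ).1 - (zh τ).1‖ = qr at *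
  generalize ‖a‖ * ‖(z τ).1 - (zh τ).1‖ = ar at *
  set Y := θ * (nkt + nm) + qr + ar + |e - eh| + δ * ‖Φ τ‖ + θ * (δ * nu) with hY
  have hY0 : 0 ≤ Y := by positivity
  have h1 : θ * nk ≤ 4 * C ^ 3 * Y + θ * nkt := by
    have h2 := mul_le_mul_of_nonneg_left hnk hθ0
    have h3 : θ * (4 * C ^ 3 * (δ * (nu + ar + ‖Φ τ‖))) ≤ 4 * C ^ 3 * Y := by
      rw [show θ * (4 * C ^ 3 * (δ * (nu + ar + ‖Φ τ‖))) =
        4 * C ^ 3 * (θ * (δ * nu) + θ * δ * ar + θ * (δ * ‖Φ τ‖)) by ring]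
      gcongr
      have h4 : θ * δ * ar ≤ ar :=
        mul_le_of_le_one_left hAr (mul_le_one₀ hθ1 hδ hδ1)
      have h5 : θ * (δ * ‖Φ τ‖) ≤ δ * ‖Φ τ‖ :=
        mul_le_of_le_one_left (by positivity) hθ1
      have h6 : 0 ≤ θ * (nkt + nm) := by positivity
      linarith
    rw [mul_add] at h2
    linarith
  have h2 : R * nk ≤ θ * nk := by gcongr
  have h3 : R * nm ≤ θ * nm := by gcongr
  have h4 : θ * nkt + θ * nm + qr + ar + |e - eh| ≤ Y := by
    have : 0 ≤ θ * (δ * nu) := by positivity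
    have : 0 ≤ δ * ‖Φ τ‖ := by positivity
    rw [hY]; linarith
  have h5 : Y ≤ C ^ 3 * Y := le_mul_of_one_le_left hY0 hC3
  calc 4 * C ^ 2 * (R * nk + R * nm + qr + ar + |e - eh|) ≤ 4 * C ^ 2 * (5 * C ^ 3 * Y) := by
        gcongr; linarith
    _ = _ := by ring

/-- What averaging leaves over is a second order remainder of the cost, the non-oscillating forcing
`ε`, and derivatives of slow variables inside the corrections. The latter carry a factor `δ`, since
the controller moves at that speed. -/
theorem abs_demodulated_error_le (h : PairAt c g a δ R z zh e eh Φ ε τ)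
    (hb : EscBounds c g H J C) (hδ : 0 ≤ δ) (hθ : R + ‖a‖ + δ ≤ C⁻¹) {E : Fin 2 → ℝ} {E1 : ℝ}
    {ρ' : Plane} {i : Fin 2}
    (hE1 : |E1| ≤ C * ((R + ‖a‖ + δ) * (‖a‖ * ‖(z τ).1 - (zh τ).1‖)))
    (hE : |E i| ≤ δ * (4 * C ^ 2 * (R * ‖(z τ).2.1 - (zh τ).2.1‖ +
      R * ‖(z τ).2.2.2 - (zh τ).2.2.2‖ +
        ‖(zh τ).2.1‖ * ‖(z τ).1 - (zh τ).1‖ + ‖a‖ * ‖(z τ).1 - (zh τ).1‖ + |e - eh|)))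
    (hρ' : ‖ρ'‖ ≤ δ * (4 * C * (‖(z τ).2.1 - (zh τ).2.1‖ +
        ‖(zh τ).2.1‖ * ‖(z τ).2.2.2 - (zh τ).2.2.2‖))) :
    |E1 * Real.sin (c.freq i * τ) + ε i
        + (c.freq i)⁻¹ * ((-(δ * c.highpass i * gapU g z zh τ i) + E i) * Real.cos (c.freq i * τ))
        - ∑ j, a j * (J i j τ * H (EuclideanSpace.single j 1) ρ')| ≤
      75 * C ^ 6 * pairError c g H J a δ R z zh e eh Φ ε τ := by
  have hC := hb.one_le
  have hC0 := hb.pos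
  have hC1 : C⁻¹ ≤ 1 := inv_le_one_of_one_le₀ hC
  have hR0 : 0 ≤ R := (norm_nonneg _).trans h.left_le
  obtain ⟨s1, s2, s3, s4, s5, -⟩ := h.error_estimates hb hδ hθ
  have hX0 := h.pairError_nonneg (H := H) (J := J) hδ
  set X := pairError c g H J a δ R z zh e eh Φ ε τ with hX
  have hA0 := norm_nonneg a
  have hδ1 : δ ≤ 1 := by linarith
  have h1 : |E1 * Real.sin (c.freq i * τ) + ε i| ≤ C * X := by
    have h2 : |E1 * Real.sin (c.freq i * τ)| ≤ _ :=
      abs_mul_le_of_le hE1 (Real.abs_sin_le_one _)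
    have h3 := Plane.abs_apply_le ε i
    have h4 : 1 * ‖ε‖ ≤ C * ‖ε‖ := by gcongr
    have h5 := mul_le_mul_of_nonneg_left s5 hC0.le
    have h6 := abs_add_le (E1 * Real.sin (c.freq i * τ)) (ε i)
    linarith
  have h2 : |(c.freq i)⁻¹ * ((-(δ * c.highpass i * gapU g z zh τ i) + E i) *
      Real.cos (c.freq i * τ))| ≤ C * (C * X + 24 * C ^ 5 * X) := by
    rw [abs_mul, abs_of_nonneg (inv_nonneg.2 (c.freq_pos i).le)]
    have h3 : |-(δ * c.highpass i * gapU g z zh τ i) + E i| ≤ C * X + 24 * C ^ 5 * X := by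
      refine (abs_add_le _ _).trans (add_le_add ?_ ?_)
      · rw [abs_neg, abs_mul, abs_of_nonneg (mul_nonneg hδ (c.highpass_pos i).le)]
        have h4 : δ * ‖gapU g z zh τ‖ ≤ X := by
          refine le_trans ?_ s4
          gcongr
          have : 0 ≤ ‖a‖ * ‖(z τ).1 - (zh τ).1‖ := by positivity
          linarith [norm_nonneg (Φ τ)]
        calc δ * c.highpass i * |gapU g z zh τ i| ≤ δ * C * ‖gapU g z zh τ‖ := by
              gcongr
              · exact hb.highpass_le i
              · exact Plane.abs_apply_le _ i
          _ = C * (δ * ‖gapU g z zh τ‖) := by ring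
          _ ≤ C * X := by gcongr
      · refine hE.trans ?_
        calc _ = 4 * C ^ 2 * (δ * (R * ‖(z τ).2.1 - (zh τ).2.1‖ +
                R * ‖(z τ).2.2.2 - (zh τ).2.2.2‖ + ‖(zh τ).2.1‖ * ‖(z τ).1 - (zh τ).1‖ +
                ‖a‖ * ‖(z τ).1 - (zh τ).1‖ + |e - eh|)) := by ring
          _ ≤ 4 * C ^ 2 * (6 * C ^ 3 * X) := by gcongr
          _ = _ := by ring
    have h5 : |(-(δ * c.highpass i * gapU g z zh τ i) + E i) * Real.cos (c.freq i * τ)| ≤ _ :=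
      abs_mul_le_of_le h3 (Real.abs_cos_le_one _)
    gcongr
    exact hb.freq_inv_le i
  have h3 : |∑ j, a j * (J i j τ * H (EuclideanSpace.single j 1) ρ')| ≤ 48 * C ^ 6 * X := by
    refine (hb.abs_primitive_sum_le a ρ' i τ).trans ?_
    set nk := ‖(z τ).2.1 - (zh τ).2.1‖ with hnk
    set qm := ‖(zh τ).2.1‖ * ‖(z τ).2.2.2 - (zh τ).2.2.2‖ with hqm
    have hnk0 : 0 ≤ nk := norm_nonneg _
    have hqm0 : 0 ≤ qm := by positivity
    have h4 : ‖a‖ * (δ * (nk + qm)) ≤ 6 * C ^ 3 * X := by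
      have h5 : ‖a‖ * nk ≤ (R + ‖a‖ + δ) * nk := by gcongr; linarith
      have h6 : ‖a‖ * (δ * (nk + qm)) ≤ ‖a‖ * (nk + qm) := by
        gcongr; exact mul_le_of_le_one_left (by positivity) hδ1
      have h7 : ‖a‖ * qm ≤ qm := mul_le_of_le_one_left hqm0 (by linarith)
      have h8 : X ≤ C ^ 3 * X := le_mul_of_one_le_left hX0 (one_le_pow₀ hC)
      nlinarith
    calc 2 * C ^ 2 * (‖a‖ * ‖ρ'‖) ≤ 2 * C ^ 2 * (‖a‖ * (δ * (4 * C * (nk + qm)))) := by gcongr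
      _ = 8 * C ^ 3 * (‖a‖ * (δ * (nk + qm))) := by ring
      _ ≤ 8 * C ^ 3 * (6 * C ^ 3 * X) := by gcongr
      _ = _ := by ring
  have h4 : C * X ≤ C ^ 6 * X := by
    gcongr; exact le_self_pow₀ hC (by norm_num)
  have h5 : C ^ 2 * X ≤ C ^ 6 * X := by
    gcongr
    norm_num
  refine (abs_sub _ _).trans ?_
  have h6 := abs_add_le (E1 * Real.sin (c.freq i * τ) + ε i) ((c.freq i)⁻¹ *
    ((-(δ * c.highpass i * gapU g z zh τ i) + E i) * Real.cos (c.freq i * τ)))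
  have h7 : 0 ≤ C ^ 6 * X := by positivity
  nlinarith

/-- The averaged gradient `‖a‖ * ‖ρ‖` is the one forcing that is not part of the error. It couples
`gapK` to the slow gap and is absorbed later by giving `gapK` a small weight. -/
theorem diniLE_gapK (h : PairAt c g a δ R z zh e eh Φ ε τ) (hb : EscBounds c g H J C)
    (hδ : 0 ≤ δ) (hθ : R + ‖a‖ + δ ≤ C⁻¹) :
    DiniLE (fun t => ‖gapK c g H J a δ z zh Φ t‖)
      (δ * (-C⁻¹ * ‖gapK c g H J a δ z zh Φ τ‖ + 2 * (77 * C ^ 7 *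
        (‖a‖ * ‖(z τ).1 - (zh τ).1‖ + pairError c g H J a δ R z zh e eh Φ ε τ)))) τ := by
  have hC := hb.one_le
  have hC0 := hb.pos
  obtain ⟨E, E2, Es, E1, ρ', hall⟩ := h.exists_gapK_gapS_deriv hb hδ hθ
  refine DiniLE.plane_norm_diag (d := c.lowpass) hδ hb.le_lowpass (fun i => (hall i).1)
    fun i => ?_
  obtain ⟨-, -, -, hEs, hE1, hE, hρ'⟩ := hall i
  have h1 : |Es i| ≤ _ := hEs ▸ h.abs_demodulated_error_le hb hδ hθ hE1 hE hρ'
  have hX0 := h.pairError_nonneg (H := H) (J := J) hδ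
  have h2 := (h.error_estimates hb hδ hθ).2.2.2.1
  set X := pairError c g H J a δ R z zh e eh Φ ε τ with hX
  have h3 := (abs_sub_gapK_le (a := a) (z := z) (zh := zh) (Φ := Φ) (τ := τ) hb hδ i)
  have h4 : |(z τ).2.1 i - (zh τ).2.1 i - gapK c g H J a δ z zh Φ τ i| ≤ 2 * C ^ 3 * X :=
    h3.trans (by gcongr)
  have h5 : |1 / 2 * a i * H (EuclideanSpace.single i 1) ((z τ).1 - (zh τ).1)| ≤
      C * (‖a‖ * ‖(z τ).1 - (zh τ).1‖) := by
    have h6 := Plane.abs_bilin_le H hb.hess.norm_le (EuclideanSpace.single i 1)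
      ((z τ).1 - (zh τ).1)
    rw [PiLp.norm_single, norm_one, mul_one] at h6
    have h7 := Plane.abs_apply_le a i
    rw [abs_mul, abs_mul, abs_of_pos (by norm_num : (0 : ℝ) < 1 / 2)]
    calc 1 / 2 * |a i| * _ ≤ 1 / 2 * ‖a‖ * (C * ‖(z τ).1 - (zh τ).1‖) := by gcongr
      _ ≤ 1 * ‖a‖ * (C * ‖(z τ).1 - (zh τ).1‖) := by gcongr; norm_num
      _ = _ := by ring
  rw [mul_assoc, abs_mul, abs_of_nonneg hδ, abs_mul, abs_of_pos (c.lowpass_pos i)]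
  refine mul_le_mul_of_nonneg_left ?_ hδ
  set ar := ‖a‖ * ‖(z τ).1 - (zh τ).1‖ with har
  have har0 : 0 ≤ ar := by positivity
  have h6 : |1 / 2 * a i * H (EuclideanSpace.single i 1) ((z τ).1 - (zh τ).1)
      - ((z τ).2.1 i - (zh τ).2.1 i - gapK c g H J a δ z zh Φ τ i) + Es i| ≤
      C * ar + 2 * C ^ 3 * X + 75 * C ^ 6 * X :=
    (abs_add_le _ _).trans (add_le_add ((abs_sub _ _).trans (add_le_add h5 h4)) h1)
  have h7 : C ≤ C ^ 6 := le_self_pow₀ hC (by norm_num)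
  have h8 : C ^ 3 ≤ C ^ 6 := pow_le_pow_right₀ hC (by norm_num)
  calc c.lowpass i * _ ≤ C * (C * ar + 2 * C ^ 3 * X + 75 * C ^ 6 * X) := by
        gcongr; exact hb.lowpass_le i
    _ ≤ C * (C ^ 6 * ar + 2 * C ^ 6 * X + 75 * C ^ 6 * X) := by gcongr
    _ ≤ C * (77 * C ^ 6 * (ar + X)) := by
        gcongr
        have : 0 ≤ C ^ 6 * ar := by positivity
        nlinarith
    _ = _ := by ring

theorem norm_gap_sub_gapS_le (hb : EscBounds c g H J C) :
    ‖(z τ).1 - (zh τ).1 - gapS c g H J a δ z zh Φ τ‖ ≤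
      2 * (C ^ 2 * ‖gapK c g H J a δ z zh Φ τ‖) := by
  have hC0 := hb.pos
  refine Plane.norm_le_of_abs_le fun i => ?_
  have h1 : ((z τ).1 - (zh τ).1 - gapS c g H J a δ z zh Φ τ) i =
      c.linGain i * (c.lowpass i)⁻¹ * gapK c g H J a δ z zh Φ τ i := by
    simp [gapS]
  have h2 := EscBounds.linGain_pos c i
  have h3 := inv_pos.2 (c.lowpass_pos i)
  rw [h1, abs_mul, abs_of_pos (mul_pos h2 h3), pow_two]
  gcongr
  · exact hb.linGain_le i
  · exact hb.lowpass_inv_le i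
  · exact Plane.abs_apply_le _ i

theorem norm_gapS_le (hb : EscBounds c g H J C) (hw : ∀ i, C⁻¹ ≤ c.weight a i) :
    ‖gapS c g H J a δ z zh Φ τ‖ ≤ 2 * (C * ‖gapW c g H J a δ z zh Φ τ‖) := by
  have hC0 := hb.pos
  refine Plane.norm_le_of_abs_le fun i => ?_
  have h1 := Plane.abs_apply_le (gapW c g H J a δ z zh Φ τ) i
  have h2 : |gapW c g H J a δ z zh Φ τ i| = c.weight a i * |gapS c g H J a δ z zh Φ τ i| := by
    simp only [gapW, abs_mul]
    rw [abs_of_nonneg (show 0 ≤ c.weight a i from Real.sqrt_nonneg _)]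
  rw [h2] at h1
  have h3 := mul_le_mul_of_nonneg_right (hw i) (abs_nonneg (gapS c g H J a δ z zh Φ τ i))
  rw [← inv_mul_le_iff₀ hC0]
  linarith

theorem norm_gapW_le (hb : EscBounds c g H J C) (hw : ∀ i, c.weight a i ≤ C) :
    ‖gapW c g H J a δ z zh Φ τ‖ ≤ 2 * (C * ‖gapS c g H J a δ z zh Φ τ‖) := by
  have hC0 := hb.pos
  refine Plane.norm_le_of_abs_le fun i => ?_
  simp only [gapW, abs_mul]
  rw [abs_of_nonneg (show 0 ≤ c.weight a i from Real.sqrt_nonneg _)]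
  gcongr
  · exact hw i
  · exact Plane.abs_apply_le _ i

/-- The matrix `diag (linGain i * a i) * H` need not be dissipative for the Euclidean norm. Since
`weight² * linGain i * a i = ‖a‖`, pairing the weighted gap with its velocity gives `-1/2 * δ * ‖a‖
* H σ σ`, and coercivity of `H` yields the rate. -/
theorem diniLE_gapW (h : PairAt c g a δ R z zh e eh Φ ε τ) (hb : EscBounds c g H J C)
    (hδ : 0 ≤ δ) (hθ : R + ‖a‖ + δ ≤ C⁻¹) (ha : ∀ i, 0 < a i)
    (hw : ∀ i, c.weight a i ≤ C) (hw' : ∀ i, C⁻¹ ≤ c.weight a i) :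
    DiniLE (fun t => ‖gapW c g H J a δ z zh Φ t‖)
      (δ * (-(8 * C ^ 3)⁻¹ * (‖a‖ * ‖gapW c g H J a δ z zh Φ τ‖) +
        2 * (82 * C ^ 8 * pairError c g H J a δ R z zh e eh Φ ε τ))) τ := by
  have hC := hb.one_le
  have hC0 := hb.pos
  obtain ⟨E, E2, Es, E1, ρ', hall⟩ := h.exists_gapK_gapS_deriv hb hδ hθ
  set σ := gapS c g H J a δ z zh Φ τ with hσ
  set ρ := (z τ).1 - (zh τ).1 with hρ
  have hwpos : ∀ i, 0 < c.weight a i := fun i => (inv_pos.2 hC0).trans_le (hw' i)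
  have hA0 := norm_nonneg a
  have hwsq : ∀ i, c.weight a i * c.weight a i * (c.linGain i * a i) = ‖a‖ := fun i => by
    have h1 : 0 < c.linGain i * a i := mul_pos (EscBounds.linGain_pos c i) (ha i)
    rw [EscConstants.weight, Real.mul_self_sqrt (by positivity), div_mul_cancel₀ _ h1.ne']
  have hwinv : ∀ i, (c.weight a i)⁻¹ ≤ C := fun i => by
    rw [inv_le_comm₀ (hwpos i) hC0]; exact hw' i
  -- Here `ρ` is split as `σ + (ρ - σ)`: the first part dissipates, while the second is a multiple
  -- of `gapK` and enters with the factor `‖a‖`, so it belongs to `pairError`.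
  have hderiv : ∀ i, HasDerivWithinAt (fun t => gapW c g H J a δ z zh Φ t i)
      (-(1 / 2 * δ * ‖a‖ * (c.weight a i)⁻¹ * H (EuclideanSpace.single i 1) σ) +
        (-(1 / 2 * δ * ‖a‖ * (c.weight a i)⁻¹ * H (EuclideanSpace.single i 1) (ρ - σ)) +
          c.weight a i * (δ * (E2 i - c.linGain i * Es i)))) (Ici τ) τ := by
    intro i
    refine ((hall i).2.1.const_mul (c.weight a i)).congr_deriv ?_
    have hsub : H (EuclideanSpace.single i 1) (ρ - σ) =
        H (EuclideanSpace.single i 1) ρ - H (EuclideanSpace.single i 1) σ := map_sub _ _ _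
    rw [hsub, ← hwsq i]
    have := (hwpos i).ne'
    field_simp
    ring
  have hX0 := h.pairError_nonneg (H := H) (J := J) hδ
  obtain ⟨s1, s2, s3, s4, s5, s6⟩ := h.error_estimates hb hδ hθ
  set X := pairError c g H J a δ R z zh e eh Φ ε τ with hX
  have hmain := DiniLE.plane_norm
    (w := WithLp.toLp 2 fun i =>
      -(1 / 2 * δ * ‖a‖ * (c.weight a i)⁻¹ * H (EuclideanSpace.single i 1) σ))
    (b := WithLp.toLp 2 fun i =>
      -(1 / 2 * δ * ‖a‖ * (c.weight a i)⁻¹ * H (EuclideanSpace.single i 1) (ρ - σ)) +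
          c.weight a i * (δ * (E2 i - c.linGain i * Es i)))
    (k := δ * ((8 * C ^ 3)⁻¹ * ‖a‖)) (ε := δ * (82 * C ^ 8 * X)) hderiv ?_ ?_ ?_
  · exact hmain.mono (le_of_eq (by ring))
  · have h1 : ∑ i, gapW c g H J a δ z zh Φ τ i *
        (-(1 / 2 * δ * ‖a‖ * (c.weight a i)⁻¹ * H (EuclideanSpace.single i 1) σ)) =
        -(1 / 2 * δ * ‖a‖ * H σ σ) := by
      rw [Plane.bilin_eq_sum H σ σ, Finset.mul_sum, ← Finset.sum_neg_distrib]
      refine Finset.sum_congr rfl fun i _ => ?_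
      have := (hwpos i).ne'
      simp only [gapW]
      rw [← hσ]
      field_simp
    have h2 := hb.coercive σ
    have h3 := norm_gapW_le (δ := δ) (z := z) (zh := zh) (Φ := Φ) (τ := τ) hb hw
    rw [← hσ] at h3
    have h4 : (8 * C ^ 3)⁻¹ * ‖gapW c g H J a δ z zh Φ τ‖ ^ 2 ≤ 1 / 2 * H σ σ := by
      calc (8 * C ^ 3)⁻¹ * ‖gapW c g H J a δ z zh Φ τ‖ ^ 2
          ≤ (8 * C ^ 3)⁻¹ * (2 * (C * ‖σ‖)) ^ 2 := by gcongr
        _ = 1 / 2 * (C⁻¹ * ‖σ‖ ^ 2) := by field_simp; ring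
        _ ≤ _ := by gcongr
    simp only
    rw [h1]
    have h5 := mul_le_mul_of_nonneg_left h4 (mul_nonneg hδ hA0)
    nlinarith
  · intro h0
    have hσ0 : σ = 0 := by
      rw [← norm_le_zero_iff]
      refine (norm_gapS_le (δ := δ) (z := z) (zh := zh) (Φ := Φ) (τ := τ) hb hw').trans ?_
      rw [h0]; simp
    ext i
    simp [hσ0]
  · intro i
    obtain ⟨-, -, hE2, hEs, hE1, hE, hρ'⟩ := hall i
    have h1 : |Es i| ≤ 75 * C ^ 6 * X := hEs ▸ h.abs_demodulated_error_le hb hδ hθ hE1 hE hρ'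
    have h2 : |E2 i| ≤ 6 * C ^ 6 * X := by
      refine hE2.trans ?_
      have h3 : R * ‖(z τ).2.1 - (zh τ).2.1‖ ≤ (R + ‖a‖ + δ) * ‖(z τ).2.1 - (zh τ).2.1‖ := by
        gcongr; linarith
      have h4 : X ≤ C ^ 3 * X := le_mul_of_one_le_left hX0 (one_le_pow₀ hC)
      calc _ ≤ C * (6 * C ^ 3 * X) := by gcongr; linarith
        _ = 6 * C ^ 4 * X := by ring
        _ ≤ 6 * C ^ 6 * X := by gcongr; norm_num
    have h3 : |H (EuclideanSpace.single i 1) (ρ - σ)| ≤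
        C * (2 * (C ^ 2 * ‖gapK c g H J a δ z zh Φ τ‖)) := by
      have h4 := Plane.abs_bilin_le H hb.hess.norm_le (EuclideanSpace.single i 1) (ρ - σ)
      rw [PiLp.norm_single, norm_one, mul_one] at h4
      refine h4.trans ?_
      gcongr
      exact norm_gap_sub_gapS_le hb
    have h5 : |1 / 2 * δ * ‖a‖ * (c.weight a i)⁻¹ * H (EuclideanSpace.single i 1) (ρ - σ)| ≤
        δ * (C ^ 8 * X) := by
      rw [abs_mul, abs_of_nonneg (by have := (hwpos i).le; positivity)]
      calc 1 / 2 * δ * ‖a‖ * (c.weight a i)⁻¹ * _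
          ≤ 1 / 2 * δ * ‖a‖ * C * (C * (2 * (C ^ 2 * ‖gapK c g H J a δ z zh Φ τ‖))) := by
            gcongr; exact hwinv i
        _ = δ * (C ^ 4 * (‖a‖ * ‖gapK c g H J a δ z zh Φ τ‖)) := by ring
        _ ≤ δ * (C ^ 8 * X) := by gcongr; norm_num
    have h6 : |c.weight a i * (δ * (E2 i - c.linGain i * Es i))| ≤ δ * (81 * C ^ 8 * X) := by
      have h7 : |E2 i - c.linGain i * Es i| ≤ 6 * C ^ 6 * X + C * (75 * C ^ 6 * X) := by
        refine (abs_sub _ _).trans (add_le_add h2 ?_)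
        rw [abs_mul, abs_of_pos (EscBounds.linGain_pos c i)]
        gcongr
        exact hb.linGain_le i
      rw [abs_mul, abs_of_pos (hwpos i), abs_mul, abs_of_nonneg hδ]
      calc c.weight a i * (δ * _) ≤ C * (δ * (6 * C ^ 6 * X + C * (75 * C ^ 6 * X))) := by
            gcongr; exact hw i
        _ ≤ C * (δ * (C * (6 * C ^ 6 * X) + C * (75 * C ^ 6 * X))) := by
            have h8 : 6 * C ^ 6 * X ≤ C * (6 * C ^ 6 * X) :=
              le_mul_of_one_le_left (by positivity) hC
            gcongr
        _ = _ := by ring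
    simp only
    refine (abs_add_le _ _).trans ?_
    rw [abs_neg]
    nlinarith

end PairAt

end Pair

/-! ### The composite Lyapunov function. -/

/-- The weights of the composite Lyapunov function. -/
theorem exists_lyapunov_weights {k₀ D₀ C₂ : ℝ} (hk₀ : 0 < k₀) (hk₁ : k₀ ≤ 1) (hD₀ : 1 ≤ D₀)
    (hC₂ : 1 ≤ C₂) :
    ∃ b K k θ₀ D : ℝ, 0 < b ∧ 0 < K ∧ 0 < k ∧ 0 < θ₀ ∧ 0 < D ∧
      ∀ θ A δ s nk nm nu nr qr f F : ℝ, 0 ≤ A → 0 ≤ δ → 0 ≤ s → 0 ≤ nk → 0 ≤ nm →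
        0 ≤ nu → 0 ≤ nr → 0 ≤ qr → 0 ≤ F → θ ≤ θ₀ → A ≤ θ → δ ≤ θ →
        nr ≤ C₂ * (s + nk) → δ * f ≤ F →
        (b * (-k₀ * nk + D₀ * (A * nr + (θ * (nk + nm + A * nr) + δ * nu + δ * qr + F)))
          + b * (-k₀ * nm + D₀ * (θ * (nk + nm + A * nr) + δ * nu + δ * qr + F))
          + K * δ * (-k₀ * nu + D₀ * (θ * (nk + nm) + qr + A * nr + f + θ * (δ * nu)))
          ≤ -k * (nk + nm + δ * nu) + D * (A * nr + δ * qr + F)) ∧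
        ((-k₀ * (A * s) + D₀ * (θ * (nk + nm + A * nr) + δ * nu + δ * qr + F))
          + (b * (-k₀ * nk + D₀ * (A * nr + (θ * (nk + nm + A * nr) + δ * nu + δ * qr + F)))
          + b * (-k₀ * nm + D₀ * (θ * (nk + nm + A * nr) + δ * nu + δ * qr + F))
          + K * δ * (-k₀ * nu + D₀ * (θ * (nk + nm) + qr + A * nr + f + θ * (δ * nu))))
          ≤ -k * (A * s + nk + nm + δ * nu) + D * (δ * qr + F)) := by
  set b := k₀ / (4 * C₂ * D₀) with hb
  set K := 2 * (3 * D₀ + 1) / k₀ with hK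
  set M := 3 * D₀ + K * D₀ with hM
  set θ₀ := b * k₀ / (4 * (C₂ + 1) * (M + 1)) with hθ₀
  have hb0 : 0 < b := by positivity
  have hK0 : 0 < K := by positivity
  have hM0 : 0 < M := by positivity
  have hθ₀0 : 0 < θ₀ := by positivity
  have hbe : C₂ * (b * D₀) = k₀ / 4 := by rw [hb]; field_simp
  have hKe : K * k₀ = 2 * (3 * D₀ + 1) := by rw [hK]; field_simp
  have hb1 : b ≤ 1 := by
    rw [hb, div_le_one (by positivity)]
    nlinarith [mul_le_mul hC₂ hD₀ zero_le_one (by linarith)]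
  have hθe : (C₂ + 1) * (M + 1) * θ₀ = b * k₀ / 4 := by rw [hθ₀]; field_simp
  have hbk : b * k₀ ≤ k₀ := mul_le_of_le_one_left hk₀.le hb1
  refine ⟨b, K, b * k₀ / 2, θ₀, M + 1, hb0, hK0, by positivity, hθ₀0, by positivity, ?_⟩
  intro θ A δ s nk nm nu nr qr f F hA hδ hs hnk hnm hnu hnr hqr hF hθ hAθ hδθ hnrle hf
  have hθ0 : 0 ≤ θ := hA.trans hAθ
  have hθle : (C₂ + 1) * (M + 1) * θ ≤ b * k₀ / 4 := by
    rw [← hθe]; gcongr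
  have e1 : (M + 1) * θ ≤ b * k₀ / 4 := by
    refine le_trans ?_ hθle
    gcongr
    exact le_mul_of_one_le_left (by positivity) (by linarith)
  have e2 : C₂ * (M * θ) ≤ b * k₀ / 4 := by
    refine le_trans ?_ hθle
    rw [mul_assoc]
    gcongr <;> linarith
  have e3 : M * θ ≤ b * k₀ / 4 := le_trans (by gcongr; linarith) e1
  have hδ1 : δ ≤ 1 := by
    have : θ ≤ (M + 1) * θ := le_mul_of_one_le_left hθ0 (by linarith)
    linarith
  have hAr : 0 ≤ A * nr := by positivity
  have hun : 0 ≤ δ * nu := by positivity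
  have hqr' : 0 ≤ δ * qr := by positivity
  -- the line of the fastest variable
  have u1 : K * δ * (-k₀ * nu + D₀ * (θ * (nk + nm) + qr + A * nr + f + θ * (δ * nu))) ≤
      -(2 * (3 * D₀ + 1)) * (δ * nu) +
        K * D₀ * (θ * (nk + nm + A * nr) + δ * qr + F + θ * (δ * nu)) := by
    have h1 : δ * (θ * (nk + nm)) ≤ θ * (nk + nm) :=
      mul_le_of_le_one_left (by positivity) hδ1
    have h2 : δ * (A * nr) ≤ θ * (A * nr) := by gcongr
    have h3 : δ * (θ * (δ * nu)) ≤ θ * (δ * nu) :=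
      mul_le_of_le_one_left (by positivity) hδ1
    have h4 : δ * (θ * (nk + nm) + qr + A * nr + f + θ * (δ * nu)) ≤
        θ * (nk + nm + A * nr) + δ * qr + F + θ * (δ * nu) := by linarith
    have h5 := mul_le_mul_of_nonneg_left h4 (by positivity : 0 ≤ K * D₀)
    have h6 : K * δ * (-k₀ * nu) = -(2 * (3 * D₀ + 1)) * (δ * nu) := by rw [← hKe]; ring
    calc _ = K * δ * (-k₀ * nu) +
          K * D₀ * (δ * (θ * (nk + nm) + qr + A * nr + f + θ * (δ * nu))) := by ring
      _ ≤ _ := by rw [h6]; linarith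
  set Q := θ * (nk + nm + A * nr) with hQ
  have hQ0 : 0 ≤ Q := by positivity
  have hbD : b * D₀ ≤ D₀ := mul_le_of_le_one_left (by linarith) hb1
  have v1 : b * D₀ * (Q + δ * nu + δ * qr + F) ≤ D₀ * (Q + δ * nu + δ * qr + F) := by gcongr
  have v0 : 0 ≤ D₀ * (Q + δ * nu + δ * qr + F) := by positivity
  have hMQ : M * Q = M * θ * nk + M * θ * nm + M * θ * (A * nr) := by rw [hQ]; ring
  have m1 : M * θ * nk ≤ b * k₀ / 4 * nk := by gcongr
  have m2 : M * θ * nm ≤ b * k₀ / 4 * nm := by gcongr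
  have m3 : K * D₀ * (θ * (δ * nu)) ≤ 1 * (δ * nu) := by
    rw [← mul_assoc]
    gcongr
    have : K * D₀ * θ ≤ M * θ := by gcongr; linarith
    linarith
  have m4 : b * k₀ / 2 * (δ * nu) ≤ 1 * (δ * nu) := by gcongr; linarith
  have m5 : M * (δ * qr) = 3 * D₀ * (δ * qr) + K * D₀ * (δ * qr) := by rw [hM]; ring
  have m6 : M * F = 3 * D₀ * F + K * D₀ * F := by rw [hM]; ring
  have m7 : M * Q = 3 * D₀ * Q + K * D₀ * Q := by rw [hM]; ring
  constructor
  · have m8 : M * θ * (A * nr) ≤ 1 * (A * nr) := by gcongr; linarith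
    have m9 : b * D₀ * (A * nr) ≤ M * (A * nr) := by
      gcongr
      have : 0 ≤ K * D₀ := by positivity
      linarith
    have p1 : 0 ≤ b * k₀ * nk := by positivity
    have p2 : 0 ≤ b * k₀ * nm := by positivity
    have p3 : 0 ≤ D₀ * (δ * nu) := by positivity
    linarith
  · have w1 : (b * D₀ + M * θ) * (A * nr) ≤ (k₀ / 4 + b * k₀ / 4) * (A * s + θ * nk) := by
      have h1 : A * nr ≤ C₂ * (A * s + θ * nk) := by
        calc A * nr ≤ A * (C₂ * (s + nk)) := by gcongr
          _ = C₂ * (A * s + A * nk) := by ring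
          _ ≤ _ := by gcongr
      calc (b * D₀ + M * θ) * (A * nr) ≤ (b * D₀ + M * θ) * (C₂ * (A * s + θ * nk)) := by gcongr
        _ = (C₂ * (b * D₀) + C₂ * (M * θ)) * (A * s + θ * nk) := by ring
        _ ≤ _ := by rw [hbe]; gcongr
    have hAs : 0 ≤ A * s := by positivity
    have w2 : (k₀ / 4 + b * k₀ / 4) * (A * s) ≤ k₀ / 2 * (A * s) := by gcongr; linarith
    have w3 : (k₀ / 4 + b * k₀ / 4) * (θ * nk) ≤ θ * nk :=
      mul_le_of_le_one_left (by positivity) (by linarith)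
    have w4 : (M * θ + θ) * nk ≤ b * k₀ / 4 * nk := by gcongr; linarith
    have w5 : b * k₀ / 2 * (A * s) ≤ k₀ / 2 * (A * s) := by gcongr
    have p1 : 0 ≤ b * k₀ * nk := by positivity
    have p3 : 0 ≤ D₀ * (δ * nu) := by positivity
    have p2 : 0 ≤ b * k₀ * nm := by positivity
    linarith

section Pair

variable {c : EscConstants} {g : Plane → ℝ} {H : Plane →L[ℝ] Plane →L[ℝ] ℝ}
  {J : Fin 2 → Fin 2 → ℝ → ℝ} {C : ℝ}

/-- Admissible amplitudes, for which the weights of the slow gap are bounded. -/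
structure AdmissibleAmplitude (c : EscConstants) (C : ℝ) (a : Plane) : Prop where
  pos : ∀ i, 0 < a i
  weight_le : ∀ i, c.weight a i ≤ C
  le_weight : ∀ i, C⁻¹ ≤ c.weight a i

theorem PairAt.norm_gap_r_le {a : Plane} {δ : ℝ} {z zh : ℝ → EscState} {Φ : ℝ → Plane} {τ : ℝ}
    (hb : EscBounds c g H J C) (ha : AdmissibleAmplitude c C a) :
    ‖(z τ).1 - (zh τ).1‖ ≤
      2 * C ^ 2 * (‖gapW c g H J a δ z zh Φ τ‖ + ‖gapK c g H J a δ z zh Φ τ‖) := by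
  have hC := hb.one_le
  have h1 := PairAt.norm_gap_sub_gapS_le (a := a) (δ := δ) (z := z) (zh := zh) (Φ := Φ)
    (τ := τ) hb
  have h2 := PairAt.norm_gapS_le (δ := δ) (z := z) (zh := zh) (Φ := Φ) (τ := τ) hb ha.le_weight
  have h3 := norm_le_insert' ((z τ).1 - (zh τ).1) (gapS c g H J a δ z zh Φ τ)
  have h4 : C * ‖gapW c g H J a δ z zh Φ τ‖ ≤ C ^ 2 * ‖gapW c g H J a δ z zh Φ τ‖ := by
    gcongr; nlinarith
  linarith

theorem PairAt.norm_gapW_le_of_gap {a : Plane} {δ : ℝ} {z zh : ℝ → EscState} {Φ : ℝ → Plane}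
    {τ : ℝ} (hb : EscBounds c g H J C) (ha : AdmissibleAmplitude c C a) :
    ‖gapW c g H J a δ z zh Φ τ‖ ≤
      2 * C * ‖(z τ).1 - (zh τ).1‖ + 4 * C ^ 3 * ‖gapK c g H J a δ z zh Φ τ‖ := by
  have hC := hb.pos
  have h1 := PairAt.norm_gap_sub_gapS_le (a := a) (δ := δ) (z := z) (zh := zh) (Φ := Φ)
    (τ := τ) hb
  have h2 := PairAt.norm_gapW_le (δ := δ) (z := z) (zh := zh) (Φ := Φ) (τ := τ) hb ha.weight_le
  have h3 := norm_le_insert ((z τ).1 - (zh τ).1) (gapS c g H J a δ z zh Φ τ)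
  have h4 := mul_le_mul_of_nonneg_left (h3.trans (add_le_add_right h1 _)) hC.le
  nlinarith

/-- Dissipation of the composite Lyapunov functions of the gap of two controller trajectories. -/
theorem EscBounds.exists_lyapunov (hb : EscBounds c g H J C) :
    ∃ b K k θ₀ D : ℝ, 0 < b ∧ 0 < K ∧ 0 < k ∧ 0 < θ₀ ∧ 0 < D ∧ θ₀ ≤ C⁻¹ ∧
      ∀ (a : Plane) (δ R : ℝ) (z zh : ℝ → EscState) (e eh : ℝ) (Φ : ℝ → Plane) (ε : Plane) (τ : ℝ),
        PairAt c g a δ R z zh e eh Φ ε τ → AdmissibleAmplitude c C a → 0 ≤ δ →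
        R + ‖a‖ + δ ≤ θ₀ →
        DiniLE (fun t => b * ‖gapK c g H J a δ z zh Φ t‖ + b * ‖(z t).2.2.2 - (zh t).2.2.2‖ +
            K * δ * ‖gapU g z zh t‖)
          (δ * (-k * (‖gapK c g H J a δ z zh Φ τ‖ + ‖(z τ).2.2.2 - (zh τ).2.2.2‖ +
            δ * ‖gapU g z zh τ‖) + D * (‖a‖ * ‖(z τ).1 - (zh τ).1‖ +
            δ * (‖(zh τ).2.1‖ * ‖(z τ).1 - (zh τ).1‖) + pairForcing δ e eh Φ ε τ))) τ ∧
        DiniLE (fun t => ‖gapW c g H J a δ z zh Φ t‖ + (b * ‖gapK c g H J a δ z zh Φ t‖ +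
            b * ‖(z t).2.2.2 - (zh t).2.2.2‖ + K * δ * ‖gapU g z zh t‖))
          (δ * (-k * (‖a‖ * ‖gapW c g H J a δ z zh Φ τ‖ + ‖gapK c g H J a δ z zh Φ τ‖ +
            ‖(z τ).2.2.2 - (zh τ).2.2.2‖ + δ * ‖gapU g z zh τ‖) + D *
            (δ * (‖(zh τ).2.1‖ * ‖(z τ).1 - (zh τ).1‖) + pairForcing δ e eh Φ ε τ))) τ := by
  have hC := hb.one_le
  have hC0 := hb.pos
  -- The smallest decay rate and the largest error constant of the four gap estimates; both are
  -- those of `PairAt.diniLE_gapW`.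
  set k₀ := (8 * C ^ 3)⁻¹ with hk₀
  set D₀ := 164 * C ^ 8 with hD₀
  have hC3 : 1 ≤ C ^ 3 := one_le_pow₀ hC
  have hk1 : k₀ ≤ 1 := inv_le_one_of_one_le₀ (by linarith)
  have hkC : k₀ ≤ C⁻¹ := by
    rw [hk₀]
    gcongr
    have : C ≤ C ^ 3 := le_self_pow₀ hC (by norm_num)
    linarith
  have hD1 : 1 ≤ D₀ := by
    have : 1 ≤ C ^ 8 := one_le_pow₀ hC
    linarith
  have hpow : ∀ n ≤ 8, C ^ n ≤ C ^ 8 := fun n hn => pow_le_pow_right₀ hC hn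
  obtain ⟨b, K, k, θ₀, D, hb0, hK0, hk0, hθ0, hD0, hw⟩ := exists_lyapunov_weights
    (C₂ := 2 * C ^ 2) (by positivity : 0 < k₀) hk1 hD1 (by nlinarith)
  refine ⟨b, K, k, min θ₀ C⁻¹, D, hb0, hK0, hk0, by positivity, hD0, min_le_right _ _, ?_⟩
  intro a δ R z zh e eh Φ ε τ h ha hδ hθ
  have hθC : R + ‖a‖ + δ ≤ C⁻¹ := hθ.trans (min_le_right _ _)
  have hR0 : 0 ≤ R := (norm_nonneg _).trans h.left_le
  have hA0 := norm_nonneg a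
  have hX0 := h.pairError_nonneg (H := H) (J := J) hδ
  have hF0 : 0 ≤ pairForcing δ e eh Φ ε τ := by unfold pairForcing; positivity
  have hf : δ * (|e - eh| + δ * ‖Φ τ‖) ≤ pairForcing δ e eh Φ ε τ := by
    have h1 : δ * (δ * ‖Φ τ‖) ≤ δ * ‖Φ τ‖ :=
      mul_le_of_le_one_left (by positivity)
        (by linarith [inv_le_one_of_one_le₀ hC])
    unfold pairForcing
    linarith [norm_nonneg ε]
  have dK : DiniLE (fun t => ‖gapK c g H J a δ z zh Φ t‖)
      (δ * (-k₀ * ‖gapK c g H J a δ z zh Φ τ‖ + D₀ *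
        (‖a‖ * ‖(z τ).1 - (zh τ).1‖ + pairError c g H J a δ R z zh e eh Φ ε τ))) τ := by
    refine (h.diniLE_gapK hb hδ hθC).mono (mul_le_mul_of_nonneg_left (add_le_add ?_ ?_) hδ)
    · gcongr
    · rw [← mul_assoc]
      gcongr
      have := hpow 7 (by norm_num)
      have : 0 ≤ C ^ 8 := by positivity
      linarith
  have dM : DiniLE (fun t => ‖(z t).2.2.2 - (zh t).2.2.2‖)
      (δ * (-k₀ * ‖(z τ).2.2.2 - (zh τ).2.2.2‖ + D₀ *
        pairError c g H J a δ R z zh e eh Φ ε τ)) τ := by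
    refine (h.diniLE_gap_m hb hδ hθC).mono (mul_le_mul_of_nonneg_left (add_le_add ?_ ?_) hδ)
    · gcongr
    · rw [← mul_assoc]
      gcongr
      have := hpow 4 (by norm_num)
      have : 0 ≤ C ^ 8 := by positivity
      linarith
  have dU : DiniLE (fun t => ‖gapU g z zh t‖)
      (δ * (-k₀ * ‖gapU g z zh τ‖ + D₀ * ((R + ‖a‖ + δ) * (‖gapK c g H J a δ z zh Φ τ‖ +
        ‖(z τ).2.2.2 - (zh τ).2.2.2‖) + ‖(zh τ).2.1‖ * ‖(z τ).1 - (zh τ).1‖ +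
        ‖a‖ * ‖(z τ).1 - (zh τ).1‖ + (|e - eh| + δ * ‖Φ τ‖) +
        (R + ‖a‖ + δ) * (δ * ‖gapU g z zh τ‖)))) τ := by
    refine (h.diniLE_gapU hb hδ hθC).mono (mul_le_mul_of_nonneg_left (add_le_add ?_ ?_) hδ)
    · gcongr
    · rw [← mul_assoc, ← add_assoc _ |e - eh|]
      gcongr
      have := hpow 5 (by norm_num)
      have : 0 ≤ C ^ 8 := by positivity
      linarith
  have dW : DiniLE (fun t => ‖gapW c g H J a δ z zh Φ t‖)
      (δ * (-k₀ * (‖a‖ * ‖gapW c g H J a δ z zh Φ τ‖) + D₀ *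
        pairError c g H J a δ R z zh e eh Φ ε τ)) τ := by
    refine (h.diniLE_gapW hb hδ hθC ha.pos ha.weight_le ha.le_weight).mono (le_of_eq ?_)
    rw [hk₀, hD₀]; ring
  have hfast := ((dK.const_mul hb0.le).add (dM.const_mul hb0.le)).add
    (dU.const_mul (mul_nonneg hK0.le hδ))
  obtain ⟨h1, h2⟩ := hw (R + ‖a‖ + δ) ‖a‖ δ ‖gapW c g H J a δ z zh Φ τ‖
    ‖gapK c g H J a δ z zh Φ τ‖ ‖(z τ).2.2.2 - (zh τ).2.2.2‖ ‖gapU g z zh τ‖ ‖(z τ).1 - (zh τ).1‖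
    (‖(zh τ).2.1‖ * ‖(z τ).1 - (zh τ).1‖) (|e - eh| + δ * ‖Φ τ‖) (pairForcing δ e eh Φ ε τ)
    hA0 hδ (norm_nonneg _) (norm_nonneg _) (norm_nonneg _) (norm_nonneg _) (norm_nonneg _)
    (by positivity) hF0 (hθ.trans (min_le_left _ _)) (by linarith) (by linarith)
    (PairAt.norm_gap_r_le hb ha) hf
  constructor
  · refine hfast.mono (le_trans (le_of_eq ?_) (mul_le_mul_of_nonneg_left h1 hδ))
    unfold pairError; ring
  · refine (dW.add hfast).mono (le_trans (le_of_eq ?_) (mul_le_mul_of_nonneg_left h2 hδ))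
    unfold pairError; ring

end Pair

/-! ### Driven trajectories and the quadratic forcing. -/

/-- A controller trajectory on `[0, T]` driven by the cost error `e`, which is controlled by the
size `N` of the boundary layer of the plant. -/
structure DrivenTrajectory (c : EscConstants) (g : Plane → ℝ) (lam B : ℝ) (a : Plane)
    (δ ω R T : ℝ) (z : ℝ → EscState) (e N : ℝ → ℝ) : Prop where
  continuousOn : ContinuousOn z (Icc 0 T)
  hasDeriv : ∀ τ ∈ Ico 0 T, HasDerivWithinAt z
    (δ • escField c τ (g ((z τ).1 + perturbation c a τ) + e τ) (z τ)) (Ici τ) τ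
  norm_le : ∀ τ ∈ Icc 0 T, ‖z τ‖ ≤ R
  layer_continuousOn : ContinuousOn N (Icc 0 T)
  layer_nonneg : ∀ τ ∈ Icc 0 T, 0 ≤ N τ
  error_le : ∀ τ ∈ Icc 0 T, |e τ| ≤ B * N τ
  layer_dini : ∀ τ ∈ Ico 0 T, DiniLE N (-(lam / ω) * N τ + B * (‖a‖ + δ * ‖(z τ).2.1‖)) τ

/-- An exponentially decaying fence. -/
theorem le_exp_add_of_diniLE {f : ℝ → ℝ} {T k m : ℝ} (hf : ContinuousOn f (Icc 0 T)) (hk : 0 < k)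
    (hm : 0 < m) (hd : ∀ t ∈ Ico 0 T, DiniLE f (-k * f t + m) t) :
    ∀ t ∈ Icc 0 T, f t ≤ f 0 * Real.exp (-k * t) + 2 * m / k := by
  -- The equilibrium of the comparison equation is `m / k`; doubling it makes the fence strict.
  refine le_of_diniLE_of_strict_supersolution
    (B' := fun t => f 0 * (Real.exp (-k * t) * -k)) hf ?_ (fun t => ?_) fun t ht heq => ?_
  · have : 0 < 2 * m / k := by positivity
    simp only [mul_zero, Real.exp_zero, mul_one]
    linarith
  · have h1 : HasDerivAt (fun t : ℝ => -k * t) (-k) t := by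
      simpa using (hasDerivAt_id t).const_mul (-k)
    exact (h1.exp.const_mul (f 0)).add_const _
  · refine ⟨_, hd t ht, ?_⟩
    rw [heq]
    have : k * (2 * m / k) = 2 * m := by field_simp
    nlinarith

theorem continuousOn_plane {s : Set ℝ} {v : ℝ → Plane}
    (h : ∀ i, ContinuousOn (fun t => v t i) s) : ContinuousOn v s :=
  (PiLp.continuous_toLp 2 _).comp_continuousOn (continuousOn_pi.2 h)

section Pair

variable {c : EscConstants} {g : Plane → ℝ} {H : Plane →L[ℝ] Plane →L[ℝ] ℝ}
  {J : Fin 2 → Fin 2 → ℝ → ℝ} {C : ℝ}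

theorem EscBounds.continuousOn_gaps (hb : EscBounds c g H J C) {a : Plane} {δ T : ℝ}
    {z zh : ℝ → EscState} {Φ : ℝ → Plane} (hz : ContinuousOn z (Icc 0 T))
    (hzh : ContinuousOn zh (Icc 0 T)) (hΦ : ContinuousOn Φ (Icc 0 T)) :
    ContinuousOn (gapU g z zh) (Icc 0 T) ∧
      ContinuousOn (gapK c g H J a δ z zh Φ) (Icc 0 T) ∧
      ContinuousOn (gapW c g H J a δ z zh Φ) (Icc 0 T) := by
  have hg : Continuous g := hb.hess.differentiable.continuous
  have hJ : ∀ i j, Continuous (J i j) := fun i j =>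
    continuous_iff_continuousAt.2 fun t => (hb.primitive i j t).continuousAt
  have happ : ∀ {v : ℝ → Plane}, ContinuousOn v (Icc 0 T) →
      ∀ i, ContinuousOn (fun t => v t i) (Icc 0 T) := fun hv i =>
    (EuclideanSpace.proj (𝕜 := ℝ) i).continuous.comp_continuousOn hv
  have h1 : ContinuousOn (fun t => (z t).1) (Icc 0 T) := hz.fst
  have h1' : ContinuousOn (fun t => (zh t).1) (Icc 0 T) := hzh.fst
  have h2 : ContinuousOn (fun t => (z t).2.1) (Icc 0 T) := hz.snd.fst
  have h2' : ContinuousOn (fun t => (zh t).2.1) (Icc 0 T) := hzh.snd.fst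
  have h3 : ContinuousOn (fun t => (z t).2.2.1) (Icc 0 T) := hz.snd.snd.fst
  have h3' : ContinuousOn (fun t => (zh t).2.2.1) (Icc 0 T) := hzh.snd.snd.fst
  have hU : ContinuousOn (gapU g z zh) (Icc 0 T) := by
    refine continuousOn_plane fun i => ?_
    exact ((hg.comp_continuousOn h1).sub (hg.comp_continuousOn h1')).sub
      ((happ h3 i).sub (happ h3' i))
  have hK : ContinuousOn (gapK c g H J a δ z zh Φ) (Icc 0 T) := by
    refine continuousOn_plane fun i => ?_
    refine ContinuousOn.sub (ContinuousOn.sub (((happ h2 i).sub (happ h2' i)).add ?_) ?_) ?_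
    · exact continuousOn_const.mul ((happ hU i).mul (by fun_prop))
    · refine continuousOn_const.mul (continuousOn_finsetSum _ fun j _ => ?_)
      exact continuousOn_const.mul ((hJ i j).continuousOn.mul
        ((H (EuclideanSpace.single j 1)).continuous.comp_continuousOn (h1.sub h1')))
    · exact continuousOn_const.mul (happ hΦ i)
  refine ⟨hU, hK, continuousOn_plane fun i => ?_⟩
  exact continuousOn_const.mul (((happ h1 i).sub (happ h1' i)).sub
    (continuousOn_const.mul (happ hK i)))

/-- The second order part of the demodulated cost has a small primitive. -/
theorem exists_quadratic_primitive (c : EscConstants) (H : Plane →L[ℝ] Plane →L[ℝ] ℝ) :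
    ∃ B, 0 < B ∧ ∀ a : Plane, ∃ Φ : ℝ → Plane, (∀ τ i, HasDerivAt (fun t => Φ t i)
      (1 / 2 * H (perturbation c a τ) (perturbation c a τ) * Real.sin (c.freq i * τ)) τ) ∧
      ∀ τ, ‖Φ τ‖ ≤ B * ‖a‖ ^ 2 := by
  choose S D hS hD using fun i j k : Fin 2 =>
    HasBoundedPrimitive.sin_mul_sin_mul_sin (c.freq j) (c.freq k) (c.freq i)
  set h : Fin 2 → Fin 2 → ℝ := fun j k =>
    H (EuclideanSpace.single j 1) (EuclideanSpace.single k 1) with hh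
  set B := ∑ i, ∑ j, ∑ k, |h j k| * |D i j k| with hB
  have hB0 : 0 ≤ B := by positivity
  refine ⟨2 * (B + 1), by positivity, fun a => ⟨fun t => WithLp.toLp 2 fun i =>
    1 / 2 * ∑ j, ∑ k, a j * a k * h j k * S i j k t, fun τ i => ?_, fun τ => ?_⟩⟩
  · have h1 := (HasDerivAt.fun_sum (u := Finset.univ) fun j _ =>
      HasDerivAt.fun_sum (u := Finset.univ) fun k _ =>
        (hS i j k τ).const_mul (a j * a k * h j k)).const_mul (1 / 2)
    refine h1.congr_deriv ?_
    have h2 : H (perturbation c a τ) (perturbation c a τ) =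
        ∑ j, ∑ k, a j * Real.sin (c.freq j * τ) * (a k * Real.sin (c.freq k * τ)) * h j k := by
      rw [Plane.bilin_eq_sum]
      refine Finset.sum_congr rfl fun j _ => ?_
      have h3 : ∀ v : Plane, H (EuclideanSpace.single j 1) v = ∑ k, v k * h j k := fun v => by
        conv_lhs => rw [Plane.eq_sum_single v]
        simp [hh]
      rw [h3, Finset.mul_sum]
      refine Finset.sum_congr rfl fun k _ => ?_
      simp only [perturbation]
      ring
    rw [h2]
    simp only [Fin.sum_univ_two]
    ring
  · have h1 := Plane.norm_le_of_abs_le (v := WithLp.toLp 2 fun i =>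
      1 / 2 * ∑ j, ∑ k, a j * a k * h j k * S i j k τ) (b := B * ‖a‖ ^ 2) fun i => by
        have h2 : |∑ j, ∑ k, a j * a k * h j k * S i j k τ| ≤
            ∑ j, ∑ k, ‖a‖ ^ 2 * (|h j k| * |D i j k|) := by
          refine (Finset.abs_sum_le_sum_abs _ _).trans (Finset.sum_le_sum fun j _ => ?_)
          refine (Finset.abs_sum_le_sum_abs _ _).trans (Finset.sum_le_sum fun k _ => ?_)
          rw [abs_mul, abs_mul, abs_mul, pow_two, mul_assoc (|a j| * |a k|)]
          have := Plane.abs_apply_le a j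
          have := Plane.abs_apply_le a k
          have := (hD i j k τ).trans (le_abs_self _)
          gcongr
        have h3 : ∑ j, ∑ k, ‖a‖ ^ 2 * (|h j k| * |D i j k|) ≤ B * ‖a‖ ^ 2 := by
          simp only [← Finset.mul_sum]
          rw [mul_comm]
          gcongr
          rw [hB]
          exact Finset.single_le_sum (f := fun i => ∑ j, ∑ k, |h j k| * |D i j k|)
            (fun i _ => by positivity) (Finset.mem_univ i)
        simp only [abs_mul]
        rw [abs_of_pos (by norm_num : (0 : ℝ) < 1 / 2)]
        have h4 := abs_nonneg (∑ j, ∑ k, a j * a k * h j k * S i j k τ)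
        linarith
    refine h1.trans ?_
    have := sq_nonneg ‖a‖
    nlinarith

end Pair

/-! ### Dissipation and stability of a single trajectory. -/

/-- The Lyapunov function of the fast part of the gap of two controller trajectories. -/
noncomputable def fastGap (c : EscConstants) (g : Plane → ℝ) (H : Plane →L[ℝ] Plane →L[ℝ] ℝ)
    (J : Fin 2 → Fin 2 → ℝ → ℝ) (a : Plane) (δ b K : ℝ) (z zh : ℝ → EscState) (Φ : ℝ → Plane)
    (t : ℝ) : ℝ :=
  b * ‖gapK c g H J a δ z zh Φ t‖ + b * ‖(z t).2.2.2 - (zh t).2.2.2‖ + K * δ * ‖gapU g z zh t‖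

/-- Absorbing the boundary layer into the Lyapunov functions. -/
theorem layer_absorption {k₀ D Cf C₃ lam B A δ ω s nk nm nu N q F Kn : ℝ}
    (hD : 0 < D) (hCf : 0 < Cf) (hC₃ : 1 ≤ C₃) (hlam : 0 < lam) (hB : 0 < B)
    (hA : 0 ≤ A) (hδ : 0 ≤ δ) (hω : 0 < ω) (hnk : 0 ≤ nk) (hnu : 0 ≤ nu)
    (hA1 : A ≤ 1) (hδ1 : δ ≤ 1)
    (hKn : Kn * lam = D * Cf + 1) (hKn0 : 0 < Kn)
    (hsmall : Kn * B * C₃ * ω ≤ k₀ / 2)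
    (hF : F ≤ Cf * (N + A ^ 3 + δ * A ^ 2))
    (hq : q ≤ nk + C₃ * (δ * nu + (1 + Cf) * A)) :
    -k₀ * (s + nk + nm + δ * nu) + D * F + Kn * ω * (-(lam / ω) * N + B * (A + δ * q)) ≤
      -k₀ * (s + nm) - k₀ / 2 * (nk + δ * nu) - N +
        (D * Cf + Kn * B * (1 + C₃ * (1 + Cf))) * (A * (A ^ 2 + δ + ω)) := by
  have h1 : ω * (-(lam / ω) * N) = -lam * N := by field_simp
  have h2 : D * F ≤ D * (Cf * (N + A ^ 3 + δ * A ^ 2)) := by gcongr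
  have h3 : δ * q ≤ nk + C₃ * (δ * nu) + C₃ * (1 + Cf) * A := by
    have h4 : δ * q ≤ δ * (nk + C₃ * (δ * nu + (1 + Cf) * A)) := by gcongr
    have h5 : δ * (nk + C₃ * (δ * nu + (1 + Cf) * A)) ≤ nk + C₃ * (δ * nu + (1 + Cf) * A) :=
      mul_le_of_le_one_left (by positivity) hδ1
    linarith
  have h4 : Kn * ω * (B * (A + δ * q)) ≤
      Kn * ω * (B * (A + (nk + C₃ * (δ * nu) + C₃ * (1 + Cf) * A))) := by gcongr
  have h5 : Kn * B * ω * nk ≤ k₀ / 2 * nk := by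
    gcongr
    refine le_trans ?_ hsmall
    rw [mul_assoc (Kn * B)]
    gcongr
    exact le_mul_of_one_le_left hω.le hC₃
  have h6 : Kn * B * C₃ * ω * (δ * nu) ≤ k₀ / 2 * (δ * nu) := by gcongr
  have h7 : D * Cf * (A ^ 3 + δ * A ^ 2) ≤ D * Cf * (A * (A ^ 2 + δ + ω)) := by
    gcongr
    have h8 : δ * A ^ 2 ≤ δ * A := by gcongr; nlinarith
    nlinarith [mul_nonneg hA hω.le]
  have h8 : Kn * B * (1 + C₃ * (1 + Cf)) * (ω * A) ≤
      Kn * B * (1 + C₃ * (1 + Cf)) * (A * (A ^ 2 + δ + ω)) := by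
    refine mul_le_mul_of_nonneg_left ?_ (by positivity)
    rw [mul_comm ω]
    gcongr
    have := sq_nonneg A
    linarith
  have h9 : Kn * ω * (-(lam / ω) * N) = -(D * Cf + 1) * N := by
    rw [mul_assoc, h1, ← hKn]; ring
  linarith

section Single

variable {c : EscConstants} {g : Plane → ℝ} {H : Plane →L[ℝ] Plane →L[ℝ] ℝ}
  {J : Fin 2 → Fin 2 → ℝ → ℝ} {C : ℝ}

/-- The forcing of a single driven trajectory, seen as a pair with the zero trajectory. -/
theorem EscBounds.exists_single_forcing (hb : EscBounds c g H J C) {B : ℝ} (hB : 0 < B) :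
    ∃ Cf, 0 < Cf ∧ ∀ a : Plane, ‖a‖ ≤ 1 → ∃ Φ : ℝ → Plane, Continuous Φ ∧
      (∀ τ, ‖Φ τ‖ ≤ Cf * ‖a‖ ^ 2) ∧
      ∀ (lam δ ω R T : ℝ) (z : ℝ → EscState) (e N : ℝ → ℝ), 0 ≤ δ → δ ≤ 1 →
        DrivenTrajectory c g lam B a δ ω R T z e N → ∀ τ ∈ Ico 0 T, ∃ (eh : ℝ) (ε : Plane),
          PairAt c g a δ R z (fun _ => 0) (e τ) eh Φ ε τ ∧
          |e τ - eh| ≤ Cf * (N τ + ‖a‖ ^ 2) ∧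
          pairForcing δ (e τ) eh Φ ε τ ≤ Cf * (N τ + ‖a‖ ^ 3 + δ * ‖a‖ ^ 2) := by
  obtain ⟨BΦ, hBΦ, hΦ⟩ := exists_quadratic_primitive c H
  have hC0 := hb.pos
  refine ⟨3 * B + 4 * C + BΦ, by positivity, fun a ha1 => ?_⟩
  obtain ⟨Φ, hder, hle⟩ := hΦ a
  have hA0 := norm_nonneg a
  refine ⟨Φ, ?_, fun τ => (hle τ).trans ?_, ?_⟩
  · rw [← continuousOn_univ]
    exact continuousOn_plane fun i t _ => (hder t i).continuousAt.continuousWithinAt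
  · gcongr; linarith
  intro lam δ ω R T z e N hδ hδ1 hd τ hτ
  have hτ' : τ ∈ Icc 0 T := ⟨hτ.1, hτ.2.le⟩
  set p := perturbation c a τ with hp
  have hpa : ‖p‖ ≤ ‖a‖ := norm_perturbation_le c a τ
  have hR0 : 0 ≤ R := (norm_nonneg _).trans (hd.norm_le τ hτ')
  set ε : Plane := WithLp.toLp 2 fun i =>
    (e τ + (g p - 1 / 2 * H p p)) * Real.sin (c.freq i * τ) with hε
  have htay : |g p - 1 / 2 * H p p| ≤ C * ‖a‖ ^ 3 :=
    (hb.hess.taylor p (hpa.trans ha1)).trans (by gcongr)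
  have hquad : |H p p| ≤ C * ‖a‖ ^ 2 := by
    refine (Plane.abs_bilin_le H hb.hess.norm_le p p).trans ?_
    rw [mul_assoc, pow_two]; gcongr
  have he := hd.error_le τ hτ'
  have hN := hd.layer_nonneg τ hτ'
  have h3 : ‖a‖ ^ 3 ≤ ‖a‖ ^ 2 := pow_le_pow_of_le_one hA0 ha1 (by norm_num)
  have hCA : C * ‖a‖ ^ 3 ≤ C * ‖a‖ ^ 2 := by gcongr
  have hgap : |e τ - -g p| ≤ B * N τ + 2 * C * ‖a‖ ^ 2 := by
    have h1 : e τ - -g p = e τ + ((g p - 1 / 2 * H p p) + 1 / 2 * H p p) := by ring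
    rw [h1]
    have h2 := abs_add_le (e τ) ((g p - 1 / 2 * H p p) + 1 / 2 * H p p)
    have h4 := abs_add_le (g p - 1 / 2 * H p p) (1 / 2 * H p p)
    rw [abs_mul, abs_of_pos (by norm_num : (0 : ℝ) < 1 / 2)] at h4
    have h5 := abs_nonneg (H p p)
    linarith
  have hεle : ‖ε‖ ≤ 2 * (B * N τ + C * ‖a‖ ^ 3) := by
    refine Plane.norm_le_of_abs_le fun i => ?_
    refine abs_mul_le_of_le ?_ (Real.abs_sin_le_one _)
    exact (abs_add_le _ _).trans (add_le_add he htay)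
  -- With the cost error `-g p` the zero trajectory receives the signal `0` and is a controller
  -- trajectory. The demodulated error gap `(e + g p) * sin` then splits into the derivative of `Φ`,
  -- which carries the quadratic part of `g p`, and `ε`, which keeps the layer error and the cubic
  -- remainder.
  refine ⟨-g p, ε, ⟨hd.hasDeriv τ hτ, ?_, fun i => ?_, hd.norm_le τ hτ', by simpa using hR0⟩,
    ?_, ?_⟩
  · have h1 : escField c τ (g ((0 : EscState).1 + perturbation c a τ) + -g p) 0 = 0 := by
      simp only [Prod.fst_zero, zero_add]
      rw [← hp, add_neg_cancel]
      ext i <;> simp [escField]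
    rw [h1, smul_zero]
    exact hasDerivWithinAt_const _ _ _
  · refine (hder τ i).hasDerivWithinAt.congr_deriv ?_
    simp only [hε]
    ring
  · refine hgap.trans ?_
    have h1 := sq_nonneg ‖a‖
    nlinarith [mul_nonneg hB.le hN, mul_nonneg hC0.le hN, mul_nonneg hBΦ.le hN,
      mul_nonneg hB.le h1, mul_nonneg hC0.le h1, mul_nonneg hBΦ.le h1]
  · unfold pairForcing
    have h1 : δ * ‖Φ τ‖ ≤ δ * (BΦ * ‖a‖ ^ 2) := by gcongr; exact hle τ
    have h2 : δ * |e τ - -g p| ≤ δ * (B * N τ + 2 * C * ‖a‖ ^ 2) := by gcongr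
    have h4 : δ * (B * N τ) ≤ B * N τ := mul_le_of_le_one_left (by positivity) hδ1
    have q1 : 0 ≤ ‖a‖ ^ 3 := by positivity
    have q2 : 0 ≤ δ * ‖a‖ ^ 2 := by positivity
    nlinarith [mul_nonneg hC0.le hN, mul_nonneg hBΦ.le hN, mul_nonneg hB.le q1,
      mul_nonneg hC0.le q1, mul_nonneg hBΦ.le q1, mul_nonneg hB.le q2, mul_nonneg hC0.le q2]

set_option maxHeartbeats 1000000 in
/-- Dissipation along a single driven trajectory. -/
theorem EscBounds.exists_single_lyapunov (hb : EscBounds c g H J C) {lam B : ℝ} (hlam : 0 < lam)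
    (hB : 0 < B) :
    ∃ b K Kn k Q θ₁ : ℝ, 0 < b ∧ 0 < K ∧ 0 < Kn ∧ 0 < k ∧ 0 < Q ∧ 0 < θ₁ ∧ θ₁ ≤ C⁻¹ ∧
      ∀ (a : Plane) (δ ω R T : ℝ) (z : ℝ → EscState) (e N : ℝ → ℝ),
        DrivenTrajectory c g lam B a δ ω R T z e N → AdmissibleAmplitude c C a → 0 < δ → 0 < ω →
        0 ≤ R → R + ‖a‖ + δ + ω ≤ θ₁ →
        ∃ Φ : ℝ → Plane, Continuous Φ ∧ (∀ τ, ‖Φ τ‖ ≤ Q * ‖a‖ ^ 2) ∧ ∀ τ ∈ Ico 0 T,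
          DiniLE (fun t => fastGap c g H J a δ b K z (fun _ => 0) Φ t + Kn * δ * ω * N t)
            (δ * (-k * (fastGap c g H J a δ b K z (fun _ => 0) Φ τ + Kn * δ * ω * N τ) +
              Q * ‖a‖)) τ ∧
          DiniLE (fun t => ‖gapW c g H J a δ z (fun _ => 0) Φ t‖ +
              fastGap c g H J a δ b K z (fun _ => 0) Φ t + Kn * δ * ω * N t)
            (δ * (-k * (‖a‖ * (‖gapW c g H J a δ z (fun _ => 0) Φ τ‖ +
              fastGap c g H J a δ b K z (fun _ => 0) Φ τ + Kn * δ * ω * N τ)) +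
              Q * (‖a‖ * (‖a‖ ^ 2 + δ + ω)))) τ ∧
          DiniLE (fun t => ‖gapU g z (fun _ => 0) t‖)
            (δ * (-k * ‖gapU g z (fun _ => 0) τ‖ +
              Q * (‖gapK c g H J a δ z (fun _ => 0) Φ τ‖ + ‖(z τ).2.2.2‖ + ‖(z τ).1‖ +
                N τ + ‖a‖))) τ := by
  obtain ⟨b, K, k₀, θ₀, D, hb0, hK0, hk0, hθ0, hD0, hθC, hlyap⟩ := hb.exists_lyapunov
  obtain ⟨Cf, hCf, hforce⟩ := hb.exists_single_forcing hB
  have hC := hb.one_le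
  have hC0 := hb.pos
  have hCinv : C⁻¹ ≤ 1 := inv_le_one_of_one_le₀ hC
  -- The layer term `Kn * δ * ω * N` decays by `δ * Kn * lam * N`, which outweighs the forcing `δ *
  -- D * Cf * N` and leaves `δ * N` to spare.
  set Kn := (D * Cf + 1) / lam with hKn
  have hKn0 : 0 < Kn := by positivity
  have hKne : Kn * lam = D * Cf + 1 := by rw [hKn]; field_simp
  set C₃ := 4 * C ^ 3 with hC₃
  have hC₃1 : 1 ≤ C₃ := by
    have : 1 ≤ C ^ 3 := one_le_pow₀ hC
    linarith
  set Q₁ := D * Cf + Kn * B * (1 + C₃ * (1 + Cf)) with hQ₁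
  have hQ₁0 : 0 < Q₁ := by positivity
  set S := 1 + b + K + Kn with hS
  have hS1 : 0 < S := by positivity
  set m := min (k₀ / 2) 1 with hm
  have hm0 : 0 < m := by positivity
  have hm1 : m ≤ k₀ / 2 := min_le_left _ _
  have hm2 : m ≤ 1 := min_le_right _ _
  set k := min (m / S) (C⁻¹ / 2) with hk
  have hkpos : 0 < k := by positivity
  have hkS : k * S ≤ m := by
    calc k * S ≤ m / S * S := by gcongr; exact min_le_left _ _
      _ = m := by field_simp
  set Q := 3 * Q₁ + D + Cf + 80 * C ^ 5 * (1 + Cf) with hQ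
  have hQ0 : 0 < Q := by positivity
  -- The second entry makes `ω` small enough to absorb the feedback of the gradient estimate through
  -- the layer; the third makes `δ` small enough for the self-coupling of `gapU` to use only half of
  -- its decay.
  set θ₁ := min θ₀ (min (k₀ / 2 / (Kn * B * C₃)) (C⁻¹ / 2 / (40 * C ^ 5))) with hθ₁
  have hθ₁0 : 0 < θ₁ := by positivity
  refine ⟨b, K, Kn, k, Q, θ₁, hb0, hK0, hKn0, hkpos, hQ0, hθ₁0, (min_le_left _ _).trans hθC, ?_⟩
  intro a δ ω R T z e N hd ha hδ hω hR hθ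
  have hA0 := norm_nonneg a
  have hθle0 : R + ‖a‖ + δ + ω ≤ θ₀ := hθ.trans (min_le_left _ _)
  have hθle1 : R + ‖a‖ + δ + ω ≤ C⁻¹ := hθle0.trans hθC
  have hA1 : ‖a‖ ≤ 1 := by linarith
  have hδ1 : δ ≤ 1 := by linarith
  have hω1 : ω ≤ 1 := by linarith
  have hωsmall : Kn * B * C₃ * ω ≤ k₀ / 2 := by
    have h1 : ω ≤ k₀ / 2 / (Kn * B * C₃) := by
      have := hθ.trans ((min_le_right _ _).trans (min_le_left _ _))
      linarith
    rwa [le_div_iff₀ (by positivity), mul_comm] at h1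
  have hδsmall : 40 * C ^ 5 * δ ≤ C⁻¹ / 2 := by
    have h1 : δ ≤ C⁻¹ / 2 / (40 * C ^ 5) := by
      have := hθ.trans ((min_le_right _ _).trans (min_le_right _ _))
      linarith
    rwa [le_div_iff₀ (by positivity), mul_comm] at h1
  obtain ⟨Φ, hΦc, hΦle, hpair⟩ := hforce a hA1
  have h80 : 0 < 80 * C ^ 5 * (1 + Cf) := by positivity
  have hQCf : Cf ≤ Q := by rw [hQ]; linarith
  have hQQ₁ : 2 * Q₁ + D ≤ Q - Q₁ := by rw [hQ]; linarith
  have hQ80 : 80 * C ^ 5 * (1 + Cf) ≤ Q := by rw [hQ]; linarith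
  refine ⟨Φ, hΦc, fun τ => (hΦle τ).trans (by gcongr), fun τ hτ => ?_⟩
  have hτ' : τ ∈ Icc 0 T := ⟨hτ.1, hτ.2.le⟩
  obtain ⟨eh, ε, hP, hΔ, hF⟩ := hpair lam δ ω R T z e N hδ.le hδ1 hd τ hτ
  obtain ⟨dfast, dall⟩ := hlyap a δ R z (fun _ => 0) (e τ) eh Φ ε τ hP ha hδ.le (by linarith)
  have dN := (hd.layer_dini τ hτ).const_mul (by positivity : 0 ≤ Kn * δ * ω)
  have dU := hP.diniLE_gapU hb hδ.le (by linarith)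
  have hqle := PairAt.norm_gap_q_le (a := a) (z := z) (zh := fun _ => 0) (Φ := Φ) (τ := τ) hb hδ.le
  have hN0 := hd.layer_nonneg τ hτ'
  have hzle := EscState.norms_le (hd.norm_le τ hτ')
  simp only [Prod.fst_zero, Prod.snd_zero, sub_zero, norm_zero, zero_mul, mul_zero, zero_add,
    add_zero] at dfast dall dU hqle
  have hr1 : ‖(z τ).1‖ ≤ 1 := by linarith [hzle.1]
  have hr0 := norm_nonneg (z τ).1
  have hm0' := norm_nonneg (z τ).2.2.2
  have hs0 := norm_nonneg (gapW c g H J a δ z (fun _ => 0) Φ τ)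
  have hk0' := norm_nonneg (gapK c g H J a δ z (fun _ => 0) Φ τ)
  have hu0 := norm_nonneg (gapU g z (fun _ => 0) τ)
  have hΦτ := hΦle τ
  have hΦ0 := norm_nonneg (Φ τ)
  have hfg : fastGap c g H J a δ b K z (fun _ => 0) Φ τ =
      b * ‖gapK c g H J a δ z (fun _ => 0) Φ τ‖ + b * ‖(z τ).2.2.2‖ +
        K * δ * ‖gapU g z (fun _ => 0) τ‖ := by
    simp [fastGap]
  have dfast' := dfast.add dN
  have dall' := dall.add dN
  have hfun : ∀ t, fastGap c g H J a δ b K z (fun _ => 0) Φ t =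
      b * ‖gapK c g H J a δ z (fun _ => 0) Φ t‖ + b * ‖(z t).2.2.2‖ +
        K * δ * ‖gapU g z (fun _ => 0) t‖ := fun t => by simp [fastGap]
  simp only [hfun]
  set s := ‖gapW c g H J a δ z (fun _ => 0) Φ τ‖ with hs
  set nk := ‖gapK c g H J a δ z (fun _ => 0) Φ τ‖ with hnk
  set nu := ‖gapU g z (fun _ => 0) τ‖ with hnu
  set nm := ‖(z τ).2.2.2‖ with hnm
  set nr := ‖(z τ).1‖ with hnr
  set A := ‖a‖ with hAdef
  have hAA : A ^ 2 ≤ A := pow_le_of_le_one hA0 hA1 two_ne_zero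
  have hq : ‖(z τ).2.1‖ ≤ nk + C₃ * (δ * nu + (1 + Cf) * A) := by
    refine hqle.trans ?_
    rw [hC₃]
    gcongr
    have h1 : A * nr ≤ A := mul_le_of_le_one_right hA0 hr1
    have h2 : ‖Φ τ‖ ≤ Cf * A := hΦτ.trans (by gcongr)
    have h3 : δ * (A * nr + ‖Φ τ‖) ≤ A * nr + ‖Φ τ‖ :=
      mul_le_of_le_one_left (by positivity) hδ1
    linarith
  have hun : 0 ≤ δ * nu := by positivity
  have hP0 : 0 ≤ A * (A ^ 2 + δ + ω) := by positivity
  -- comparison of the functions with their dissipation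
  have hW : k * (b * nk + b * nm + K * δ * nu + Kn * δ * ω * N τ) ≤
      m * (nk + nm + δ * nu + N τ) := by
    have h1 : b * nk + b * nm + K * δ * nu + Kn * δ * ω * N τ ≤
        S * (nk + nm + δ * nu + N τ) := by
      have h2 : Kn * δ * ω * N τ ≤ Kn * N τ := by
        rw [mul_assoc Kn]
        gcongr
        exact mul_le_of_le_one_right hKn0.le (mul_le_one₀ hδ1 hω.le hω1)
      have h3 : b * nk ≤ S * nk := by gcongr; rw [hS]; linarith
      have h4 : b * nm ≤ S * nm := by gcongr; rw [hS]; linarith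
      have h5 : K * (δ * nu) ≤ S * (δ * nu) := by gcongr; rw [hS]; linarith
      have h6 : Kn * N τ ≤ S * N τ := by gcongr; rw [hS]; linarith
      linarith
    calc _ ≤ k * (S * (nk + nm + δ * nu + N τ)) := by gcongr
      _ = k * S * (nk + nm + δ * nu + N τ) := by ring
      _ ≤ _ := by gcongr
  have hV : k * (A * (s + (b * nk + b * nm + K * δ * nu) + Kn * δ * ω * N τ)) ≤
      m * (A * s + nk + nm + δ * nu + N τ) := by
    have h1 : k * (A * s) ≤ m * (A * s) := by
      have h2 : k ≤ k * S := le_mul_of_one_le_right hkpos.le (by linarith)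
      have := h2.trans hkS
      gcongr
    have h2 : A * (k * (b * nk + b * nm + K * δ * nu + Kn * δ * ω * N τ)) ≤
        k * (b * nk + b * nm + K * δ * nu + Kn * δ * ω * N τ) :=
      mul_le_of_le_one_left (by positivity) hA1
    linarith
  have hmk : m * (nk + nm + δ * nu + N τ) ≤ k₀ / 2 * (nk + δ * nu) + k₀ * nm + N τ := by
    have h1 : m * nk ≤ k₀ / 2 * nk := by gcongr
    have h2 : m * nm ≤ k₀ * nm := by gcongr; linarith
    have h3 : m * (δ * nu) ≤ k₀ / 2 * (δ * nu) := by gcongr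
    have h4 : m * N τ ≤ 1 * N τ := by gcongr
    linarith
  refine ⟨dfast'.mono ?_, dall'.mono ?_, dU.mono ?_⟩
  · have habs := layer_absorption (s := 0) (nm := nm) hD0 hCf hC₃1 hlam hB hA0 hδ.le hω
      hk0' hu0 hA1 hδ1 hKne hKn0 hωsmall hF hq
    have h1 : A * (A ^ 2 + δ + ω) ≤ A * 3 := by gcongr; linarith
    have h2 : Q₁ * (A * (A ^ 2 + δ + ω)) ≤ Q₁ * (A * 3) := by gcongr
    have h3 : D * (A * nr) ≤ D * A := by gcongr; exact mul_le_of_le_one_right hA0 hr1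
    have h4 : 0 ≤ (Q - (3 * Q₁ + D)) * A := mul_nonneg (by linarith) hA0
    calc _ = δ * ((-k₀ * (0 + nk + nm + δ * nu) + D * pairForcing δ (e τ) eh Φ ε τ +
          Kn * ω * (-(lam / ω) * N τ + B * (A + δ * ‖(z τ).2.1‖))) + D * (A * nr)) := by ring
      _ ≤ _ := by
        refine mul_le_mul_of_nonneg_left ?_ hδ.le
        linarith
  · have habs := layer_absorption (s := A * s) (nm := nm) hD0 hCf hC₃1 hlam hB hA0 hδ.le hω
      hk0' hu0 hA1 hδ1 hKne hKn0 hωsmall hF hq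
    have h1 : m * (A * s) ≤ k₀ * (A * s) := by gcongr; linarith
    have h2 : Q₁ * (A * (A ^ 2 + δ + ω)) ≤ Q * (A * (A ^ 2 + δ + ω)) := by gcongr; linarith
    calc _ = δ * (-k₀ * (A * s + nk + nm + δ * nu) + D * pairForcing δ (e τ) eh Φ ε τ +
          Kn * ω * (-(lam / ω) * N τ + B * (A + δ * ‖(z τ).2.1‖))) := by ring
      _ ≤ _ := by
        refine mul_le_mul_of_nonneg_left ?_ hδ.le
        linarith
  · refine mul_le_mul_of_nonneg_left ?_ hδ.le
    have hθ1 : R + A + δ ≤ 1 := by linarith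
    have h1 : (R + A + δ) * (nk + nm) ≤ nk + nm := mul_le_of_le_one_left (by positivity) hθ1
    have h2 : (R + A + δ) * (δ * nu) ≤ δ * nu := mul_le_of_le_one_left hun hθ1
    have h3 : A * nr ≤ nr := mul_le_of_le_one_left hr0 hA1
    have h4 : δ * ‖Φ τ‖ ≤ Cf * A :=
      (mul_le_of_le_one_left hΦ0 hδ1).trans (hΦτ.trans (by gcongr))
    have h5 : |e τ - eh| ≤ Cf * (N τ + A) := hΔ.trans (by gcongr)
    have h6 : 40 * C ^ 5 * δ * nu ≤ C⁻¹ / 2 * nu := by gcongr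
    have h7 : k * nu ≤ C⁻¹ / 2 * nu := by gcongr; exact min_le_right _ _
    have h8 : (R + A + δ) * (nk + nm) + A * nr + |e τ - eh| + δ * ‖Φ τ‖ ≤
        (1 + Cf) * (nk + nm + nr + N τ + 2 * A) := by
      have q1 : 0 ≤ Cf * (nk + nm + nr) := by positivity
      linarith
    have h9 : 40 * C ^ 5 * ((R + A + δ) * (nk + nm) + A * nr + |e τ - eh| + δ * ‖Φ τ‖) ≤
        40 * C ^ 5 * ((1 + Cf) * (2 * (nk + nm + nr + N τ + A))) := by
      refine mul_le_mul_of_nonneg_left (h8.trans ?_) (by positivity)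
      gcongr
      linarith
    have h10 : 80 * C ^ 5 * (1 + Cf) * (nk + nm + nr + N τ + A) ≤
        Q * (nk + nm + nr + N τ + A) := by gcongr
    have h11 : 40 * C ^ 5 * ((R + A + δ) * (δ * nu)) ≤ 40 * C ^ 5 * (δ * nu) := by gcongr
    linarith

end Single

theorem HessianBounds.abs_sub_le {E : Type*} [NormedAddCommGroup E] [NormedSpace ℝ E] {g : E → ℝ}
    {H : E →L[ℝ] E →L[ℝ] ℝ} {C : ℝ} (hg : HessianBounds g H C) (hC : 0 ≤ C) {s s' : E}
    (hs : ‖s‖ ≤ 1) (hs' : ‖s'‖ ≤ 1) : |g s - g s'| ≤ C * ‖s - s'‖ := by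
  have key : ∀ x ∈ Metric.closedBall (0 : E) 1, ‖fderiv ℝ g x‖ ≤ C := fun x hx => by
    have hx1 : ‖x‖ ≤ 1 := by simpa using hx
    have h1 := hg.fderiv_lip x 0 (by linarith) (by simp)
    rw [hg.fderiv_zero, sub_zero, sub_zero] at h1
    exact h1.trans (mul_le_of_le_one_right hC hx1)
  exact (convex_closedBall (0 : E) 1).norm_image_sub_le_of_norm_fderiv_le
    (fun x _ => hg.differentiable x) key (by simpa using hs') (by simpa using hs)

section Pair

variable {c : EscConstants} {g : Plane → ℝ} {H : Plane →L[ℝ] Plane →L[ℝ] ℝ}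
  {J : Fin 2 → Fin 2 → ℝ → ℝ} {C : ℝ} {a : Plane} {δ : ℝ} {z zh : ℝ → EscState}
  {Φ : ℝ → Plane} {τ : ℝ}

/-- The transformed gaps are controlled by the gap of the trajectories. -/
theorem EscBounds.norm_gaps_le (hb : EscBounds c g H J C) (ha : AdmissibleAmplitude c C a)
    (hδ : 0 ≤ δ) (hδ1 : δ ≤ 1) (hA1 : ‖a‖ ≤ 1) (hz : ‖z τ‖ ≤ 1) (hzh : ‖zh τ‖ ≤ 1) :
    ‖gapU g z zh τ‖ ≤ 4 * C * ‖z τ - zh τ‖ ∧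
      ‖gapK c g H J a δ z zh Φ τ‖ ≤ 25 * C ^ 4 * (‖z τ - zh τ‖ + δ * ‖Φ τ‖) ∧
      ‖gapW c g H J a δ z zh Φ τ‖ ≤ 102 * C ^ 7 * (‖z τ - zh τ‖ + δ * ‖Φ τ‖) := by
  have hC := hb.one_le
  have hC0 := hb.pos
  have hr := (EscState.norms_le hz).1
  have hrh := (EscState.norms_le hzh).1
  obtain ⟨d1, d2, d3, d4⟩ := EscState.norms_le (le_refl ‖z τ - zh τ‖)
  simp only [Prod.fst_sub, Prod.snd_sub] at d1 d2 d3 d4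
  have hg := hb.hess.abs_sub_le hC0.le hr hrh
  have hU : ‖gapU g z zh τ‖ ≤ 4 * C * ‖z τ - zh τ‖ := by
    have := Plane.norm_le_of_abs_le (v := gapU g z zh τ) (b := 2 * C * ‖z τ - zh τ‖) fun i => by
      refine (abs_sub _ _).trans ?_
      have h1 : |(z τ).2.2.1 i - (zh τ).2.2.1 i| ≤ ‖z τ - zh τ‖ :=
        (Plane.abs_apply_le ((z τ).2.2.1 - (zh τ).2.2.1) i).trans d3
      have h2 : C * ‖(z τ).1 - (zh τ).1‖ ≤ C * ‖z τ - zh τ‖ := by gcongr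
      have h3 : ‖z τ - zh τ‖ ≤ C * ‖z τ - zh τ‖ := le_mul_of_one_le_left (norm_nonneg _) hC
      linarith
    linarith
  have h1 := PairAt.norm_sub_gapK_le (a := a) (z := z) (zh := zh) (Φ := Φ) (τ := τ) hb hδ
  have h2 := norm_le_insert ((z τ).2.1 - (zh τ).2.1) (gapK c g H J a δ z zh Φ τ)
  have h3 := PairAt.norm_gapW_le_of_gap (δ := δ) (z := z) (zh := zh) (Φ := Φ) (τ := τ) hb ha
  set X := ‖z τ - zh τ‖ + δ * ‖Φ τ‖ with hX
  have hΦ : 0 ≤ δ * ‖Φ τ‖ := by positivity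
  have hD := norm_nonneg (z τ - zh τ)
  have hK : ‖gapK c g H J a δ z zh Φ τ‖ ≤ 25 * C ^ 4 * X := by
    have h4 : δ * (‖gapU g z zh τ‖ + ‖a‖ * ‖(z τ).1 - (zh τ).1‖ + ‖Φ τ‖) ≤ 6 * C * X := by
      have q1 : δ * ‖gapU g z zh τ‖ ≤ 4 * C * X :=
        (mul_le_of_le_one_left (norm_nonneg _) hδ1).trans (hU.trans (by gcongr; linarith))
      have q2 : δ * (‖a‖ * ‖(z τ).1 - (zh τ).1‖) ≤ X := by
        refine (mul_le_of_le_one_left (by positivity) hδ1).trans ?_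
        refine (mul_le_of_le_one_left (by positivity) hA1).trans ?_
        linarith
      have q3 : X ≤ C * X := le_mul_of_one_le_left (by positivity) hC
      linarith
    have h5 : X ≤ C ^ 4 * X := le_mul_of_one_le_left (by positivity) (one_le_pow₀ hC)
    calc _ ≤ X + 4 * C ^ 3 * (6 * C * X) := by
          have : 4 * C ^ 3 * (δ * (‖gapU g z zh τ‖ + ‖a‖ * ‖(z τ).1 - (zh τ).1‖ + ‖Φ τ‖)) ≤
            4 * C ^ 3 * (6 * C * X) := by gcongr
          linarith
      _ = X + 24 * (C ^ 4 * X) := by ring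
      _ ≤ _ := by linarith
  refine ⟨hU, hK, h3.trans ?_⟩
  have q1 : C * ‖(z τ).1 - (zh τ).1‖ ≤ C ^ 7 * X :=
    mul_le_mul (le_self_pow₀ hC (by norm_num)) (by linarith) (norm_nonneg _) (by positivity)
  calc _ ≤ 2 * (C ^ 7 * X) + 4 * C ^ 3 * (25 * C ^ 4 * X) := by
        have : 4 * C ^ 3 * ‖gapK c g H J a δ z zh Φ τ‖ ≤ 4 * C ^ 3 * (25 * C ^ 4 * X) := by gcongr
        linarith
    _ = _ := by ring

/-- The gap of the trajectories is controlled by the transformed gaps. -/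
theorem EscBounds.norm_sub_le_of_gaps (hb : EscBounds c g H J C) (ha : AdmissibleAmplitude c C a)
    (hδ : 0 ≤ δ) (hδ1 : δ ≤ 1) (hA1 : ‖a‖ ≤ 1) (hz : ‖z τ‖ ≤ 1) (hzh : ‖zh τ‖ ≤ 1) :
    ‖z τ - zh τ‖ ≤ 13 * C ^ 5 * (‖gapW c g H J a δ z zh Φ τ‖ + ‖gapK c g H J a δ z zh Φ τ‖ +
      ‖(z τ).2.2.2 - (zh τ).2.2.2‖ + ‖gapU g z zh τ‖ + δ * ‖Φ τ‖) := by
  have hC := hb.one_le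
  have hC0 := hb.pos
  have hr := (EscState.norms_le hz).1
  have hrh := (EscState.norms_le hzh).1
  have hg := hb.hess.abs_sub_le hC0.le hr hrh
  have h1 := PairAt.norm_gap_r_le (δ := δ) (z := z) (zh := zh) (Φ := Φ) (τ := τ) hb ha
  have h2 := PairAt.norm_gap_q_le (a := a) (z := z) (zh := zh) (Φ := Φ) (τ := τ) hb hδ
  have w0 := norm_nonneg (gapW c g H J a δ z zh Φ τ)
  have w1 := norm_nonneg (gapK c g H J a δ z zh Φ τ)
  have w2 := norm_nonneg (gapU g z zh τ)
  have w3 := norm_nonneg ((z τ).2.2.2 - (zh τ).2.2.2)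
  have w4 : 0 ≤ δ * ‖Φ τ‖ := by positivity
  have w5 := norm_nonneg ((z τ).1 - (zh τ).1)
  have hη : ‖(z τ).2.2.1 - (zh τ).2.2.1‖ ≤ 2 * (C * ‖(z τ).1 - (zh τ).1‖ + ‖gapU g z zh τ‖) := by
    refine Plane.norm_le_of_abs_le fun i => ?_
    have h3 : ((z τ).2.2.1 - (zh τ).2.2.1) i = g (z τ).1 - g (zh τ).1 - gapU g z zh τ i := by
      simp only [gapU, PiLp.sub_apply]; ring
    rw [h3]
    refine (abs_sub _ _).trans (add_le_add hg (Plane.abs_apply_le _ i))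
  set W := ‖gapW c g H J a δ z zh Φ τ‖
  set K := ‖gapK c g H J a δ z zh Φ τ‖
  set U := ‖gapU g z zh τ‖
  set M := ‖(z τ).2.2.2 - (zh τ).2.2.2‖
  set E := W + K + M + U + δ * ‖Φ τ‖ with hE
  have hE0 : 0 ≤ E := by positivity
  have hr' : ‖(z τ).1 - (zh τ).1‖ ≤ 2 * C ^ 2 * E := h1.trans (by gcongr; linarith)
  have p0 : E ≤ C ^ 5 * E := le_mul_of_one_le_left hE0 (one_le_pow₀ hC)
  have p2 : C ^ 2 * E ≤ C ^ 5 * E := by gcongr; norm_num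
  have p3 : C ^ 3 * E ≤ C ^ 5 * E := by gcongr; norm_num
  have e2 : ‖(z τ).2.1 - (zh τ).2.1‖ ≤ 13 * C ^ 5 * E := by
    have q1 : δ * (U + ‖a‖ * ‖(z τ).1 - (zh τ).1‖ + ‖Φ τ‖) ≤ E + 2 * C ^ 2 * E := by
      have r1 : δ * U ≤ U := mul_le_of_le_one_left w2 hδ1
      have r2 : δ * (‖a‖ * ‖(z τ).1 - (zh τ).1‖) ≤ ‖(z τ).1 - (zh τ).1‖ :=
        (mul_le_of_le_one_left (by positivity) hδ1).trans (mul_le_of_le_one_left w5 hA1)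
      linarith
    have q2 := mul_le_mul_of_nonneg_left q1 (by positivity : 0 ≤ 4 * C ^ 3)
    have q3 : 4 * C ^ 3 * (E + 2 * C ^ 2 * E) = 4 * (C ^ 3 * E) + 8 * (C ^ 5 * E) := by ring
    linarith
  have e3 : ‖(z τ).2.2.1 - (zh τ).2.2.1‖ ≤ 13 * C ^ 5 * E := by
    have q1 := mul_le_mul_of_nonneg_left hr' hC0.le
    have q2 : C * (2 * C ^ 2 * E) = 2 * (C ^ 3 * E) := by ring
    linarith
  simp only [Prod.norm_def, sup_le_iff, Prod.fst_sub, Prod.snd_sub]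
  exact ⟨by linarith, e2, e3, by linarith⟩

set_option maxHeartbeats 1000000 in
/-- Stability of a single driven trajectory. -/
theorem EscBounds.exists_single_stability (hb : EscBounds c g H J C) {lam B : ℝ} (hlam : 0 < lam)
    (hB : 0 < B) :
    ∃ Q k θ₁ : ℝ, 0 < Q ∧ 0 < k ∧ 0 < θ₁ ∧ θ₁ ≤ C⁻¹ ∧
      ∀ (a : Plane) (δ ω R T : ℝ) (z : ℝ → EscState) (e N : ℝ → ℝ),
        DrivenTrajectory c g lam B a δ ω R T z e N → AdmissibleAmplitude c C a → 0 < δ → 0 < ω →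
        R + ‖a‖ + δ + ω ≤ θ₁ → N 0 ≤ 1 → ∀ τ ∈ Icc 0 T,
          N τ ≤ N 0 * Real.exp (-(lam / ω) * τ) + Q * ω ∧
          ‖(z τ).2.1‖ ≤ Q * (Real.exp (-(k * δ) * τ) + ‖a‖) ∧
          ‖z τ‖ ≤ Q * (‖z 0‖ + N 0 + ‖a‖ + δ + ω) ∧
          ‖(z τ).1‖ ≤ Q * (Real.exp (-(k * δ * ‖a‖) * τ) + (‖a‖ ^ 2 + δ + ω)) := by
  obtain ⟨b, K, Kn, k, Q, θ₁, hb0, hK0, hKn0, hk0, hQ0, hθ0, hθC, hlyap⟩ :=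
    hb.exists_single_lyapunov hlam hB
  have hC := hb.one_le
  have hC0 := hb.pos
  set Q₀ := 4 * B / lam with hQ₀
  -- initial values
  set P := 25 * C ^ 4 * (1 + Q) with hP
  set P' := 102 * C ^ 7 * (1 + Q) with hP'
  set Qi := P' + (b * P + b + K * (4 * C)) + Kn with hQi
  -- bounds for the Lyapunov functions
  set Qv := Qi + 2 * Q / k with hQv
  set Qr := 2 * C ^ 2 * (Qv + Qv / b) with hQr
  set Qq := Qv / b + 4 * C ^ 3 * (Qv / K + 1 + Q) with hQq
  set Qu := 4 * C + 2 * (Q * (Qv / b + Qv / b + Qr + (1 + Q₀) + 1)) / k with hQu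
  set Qz := 13 * C ^ 5 * (Qv + Qv / b + Qv / b + Qu + Q) with hQz
  have hQ₀0 : 0 < Q₀ := by positivity
  have hP0 : 0 < P := by positivity
  have hP'0 : 0 < P' := by positivity
  have hQi0 : 0 < Qi := by positivity
  have hQv0 : 0 < Qv := by positivity
  have hQr0 : 0 < Qr := by positivity
  have hQq0 : 0 < Qq := by positivity
  have hQu0 : 0 < Qu := by positivity
  have hQz0 : 0 < Qz := by positivity
  clear_value Q₀ P P' Qi Qv Qr Qq Qu Qz
  refine ⟨Q₀ + 3 * Qq + 3 * Qr + Qz, k, θ₁, by positivity, hk0, hθ0, hθC, ?_⟩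
  intro a δ ω R T z e N hd ha hδ hω hθ hN01 τ hτ
  have hT : 0 ≤ T := hτ.1.trans hτ.2
  have h0T : (0 : ℝ) ∈ Icc 0 T := ⟨le_rfl, hT⟩
  have hR0 : 0 ≤ R := (norm_nonneg _).trans (hd.norm_le 0 h0T)
  have hA : 0 < ‖a‖ := norm_pos_iff.2 fun h => by simpa [h] using ha.pos 0
  have hθ1 : R + ‖a‖ + δ + ω ≤ 1 := hθ.trans (hθC.trans (inv_le_one_of_one_le₀ hC))
  have hA1 : ‖a‖ ≤ 1 := by linarith
  have hδ1 : δ ≤ 1 := by linarith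
  have hω1 : ω ≤ 1 := by linarith
  obtain ⟨Φ, hΦc, hΦle, hdini⟩ := hlyap a δ ω R T z e N hd ha hδ hω hR0 hθ
  obtain ⟨cU, cK, cW⟩ := hb.continuousOn_gaps (a := a) (δ := δ) hd.continuousOn
    (continuousOn_const (c := (0 : EscState))) hΦc.continuousOn
  have cN := hd.layer_continuousOn
  have cM : ContinuousOn (fun t => ‖(z t).2.2.2 - (0 : EscState).2.2.2‖) (Icc 0 T) :=
    (hd.continuousOn.snd.snd.snd.sub continuousOn_const).norm
  have cF : ContinuousOn (fastGap c g H J a δ b K z (fun _ => 0) Φ) (Icc 0 T) :=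
    ((continuousOn_const.mul cK.norm).add (continuousOn_const.mul cM)).add
      (continuousOn_const.mul cU.norm)
  have hN0 := hd.layer_nonneg 0 h0T
  have hI1 : ‖z 0‖ ≤ 1 := (hd.norm_le 0 h0T).trans (by linarith)
  have hΦA : ∀ t, δ * ‖Φ t‖ ≤ Q * ‖a‖ := fun t => by
    refine (mul_le_of_le_one_left (norm_nonneg _) hδ1).trans ((hΦle t).trans ?_)
    gcongr
    exact pow_le_of_le_one hA.le hA1 two_ne_zero
  -- the boundary layer
  have hNle : ∀ t ∈ Icc 0 T, N t ≤ N 0 * Real.exp (-(lam / ω) * t) + Q₀ * ω := by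
    intro t ht
    have h1 := le_exp_add_of_diniLE (k := lam / ω) (m := 2 * B) cN (by positivity) (by positivity)
      (fun s hs => (hd.layer_dini s hs).mono ?_) t ht
    · have h2 : 2 * (2 * B) / (lam / ω) = Q₀ * ω := by rw [hQ₀]; field_simp; ring
      rwa [h2] at h1
    · have h2 := (EscState.norms_le (hd.norm_le s ⟨hs.1, hs.2.le⟩)).2.1
      have h3 : δ * ‖(z s).2.1‖ ≤ 1 :=
        (mul_le_of_le_one_left (norm_nonneg _) hδ1).trans (by linarith)
      have h4 : B * (‖a‖ + δ * ‖(z s).2.1‖) ≤ B * 2 := by gcongr; linarith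
      linarith
  -- initial values
  set E := ‖z 0‖ + N 0 + ‖a‖ + δ + ω with hE
  have hI0 := norm_nonneg (z 0)
  have hE0 : 0 < E := by positivity
  clear_value E
  obtain ⟨iU, iK, iW⟩ := hb.norm_gaps_le (z := z) (zh := fun _ => 0) (Φ := Φ) (τ := 0) ha
    hδ.le hδ1 hA1 hI1 (by simp)
  have iM : ‖(z 0).2.2.2 - (0 : EscState).2.2.2‖ ≤ E := by
    have := (EscState.norms_le (le_refl ‖z 0‖)).2.2.2
    simp only [Prod.snd_zero, sub_zero]
    linarith
  rw [sub_zero] at iU iK iW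
  have hX : ‖z 0‖ + δ * ‖Φ 0‖ ≤ (1 + Q) * E := by
    have h1 := hΦA 0
    have h2 : Q * ‖a‖ ≤ Q * E := by gcongr; linarith
    linarith
  have iK' : ‖gapK c g H J a δ z (fun _ => 0) Φ 0‖ ≤ P * E := iK.trans (by
    rw [hP, mul_assoc _ (1 + Q)]; gcongr)
  have iW' : ‖gapW c g H J a δ z (fun _ => 0) Φ 0‖ ≤ P' * E := iW.trans (by
    rw [hP', mul_assoc _ (1 + Q)]; gcongr)
  have iU' : ‖gapU g z (fun _ => 0) 0‖ ≤ 4 * C * E := iU.trans (by gcongr; linarith)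
  have iF : fastGap c g H J a δ b K z (fun _ => 0) Φ 0 ≤ (b * P + b + K * (4 * C)) * E := by
    have h1 : b * ‖gapK c g H J a δ z (fun _ => 0) Φ 0‖ ≤ b * (P * E) := by gcongr
    have h2 : b * ‖(z 0).2.2.2 - (0 : EscState).2.2.2‖ ≤ b * E := by gcongr
    have h3 : K * δ * ‖gapU g z (fun _ => 0) 0‖ ≤ K * (4 * C * E) := by
      gcongr
      exact mul_le_of_le_one_right hK0.le hδ1
    unfold fastGap
    linarith
  have iN : Kn * δ * ω * N 0 ≤ Kn * E := by
    rw [mul_assoc, mul_assoc]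
    gcongr
    refine (mul_le_of_le_one_left (by positivity) hδ1).trans ?_
    refine (mul_le_of_le_one_left (by positivity) hω1).trans ?_
    linarith
  set F := fastGap c g H J a δ b K z (fun _ => 0) Φ with hF
  set W := gapW c g H J a δ z (fun _ => 0) Φ with hW
  -- the Lyapunov functions
  have hfast : ∀ t ∈ Icc 0 T, F t + Kn * δ * ω * N t ≤
      Qi * E * Real.exp (-(k * δ) * t) + 2 * Q / k * ‖a‖ := by
    intro t ht
    have h1 := le_exp_add_of_diniLE (f := fun t => F t + Kn * δ * ω * N t) (k := k * δ)
      (m := δ * (Q * ‖a‖)) (cF.add (continuousOn_const.mul cN)) (by positivity) (by positivity)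
      (fun s hs => (hdini s hs).1.mono (le_of_eq (by ring))) t ht
    have h2 : 2 * (δ * (Q * ‖a‖)) / (k * δ) = 2 * Q / k * ‖a‖ := by field_simp
    rw [h2] at h1
    have h3 : F 0 + Kn * δ * ω * N 0 ≤ Qi * E := by
      have : 0 ≤ P' * E := by positivity
      rw [hQi]; linarith
    have h4 := mul_le_mul_of_nonneg_right h3 (Real.exp_pos (-(k * δ) * t)).le
    linarith
  -- The forcing carries the same factor `‖a‖` as the rate, so no negative power of the amplitude
  -- appears.
  have hfull : ∀ t ∈ Icc 0 T, ‖W t‖ + F t + Kn * δ * ω * N t ≤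
      Qi * E * Real.exp (-(k * δ * ‖a‖) * t) + 2 * Q / k * (‖a‖ ^ 2 + δ + ω) := by
    intro t ht
    have h1 := le_exp_add_of_diniLE (f := fun t => ‖W t‖ + F t + Kn * δ * ω * N t)
      (k := k * δ * ‖a‖) (m := δ * (Q * (‖a‖ * (‖a‖ ^ 2 + δ + ω))))
      ((cW.norm.add cF).add (continuousOn_const.mul cN)) (by positivity) (by positivity)
      (fun s hs => (hdini s hs).2.1.mono (le_of_eq (by ring))) t ht
    have h2 : 2 * (δ * (Q * (‖a‖ * (‖a‖ ^ 2 + δ + ω)))) / (k * δ * ‖a‖) =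
        2 * Q / k * (‖a‖ ^ 2 + δ + ω) := by field_simp
    rw [h2] at h1
    have h3 : ‖W 0‖ + F 0 + Kn * δ * ω * N 0 ≤ Qi * E := by
      rw [hQi]; linarith
    have h4 := mul_le_mul_of_nonneg_right h3 (Real.exp_pos (-(k * δ * ‖a‖) * t)).le
    linarith
  -- recovering the components
  have hcomp : ∀ t ∈ Icc 0 T, ∀ v, F t + Kn * δ * ω * N t ≤ v →
      ‖gapK c g H J a δ z (fun _ => 0) Φ t‖ ≤ v / b ∧
        ‖(z t).2.2.2 - (0 : EscState).2.2.2‖ ≤ v / b ∧ δ * ‖gapU g z (fun _ => 0) t‖ ≤ v / K := by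
    intro t ht v hv
    have h1 := norm_nonneg (gapK c g H J a δ z (fun _ => 0) Φ t)
    have h2 := norm_nonneg ((z t).2.2.2 - (0 : EscState).2.2.2)
    have h3 := norm_nonneg (gapU g z (fun _ => 0) t)
    have h4 := hd.layer_nonneg t ht
    have h5 : 0 ≤ Kn * δ * ω * N t := by positivity
    have h6 : F t = b * ‖gapK c g H J a δ z (fun _ => 0) Φ t‖ +
      b * ‖(z t).2.2.2 - (0 : EscState).2.2.2‖ + K * δ * ‖gapU g z (fun _ => 0) t‖ := rfl
    have h7 : 0 ≤ b * ‖gapK c g H J a δ z (fun _ => 0) Φ t‖ := by positivity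
    have h8 : 0 ≤ b * ‖(z t).2.2.2 - (0 : EscState).2.2.2‖ := by positivity
    have h9 : 0 ≤ K * δ * ‖gapU g z (fun _ => 0) t‖ := by positivity
    refine ⟨?_, ?_, ?_⟩ <;> rw [le_div_iff₀' (by assumption)] <;> linarith
  have hfast_nonneg : ∀ t ∈ Icc 0 T, 0 ≤ F t + Kn * δ * ω * N t := by
    intro t ht
    have h4 := hd.layer_nonneg t ht
    rw [hF]
    unfold fastGap
    positivity
  have hrle : ∀ t ∈ Icc 0 T, ∀ v, ‖W t‖ + F t + Kn * δ * ω * N t ≤ v →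
      ‖(z t).1‖ ≤ 2 * C ^ 2 * (v + v / b) := by
    intro t ht v hv
    have h1 := (hcomp t ht v (by linarith [norm_nonneg (W t)])).1
    have h2 := PairAt.norm_gap_r_le (δ := δ) (z := z) (zh := fun _ => 0) (Φ := Φ) (τ := t) hb ha
    simp only [Prod.fst_zero, sub_zero] at h2
    refine h2.trans ?_
    gcongr
    linarith [hfast_nonneg t ht]
  have hE3 : E ≤ 3 := by linarith
  have hexp : ∀ x t : ℝ, 0 ≤ x → 0 ≤ t → Real.exp (-x * t) ≤ 1 := fun x t hx ht =>
    Real.exp_le_one_iff.2 (by nlinarith [mul_nonneg hx ht])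
  have hsplit : ∀ E' x y : ℝ, 0 ≤ E' → 0 ≤ x → 0 ≤ y → Qi * (E' * x) + 2 * Q / k * (E' * y) ≤
      Qv * (E' * (x + y)) := fun E' x y h0 hx hy => by
    have h1 : 0 ≤ Qi * (E' * y) := by positivity
    have h2 : 0 ≤ 2 * Q / k * (E' * x) := by positivity
    rw [hQv]; linarith
  have hsplit3 : ∀ x y : ℝ, 0 ≤ x → 0 ≤ y → Qi * E * x + 2 * Q / k * y ≤ Qv * (3 * (x + y)) :=
    fun x y hx hy => by
    refine le_trans ?_ (hsplit 3 x y (by norm_num) hx hy)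
    have h1 : Qi * E * x ≤ Qi * 3 * x := by gcongr
    have h2 : 0 ≤ 2 * Q / k * y := by positivity
    linarith
  have hq : ∀ t ∈ Icc 0 T, ∀ s, ‖a‖ ≤ s → F t + Kn * δ * ω * N t ≤ Qv * s →
      ‖(z t).2.1‖ ≤ Qq * s := by
    intro t ht s hs hv
    obtain ⟨h1, -, h2⟩ := hcomp t ht _ hv
    have h3 := PairAt.norm_gap_q_le (a := a) (z := z) (zh := fun _ => 0) (Φ := Φ) (τ := t) hb hδ.le
    simp only [Prod.fst_zero, Prod.snd_zero, sub_zero] at h3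
    have h4 : δ * (‖a‖ * ‖(z t).1‖) ≤ s := by
      refine (mul_le_of_le_one_left (by positivity) hδ1).trans ?_
      refine (mul_le_of_le_one_right hA.le ?_).trans hs
      linarith [(EscState.norms_le (hd.norm_le t ht)).1]
    have h5 : δ * ‖Φ t‖ ≤ Q * s := (hΦA t).trans (by gcongr)
    have h6 : δ * (‖gapU g z (fun _ => 0) t‖ + ‖a‖ * ‖(z t).1‖ + ‖Φ t‖) ≤
        Qv * s / K + s + Q * s := by linarith
    calc _ ≤ Qv * s / b + 4 * C ^ 3 * (Qv * s / K + s + Q * s) := by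
          have := mul_le_mul_of_nonneg_left h6 (by positivity : 0 ≤ 4 * C ^ 3)
          linarith
      _ = Qq * s := by rw [hQq]; ring
  refine ⟨?_, ?_, ?_, ?_⟩
  · refine (hNle τ hτ).trans ?_
    gcongr
    linarith
  · have h1 := hq τ hτ (3 * (Real.exp (-(k * δ) * τ) + ‖a‖))
      (by linarith [Real.exp_pos (-(k * δ) * τ)])
      ((hfast τ hτ).trans (hsplit3 _ _ (Real.exp_pos _).le hA.le))
    refine h1.trans ?_
    rw [← mul_assoc]
    gcongr
    linarith
  · have hvE : ∀ t ∈ Icc 0 T, ‖W t‖ + F t + Kn * δ * ω * N t ≤ Qv * E := by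
      intro t ht
      refine (hfull t ht).trans ?_
      have h1 : Qi * E * Real.exp (-(k * δ * ‖a‖) * t) ≤ Qi * E :=
        mul_le_of_le_one_right (by positivity) (hexp _ _ (by positivity) ht.1)
      have h2 : 2 * Q / k * (‖a‖ ^ 2 + δ + ω) ≤ 2 * Q / k * E := by
        gcongr
        have := pow_le_of_le_one hA.le hA1 two_ne_zero
        linarith
      rw [hQv]; linarith
    have hfE : ∀ t ∈ Icc 0 T, F t + Kn * δ * ω * N t ≤ Qv * E := fun t ht => by
      linarith [hvE t ht, norm_nonneg (W t)]
    -- The Lyapunov function controls only `δ * gapU`; a bound without the factor `δ` comes from the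
    -- separate equation of `gapU`, whose forcing is bounded by now.
    have hU : ∀ t ∈ Icc 0 T, ‖gapU g z (fun _ => 0) t‖ ≤ Qu * E := by
      intro t ht
      have h1 := le_exp_add_of_diniLE (f := fun t => ‖gapU g z (fun _ => 0) t‖) (k := k * δ)
        (m := δ * (Q * ((Qv / b + Qv / b + Qr + (1 + Q₀) + 1) * E))) cU.norm (by positivity)
        (by positivity) (fun s hs => (hdini s hs).2.2.mono ?_) t ht
      · have h2 : 2 * (δ * (Q * ((Qv / b + Qv / b + Qr + (1 + Q₀) + 1) * E))) / (k * δ) =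
            2 * (Q * (Qv / b + Qv / b + Qr + (1 + Q₀) + 1)) / k * E := by field_simp
        rw [h2] at h1
        have h3 : ‖gapU g z (fun _ => 0) 0‖ * Real.exp (-(k * δ) * t) ≤ 4 * C * E :=
          (mul_le_of_le_one_right (norm_nonneg _) (hexp _ _ (by positivity) ht.1)).trans iU'
        rw [hQu]; linarith
      · have hs' : s ∈ Icc 0 T := ⟨hs.1, hs.2.le⟩
        obtain ⟨g1, g2, -⟩ := hcomp s hs' _ (hfE s hs')
        have g3 := hrle s hs' _ (hvE s hs')
        have g4 := hNle s hs'
        have g5 : N 0 * Real.exp (-(lam / ω) * s) ≤ N 0 :=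
          mul_le_of_le_one_right hN0 (hexp _ _ (by positivity) hs.1)
        have g6 : Q₀ * ω ≤ Q₀ * E := by gcongr; linarith
        have g7 : 2 * C ^ 2 * (Qv * E + Qv * E / b) = Qr * E := by rw [hQr]; ring
        have g8 : Qv * E / b = Qv / b * E := by ring
        simp only [Prod.snd_zero, sub_zero] at g2
        calc _ = -(k * δ) * ‖gapU g z (fun _ => 0) s‖ +
              δ * (Q * (‖gapK c g H J a δ z (fun _ => 0) Φ s‖ + ‖(z s).2.2.2‖ + ‖(z s).1‖ +
                N s + ‖a‖)) := by ring
          _ ≤ _ := by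
            gcongr
            linarith
    obtain ⟨g1, g2, -⟩ := hcomp τ hτ _ (hfE τ hτ)
    have g3 : ‖gapW c g H J a δ z (fun _ => 0) Φ τ‖ ≤ Qv * E := by
      linarith [hvE τ hτ, hfast_nonneg τ hτ]
    have g4 := hU τ hτ
    have g5 : δ * ‖Φ τ‖ ≤ Q * E := (hΦA τ).trans (by gcongr; linarith)
    have g6 := hb.norm_sub_le_of_gaps (z := z) (zh := fun _ => 0) (Φ := Φ) (τ := τ) ha
      hδ.le hδ1 hA1 ((hd.norm_le τ hτ).trans (by linarith)) (by simp)
    rw [sub_zero] at g6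
    calc _ ≤ _ := g6
      _ ≤ 13 * C ^ 5 * (Qv * E + Qv * E / b + Qv * E / b + Qu * E + Q * E) := by gcongr
      _ = Qz * E := by rw [hQz]; ring
      _ ≤ _ := by gcongr; linarith
  · have h1 := hrle τ hτ _ ((hfull τ hτ).trans
      (hsplit3 _ _ (Real.exp_pos _).le (by positivity)))
    refine h1.trans ?_
    calc _ = 3 * Qr * (Real.exp (-(k * δ * ‖a‖) * τ) + (‖a‖ ^ 2 + δ + ω)) := by rw [hQr]; ring
      _ ≤ _ := by gcongr; linarith

end Pair

/-! ### Closeness of the full and the reduced controller. -/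

/-- A fence for a function driven by a decaying and a small persistent forcing. -/
theorem le_of_diniLE_of_transient {f : ℝ → ℝ} {T k κ Q A δ ω Kp : ℝ}
    (hf : ContinuousOn f (Icc 0 T)) (hk : 0 < k) (hκ : 0 < κ) (hQ : 0 < Q) (hA : 0 < A)
    (hδ : 0 < δ) (hω : 0 < ω) (hδk : Q * δ ≤ k / 2) (hδκ : 6 * (Q * δ) ≤ κ) (hKp : 1 ≤ Kp)
    (hKQ : 4 * Q ≤ k * Kp / 2) (h0 : f 0 ≤ Kp * ω)
    (hd : ∀ t ∈ Ico 0 T, DiniLE f (δ * (-k * (A * f t) +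
      Q * (δ * (Real.exp (-(κ * δ) * t) + A)) * f t +
      Q * ω * (A + δ * Real.exp (-(κ * δ) * t)))) t) :
    ∀ t ∈ Icc 0 T, f t ≤ 2 * Kp * ω := by
  -- The fence rises from `Kp * ω` to `2 * Kp * ω` as the transient dies out, and its slope pays for
  -- the transient terms. The persistent part of the coupling is absorbed by half of the decay `k *
  -- A`.
  have key : ∀ t ∈ Icc 0 T, f t ≤ Kp * ω * (2 - Real.exp (-(κ * δ) * t)) := by
    refine le_of_diniLE_of_strict_supersolution
      (B' := fun t => Kp * ω * -(Real.exp (-(κ * δ) * t) * -(κ * δ))) hf ?_ (fun t => ?_)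
      fun t ht heq => ⟨_, hd t ht, ?_⟩
    · simp only [mul_zero, Real.exp_zero]
      linarith
    · have h1 : HasDerivAt (fun t : ℝ => -(κ * δ) * t) (-(κ * δ)) t := by
        simpa using (hasDerivAt_id t).const_mul (-(κ * δ))
      exact (h1.exp.const_sub 2).const_mul _
    · have hx0 := Real.exp_pos (-(κ * δ) * t)
      have hx1 : Real.exp (-(κ * δ) * t) ≤ 1 :=
        Real.exp_le_one_iff.2 (by nlinarith [mul_nonneg (mul_pos hκ hδ).le ht.1])
      rw [heq]
      generalize Real.exp (-(κ * δ) * t) = x at hx0 hx1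
      set V := Kp * ω * (2 - x) with hV
      have hKω : 0 < Kp * ω := by positivity
      have hV1 : Kp * ω ≤ V := le_mul_of_one_le_right hKω.le (by linarith)
      have hV2 : V ≤ 2 * (Kp * ω) := by rw [hV, mul_comm 2]; gcongr; linarith
      have hV0 : 0 ≤ V := hKω.le.trans hV1
      have e1 : Q * δ * (A * V) ≤ k / 2 * (A * V) := by gcongr
      have e2 : Q * δ * (x * V) ≤ Q * δ * (x * (2 * (Kp * ω))) := by gcongr
      have e3 : k / 2 * (A * (Kp * ω)) ≤ k / 2 * (A * V) := by gcongr
      have e4 : 4 * Q * (A * ω) ≤ k * Kp / 2 * (A * ω) := by gcongr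
      have e5 : Q * ω * (δ * x) ≤ Q * ω * (δ * x) * Kp := le_mul_of_one_le_right (by positivity) hKp
      have e6 : 6 * (Q * δ) * (Kp * ω * x) ≤ κ * (Kp * ω * x) := by gcongr
      have e7 : 0 < Q * (A * ω) := by positivity
      have e8 : 0 < Q * δ * (Kp * ω * x) := by positivity
      calc _ < δ * (κ * (Kp * ω * x)) := by
            refine mul_lt_mul_of_pos_left ?_ hδ
            linarith
        _ = _ := by ring
  intro t ht
  refine (key t ht).trans ?_
  have := Real.exp_pos (-(κ * δ) * t)
  have h1 : Kp * ω * (2 - Real.exp (-(κ * δ) * t)) ≤ Kp * ω * 2 := by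
    gcongr; linarith
  linarith

/-- A fence for a function driven by a boundary layer. -/
theorem le_of_diniLE_of_layer {f : ℝ → ℝ} {T k lam Q δ ω Kp : ℝ}
    (hf : ContinuousOn f (Icc 0 T)) (hk : 0 < k) (hlam : 0 < lam) (hQ : 0 < Q) (hδ : 0 < δ)
    (hδ1 : δ ≤ 1) (hω : 0 < ω) (hKp : 0 < Kp) (hKQ : 2 * Q ≤ k * Kp) (hKl : Q ≤ Kp * lam)
    (h0 : f 0 ≤ 0)
    (hd : ∀ t ∈ Ico 0 T, DiniLE f (δ * (-k * f t + Q * (ω + Real.exp (-(lam / ω) * t)))) t) :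
    ∀ t ∈ Icc 0 T, f t ≤ 2 * Kp * ω := by
  -- The slope of this fence is `Kp * lam * exp (-(lam / ω) * t)`, of order one inside the layer.
  -- This pays for the unit impulse there, although the total rise is only of order `ω`.
  have key : ∀ t ∈ Icc 0 T, f t ≤ Kp * ω * (2 - Real.exp (-(lam / ω) * t)) := by
    refine le_of_diniLE_of_strict_supersolution
      (B' := fun t => Kp * ω * -(Real.exp (-(lam / ω) * t) * -(lam / ω))) hf ?_ (fun t => ?_)
      fun t ht heq => ⟨_, hd t ht, ?_⟩
    · simp only [mul_zero, Real.exp_zero]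
      linarith [mul_pos hKp hω]
    · have h1 : HasDerivAt (fun t : ℝ => -(lam / ω) * t) (-(lam / ω)) t := by
        simpa using (hasDerivAt_id t).const_mul (-(lam / ω))
      exact (h1.exp.const_sub 2).const_mul _
    · have hx0 := Real.exp_pos (-(lam / ω) * t)
      have hx1 : Real.exp (-(lam / ω) * t) ≤ 1 :=
        Real.exp_le_one_iff.2 (by nlinarith [mul_nonneg (div_pos hlam hω).le ht.1])
      rw [heq]
      generalize Real.exp (-(lam / ω) * t) = x at hx0 hx1
      have hKω : 0 < Kp * ω := by positivity
      have e1 : k * (Kp * ω) ≤ k * (Kp * ω * (2 - x)) :=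
        mul_le_mul_of_nonneg_left (le_mul_of_one_le_right hKω.le (by linarith)) hk.le
      have e2 : 2 * Q * ω ≤ k * Kp * ω := by gcongr
      have e3 : δ * (Q * x) ≤ 1 * (Kp * lam * x) := by gcongr
      have e4 : 0 < δ * (Q * ω) := by positivity
      have e5 : Kp * ω * -(x * -(lam / ω)) = Kp * lam * x := by field_simp
      rw [e5]
      have e6 : δ * (-k * (Kp * ω * (2 - x)) + Q * ω) ≤ δ * (-(Q * ω)) := by gcongr; linarith
      linarith
  intro t ht
  refine (key t ht).trans ?_
  have := Real.exp_pos (-(lam / ω) * t)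
  have h1 : Kp * ω * (2 - Real.exp (-(lam / ω) * t)) ≤ Kp * ω * 2 := by
    gcongr; linarith
  linarith

section Pair

variable {c : EscConstants} {g : Plane → ℝ} {H : Plane →L[ℝ] Plane →L[ℝ] ℝ}
  {J : Fin 2 → Fin 2 → ℝ → ℝ} {C : ℝ}

/-- A driven and an undriven trajectory form a pair without oscillating forcing. -/
theorem DrivenTrajectory.exists_pairAt {lam B : ℝ} {a : Plane} {δ ω R T : ℝ}
    {z zr : ℝ → EscState} {e N : ℝ → ℝ} (hd : DrivenTrajectory c g lam B a δ ω R T z e N)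
    (hr : DrivenTrajectory c g lam B a δ ω R T zr (fun _ => 0) (fun _ => 0))
    (hδ1 : δ ≤ 1) {τ : ℝ} (hτ : τ ∈ Ico 0 T) :
    ∃ ε, PairAt c g a δ R z zr (e τ) 0 (fun _ => 0) ε τ ∧
      pairForcing δ (e τ) 0 (fun _ => 0) ε τ ≤ 3 * B * N τ := by
  have hτ' : τ ∈ Icc 0 T := ⟨hτ.1, hτ.2.le⟩
  have he := hd.error_le τ hτ'
  -- The perturbation acts alike on both trajectories, so the error gap is only the layer error `e`.
  -- It is put entirely into `ε`, with `Φ = 0`.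
  refine ⟨WithLp.toLp 2 fun i => e τ * Real.sin (c.freq i * τ),
    ⟨hd.hasDeriv τ hτ, hr.hasDeriv τ hτ, fun i => ?_, hd.norm_le τ hτ', hr.norm_le τ hτ'⟩, ?_⟩
  · simpa using hasDerivWithinAt_const τ (Ici τ) (0 : ℝ)
  · have h1 := Plane.norm_le_of_abs_le (v := WithLp.toLp 2 fun i => e τ * Real.sin (c.freq i * τ))
      fun i => abs_mul_le_of_le he (Real.abs_sin_le_one _)
    have h2 : δ * |e τ| ≤ |e τ| := mul_le_of_le_one_left (abs_nonneg _) hδ1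
    simp only [pairForcing, norm_zero, mul_zero, add_zero, sub_zero]
    linarith

/-- Dissipation along the gap of a driven and an undriven trajectory. -/
theorem EscBounds.exists_gap_lyapunov (hb : EscBounds c g H J C) {lam B : ℝ} (hlam : 0 < lam)
    (hB : 0 < B) :
    ∃ b K Kn k Q θ₁ : ℝ, 0 < b ∧ 0 < K ∧ 0 < Kn ∧ 0 < k ∧ 0 < Q ∧ 0 < θ₁ ∧ θ₁ ≤ C⁻¹ ∧
      ∀ (a : Plane) (δ ω R T : ℝ) (z zr : ℝ → EscState) (e N : ℝ → ℝ),
        DrivenTrajectory c g lam B a δ ω R T z e N →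
        DrivenTrajectory c g lam B a δ ω R T zr (fun _ => 0) (fun _ => 0) →
        AdmissibleAmplitude c C a → 0 < δ → 0 < ω → R + ‖a‖ + δ + ω ≤ θ₁ → ∀ τ ∈ Ico 0 T,
          DiniLE (fun t => ‖gapW c g H J a δ z zr (fun _ => 0) t‖ +
              fastGap c g H J a δ b K z zr (fun _ => 0) t + Kn * δ * ω * N t)
            (δ * (-k * (‖a‖ * (‖gapW c g H J a δ z zr (fun _ => 0) τ‖ +
              fastGap c g H J a δ b K z zr (fun _ => 0) τ + Kn * δ * ω * N τ)) +
              Q * (δ * ‖(zr τ).2.1‖) * (‖gapW c g H J a δ z zr (fun _ => 0) τ‖ +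
              fastGap c g H J a δ b K z zr (fun _ => 0) τ + Kn * δ * ω * N τ) +
              Q * ω * (‖a‖ + δ * ‖(z τ).2.1‖))) τ := by
  obtain ⟨b, K, k₀, θ₀, D, hb0, hK0, hk0, hθ0, hD0, hθC, hlyap⟩ := hb.exists_lyapunov
  have hC := hb.one_le
  have hC0 := hb.pos
  set Kn := (3 * D * B + 1) / lam with hKn
  have hKn0 : 0 < Kn := by positivity
  have hKne : Kn * lam = 3 * D * B + 1 := by rw [hKn]; field_simp
  set S := 1 + b + K + Kn with hS
  have hS1 : 0 < S := by positivity
  set m := min k₀ 1 with hm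
  have hm0 : 0 < m := by positivity
  have hm1 : m ≤ k₀ := min_le_left _ _
  have hm2 : m ≤ 1 := min_le_right _ _
  refine ⟨b, K, Kn, m / S, D * (2 * C ^ 2 * (1 + b⁻¹)) + Kn * B, θ₀, hb0, hK0, hKn0,
    by positivity, by positivity, hθ0, hθC, ?_⟩
  intro a δ ω R T z zr e N hd hr ha hδ hω hθ τ hτ
  have hτ' : τ ∈ Icc 0 T := ⟨hτ.1, hτ.2.le⟩
  have hR0 : 0 ≤ R := (norm_nonneg _).trans (hd.norm_le τ hτ')
  have hA0 := norm_nonneg a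
  have hθ1 : R + ‖a‖ + δ + ω ≤ 1 := hθ.trans (hθC.trans (inv_le_one_of_one_le₀ hC))
  have hA1 : ‖a‖ ≤ 1 := by linarith
  have hδ1 : δ ≤ 1 := by linarith
  have hω1 : ω ≤ 1 := by linarith
  obtain ⟨ε, hP, hF⟩ := hd.exists_pairAt hr hδ1 hτ
  have dall := (hlyap a δ R z zr (e τ) 0 (fun _ => 0) ε τ hP ha hδ.le (by linarith)).2
  have dN := (hd.layer_dini τ hτ).const_mul (by positivity : 0 ≤ Kn * δ * ω)
  have hN0 := hd.layer_nonneg τ hτ'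
  have hr := PairAt.norm_gap_r_le (δ := δ) (z := z) (zh := zr) (Φ := fun _ => 0) (τ := τ) hb ha
  have d := dall.add dN
  simp only [fastGap]
  refine d.mono ?_
  clear d dall dN hlyap
  have hs0 := norm_nonneg (gapW c g H J a δ z zr (fun _ => 0) τ)
  have hk0' := norm_nonneg (gapK c g H J a δ z zr (fun _ => 0) τ)
  have hu0 := norm_nonneg (gapU g z zr τ)
  have hm0' := norm_nonneg ((z τ).2.2.2 - (zr τ).2.2.2)
  have hq0 := norm_nonneg (z τ).2.1
  have hqr0 := norm_nonneg (zr τ).2.1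
  generalize ‖gapW c g H J a δ z zr (fun _ => 0) τ‖ = s at *
  generalize ‖gapK c g H J a δ z zr (fun _ => 0) τ‖ = nk at *
  generalize ‖gapU g z zr τ‖ = nu at *
  generalize ‖(z τ).2.2.2 - (zr τ).2.2.2‖ = nm at *
  generalize ‖(z τ).1 - (zr τ).1‖ = nr at *
  generalize ‖(z τ).2.1‖ = q at *
  generalize ‖(zr τ).2.1‖ = qr at *
  generalize pairForcing δ (e τ) 0 (fun _ => 0) ε τ = F at *
  generalize N τ = n at *
  generalize ‖a‖ = A at *
  set V := s + (b * nk + b * nm + K * δ * nu) + Kn * δ * ω * n with hV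
  have hV0 : 0 ≤ V := by positivity
  have hun : 0 ≤ δ * nu := by positivity
  have h1 : m / S * (A * V) ≤ k₀ * (A * s + nk + nm + δ * nu) + n := by
    have h2 : A * V ≤ S * (A * s + nk + nm + δ * nu + n) := by
      have e1 : A * (b * nk) ≤ b * nk := mul_le_of_le_one_left (by positivity) hA1
      have e2 : A * (b * nm) ≤ b * nm := mul_le_of_le_one_left (by positivity) hA1
      have e3 : A * (K * δ * nu) ≤ K * δ * nu := mul_le_of_le_one_left (by positivity) hA1
      have e4 : A * (Kn * δ * ω * n) ≤ Kn * δ * ω * n := mul_le_of_le_one_left (by positivity) hA1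
      have e5 : Kn * δ * ω * n ≤ Kn * n := by
        rw [mul_assoc Kn]
        gcongr
        exact mul_le_of_le_one_right hKn0.le (mul_le_one₀ hδ1 hω.le hω1)
      have f1 : 1 * (A * s) ≤ S * (A * s) := by gcongr; linarith
      have f3 : b * nk ≤ S * nk := by gcongr; linarith
      have f4 : b * nm ≤ S * nm := by gcongr; linarith
      have f5 : K * (δ * nu) ≤ S * (δ * nu) := by gcongr; linarith
      have f6 : Kn * n ≤ S * n := by gcongr; linarith
      rw [hV]
      linarith
    have h3 : m / S * (A * V) ≤ m / S * (S * (A * s + nk + nm + δ * nu + n)) := by gcongr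
    have h4 : m / S * (S * (A * s + nk + nm + δ * nu + n)) =
        m * (A * s + nk + nm + δ * nu) + m * n := by field_simp
    have h5 : m * (A * s + nk + nm + δ * nu) ≤ k₀ * (A * s + nk + nm + δ * nu) := by gcongr
    have h6 : m * n ≤ 1 * n := by gcongr
    linarith
  -- Bounding the reference gap by the whole Lyapunov function is enough, because it enters only
  -- multiplied by `δ * qr`.
  have hnr : nr ≤ 2 * C ^ 2 * (1 + b⁻¹) * V := by
    refine hr.trans ?_
    rw [mul_assoc (2 * C ^ 2)]
    gcongr
    have h2 : b * nk ≤ V := by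
      rw [hV]
      have : 0 ≤ s + b * nm + K * δ * nu + Kn * δ * ω * n := by positivity
      linarith
    have h3 : s ≤ V := by
      rw [hV]
      have : 0 ≤ b * nk + b * nm + K * δ * nu + Kn * δ * ω * n := by positivity
      linarith
    have h4 : nk ≤ b⁻¹ * V := by rw [inv_mul_eq_div, le_div_iff₀' hb0]; exact h2
    linarith
  have h2 : D * (δ * (qr * nr)) ≤ D * (δ * (qr * (2 * C ^ 2 * (1 + b⁻¹) * V))) := by gcongr
  have h3 : D * F ≤ D * (3 * B * n) := by gcongr
  have h4 : Kn * ω * (-(lam / ω) * n) = -(3 * D * B + 1) * n := by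
    rw [← hKne]; field_simp
  have h5 : 0 ≤ Kn * B * (δ * qr) * V := by positivity
  have h6 : 0 ≤ D * (2 * C ^ 2 * (1 + b⁻¹)) * (ω * (A + δ * q)) := by positivity
  calc _ = δ * (-k₀ * (A * s + nk + nm + δ * nu) + D * (δ * (qr * nr)) + D * F +
        (Kn * ω * (-(lam / ω) * n) + Kn * B * (ω * (A + δ * q)))) := by ring
    _ ≤ _ := by
      refine mul_le_mul_of_nonneg_left ?_ hδ.le
      rw [h4]
      linarith

end Pair

section Pair

variable {c : EscConstants} {g : Plane → ℝ} {H : Plane →L[ℝ] Plane →L[ℝ] ℝ}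
  {J : Fin 2 → Fin 2 → ℝ → ℝ} {C : ℝ}

set_option maxHeartbeats 1000000 in
/-- Uniform closeness of a driven and an undriven trajectory. -/
theorem EscBounds.exists_closeness (hb : EscBounds c g H J C) {lam B : ℝ} (hlam : 0 < lam)
    (hB : 0 < B) :
    ∃ Q θ₁ : ℝ, 0 < Q ∧ 0 < θ₁ ∧
      ∀ (a : Plane) (δ ω R T : ℝ) (z zr : ℝ → EscState) (e N : ℝ → ℝ),
        DrivenTrajectory c g lam B a δ ω R T z e N →
        DrivenTrajectory c g lam B a δ ω R T zr (fun _ => 0) (fun _ => 0) →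
        AdmissibleAmplitude c C a → 0 < δ → 0 < ω → R + ‖a‖ + δ + ω ≤ θ₁ → N 0 ≤ 1 →
        z 0 = zr 0 → ∀ τ ∈ Icc 0 T, ‖z τ - zr τ‖ ≤ Q * ω := by
  obtain ⟨b, K, Kn, k, Q, θ₁, hb0, hK0, hKn0, hk0, hQ0, hθ10, hθ1C, hlyap⟩ :=
    hb.exists_gap_lyapunov hlam hB
  obtain ⟨Qs, κ, θ₂, hQs0, hκ0, hθ20, -, hstab⟩ := hb.exists_single_stability hlam hB
  have hC := hb.one_le
  have hC0 := hb.pos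
  set Q₂ := Q * (1 + 2 * Qs) with hQ₂
  have hQ₂0 : 0 < Q₂ := by positivity
  -- `Kn` dominates the initial layer term `Kn * δ * ω * N 0`; the last summand dominates the
  -- persistent forcing relative to the decay `k`.
  set Kp := 1 + Kn + 8 * Q₂ / k with hKp
  have hKp0 : 0 < Kp := by positivity
  have hKp1 : 1 ≤ Kp := by
    have : 0 < 8 * Q₂ / k := by positivity
    linarith
  have hKpQ : 4 * Q₂ ≤ k * Kp / 2 := by
    have h1 : k * (8 * Q₂ / k) = 8 * Q₂ := by field_simp
    have h2 : 0 ≤ k * (1 + Kn) := by positivity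
    rw [hKp]
    linarith
  set Qr := 2 * C ^ 2 * (2 * Kp + 2 * Kp / b) with hQr
  set Q₃ := 40 * C ^ 5 * (2 * Kp / b + 2 * Kp / b + Qr + Qr + B * (1 + Qs)) with hQ₃
  have hQr0 : 0 < Qr := by positivity
  have hQ₃0 : 0 < Q₃ := by positivity
  set Ku := 4 * C * Q₃ + Q₃ / lam with hKu
  have hKu0 : 0 < Ku := by positivity
  have hKuQ : 2 * Q₃ ≤ C⁻¹ / 2 * Ku := by
    have h1 : C⁻¹ / 2 * (4 * C * Q₃) = 2 * Q₃ := by field_simp; norm_num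
    have h2 : 0 ≤ C⁻¹ / 2 * (Q₃ / lam) := by positivity
    rw [hKu]; linarith
  have hKul : Q₃ ≤ Ku * lam := by
    have h1 : Q₃ / lam * lam = Q₃ := by field_simp
    have h2 : 0 ≤ 4 * C * Q₃ * lam := by positivity
    rw [hKu]; linarith
  refine ⟨13 * C ^ 5 * (2 * Kp + 2 * Kp / b + 2 * Kp / b + 2 * Ku),
    min θ₁ (min θ₂ (min (k / 2 / Q₂) (min (κ / (6 * Q₂)) (C⁻¹ / 2 / (40 * C ^ 5))))),
    by positivity, by positivity, ?_⟩
  intro a δ ω R T z zr e N hd hr ha hδ hω hθ hN01 hz0 τ hτ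
  have hT : 0 ≤ T := hτ.1.trans hτ.2
  have h0T : (0 : ℝ) ∈ Icc 0 T := ⟨le_rfl, hT⟩
  have hR0 : 0 ≤ R := (norm_nonneg _).trans (hd.norm_le 0 h0T)
  have hA : 0 < ‖a‖ := norm_pos_iff.2 fun h => by simpa [h] using ha.pos 0
  have t1 : R + ‖a‖ + δ + ω ≤ θ₁ := hθ.trans (min_le_left _ _)
  have t2 := hθ.trans (min_le_right _ _)
  have t3 : R + ‖a‖ + δ + ω ≤ θ₂ := t2.trans (min_le_left _ _)
  have t4 := t2.trans (min_le_right _ _)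
  have t5 : R + ‖a‖ + δ + ω ≤ k / 2 / Q₂ := t4.trans (min_le_left _ _)
  have t6 := t4.trans (min_le_right _ _)
  have t7 : R + ‖a‖ + δ + ω ≤ κ / (6 * Q₂) := t6.trans (min_le_left _ _)
  have t8 : R + ‖a‖ + δ + ω ≤ C⁻¹ / 2 / (40 * C ^ 5) := t6.trans (min_le_right _ _)
  have hθ1 : R + ‖a‖ + δ + ω ≤ 1 := t1.trans (hθ1C.trans (inv_le_one_of_one_le₀ hC))
  have hA1 : ‖a‖ ≤ 1 := by linarith
  have hδ1 : δ ≤ 1 := by linarith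
  have hω1 : ω ≤ 1 := by linarith
  have s1 : Q₂ * δ ≤ k / 2 := by
    have : δ ≤ k / 2 / Q₂ := by linarith
    rwa [le_div_iff₀ hQ₂0, mul_comm] at this
  have s2 : 6 * (Q₂ * δ) ≤ κ := by
    have : δ ≤ κ / (6 * Q₂) := by linarith
    rw [le_div_iff₀ (by positivity)] at this
    linarith
  have s3 : 40 * C ^ 5 * δ ≤ C⁻¹ / 2 := by
    have h1 : δ ≤ C⁻¹ / 2 / (40 * C ^ 5) := by linarith
    rwa [le_div_iff₀ (by positivity), mul_comm] at h1
  obtain ⟨cU, cK, cW⟩ := hb.continuousOn_gaps (a := a) (δ := δ) hd.continuousOn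
    hr.continuousOn (continuousOn_const (c := (0 : Plane)))
  have cN := hd.layer_continuousOn
  have cM : ContinuousOn (fun t => ‖(z t).2.2.2 - (zr t).2.2.2‖) (Icc 0 T) :=
    (hd.continuousOn.snd.snd.snd.sub hr.continuousOn.snd.snd.snd).norm
  have cF : ContinuousOn (fastGap c g H J a δ b K z zr (fun _ => 0)) (Icc 0 T) :=
    ((continuousOn_const.mul cK.norm).add (continuousOn_const.mul cM)).add
      (continuousOn_const.mul cU.norm)
  have hN0 := hd.layer_nonneg 0 h0T
  have hle1 : ∀ t ∈ Icc 0 T, ‖z t‖ ≤ 1 := fun t ht => (hd.norm_le t ht).trans (by linarith)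
  have hrle1 : ∀ t ∈ Icc 0 T, ‖zr t‖ ≤ 1 := fun t ht => (hr.norm_le t ht).trans (by linarith)
  have hqz := fun t ht => (hstab a δ ω R T z e N hd ha hδ hω t3 hN01 t ht).2.1
  have hqr := fun t ht =>
    (hstab a δ ω R T zr _ _ hr ha hδ hω t3 zero_le_one t ht).2.1
  have hNle := fun t ht => (hstab a δ ω R T z e N hd ha hδ hω t3 hN01 t ht).1
  obtain ⟨iU, iK, iW⟩ := hb.norm_gaps_le (z := z) (zh := zr) (Φ := fun _ => 0) (τ := 0) ha
    hδ.le hδ1 hA1 (hle1 0 h0T) (hrle1 0 h0T)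
  rw [hz0, sub_self, norm_zero] at iU iK iW
  simp only [norm_zero, mul_zero, add_zero] at iU iK iW
  set F := fastGap c g H J a δ b K z zr (fun _ => 0) with hF
  set W := gapW c g H J a δ z zr (fun _ => 0) with hW
  have hFe : ∀ t, F t = b * ‖gapK c g H J a δ z zr (fun _ => 0) t‖ +
      b * ‖(z t).2.2.2 - (zr t).2.2.2‖ + K * δ * ‖gapU g z zr t‖ := fun t => rfl
  have hF0 : ∀ t, 0 ≤ F t := fun t => by rw [hFe]; positivity
  -- Both trajectories start at the same point, so all gaps vanish initially and only the layer term
  -- contributes, with order `ω`. Inserting the decay of the two gradient estimates brings the Dini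
  -- inequality into the form of `le_of_diniLE_of_transient`.
  have hVle : ∀ t ∈ Icc 0 T, ‖W t‖ + F t + Kn * δ * ω * N t ≤ 2 * Kp * ω := by
    refine le_of_diniLE_of_transient ((cW.norm.add cF).add (continuousOn_const.mul cN)) hk0 hκ0
      hQ₂0 hA hδ hω s1 s2 hKp1 hKpQ ?_ fun t ht => (hlyap a δ ω R T z zr e N hd hr ha hδ hω
        t1 t ht).mono ?_
    · have h1 : F 0 ≤ 0 := by
        rw [hFe, hz0, sub_self, norm_zero, iU.antisymm (norm_nonneg _),
          iK.antisymm (norm_nonneg _)]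
        simp
      have h2 : Kn * δ * ω * N 0 ≤ Kn * 1 * ω * 1 := by gcongr
      have h3 : Kn * ω ≤ Kp * ω := by
        gcongr
        have : 0 < 8 * Q₂ / k := by positivity
        linarith
      linarith
    · have ht' : t ∈ Icc 0 T := ⟨ht.1, ht.2.le⟩
      have q1 := hqz t ht'
      have q2 := hqr t ht'
      have hx := Real.exp_pos (-(κ * δ) * t)
      have hNt := hd.layer_nonneg t ht'
      have hV0 : 0 ≤ ‖W t‖ + F t + Kn * δ * ω * N t := by
        have := hF0 t
        positivity
      set V := ‖W t‖ + F t + Kn * δ * ω * N t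
      set x := Real.exp (-(κ * δ) * t)
      refine mul_le_mul_of_nonneg_left ?_ hδ.le
      have p1 : Q * (δ * ‖(zr t).2.1‖) * V ≤ Q * (δ * (Qs * (x + ‖a‖))) * V := by gcongr
      have p2 : Q * ω * (‖a‖ + δ * ‖(z t).2.1‖) ≤ Q * ω * (‖a‖ + δ * (Qs * (x + ‖a‖))) := by gcongr
      have p3 : Q * Qs * (δ * (x + ‖a‖)) * V ≤ Q₂ * (δ * (x + ‖a‖)) * V := by
        gcongr
        rw [hQ₂]
        gcongr
        linarith
      have p4 : Q * ω * (‖a‖ + δ * (Qs * (x + ‖a‖))) ≤ Q₂ * ω * (‖a‖ + δ * x) := by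
        have r1 : δ * ‖a‖ ≤ ‖a‖ := mul_le_of_le_one_left hA.le hδ1
        have r2 : Q * ω * Qs * (δ * ‖a‖) ≤ Q * ω * Qs * ‖a‖ := by gcongr
        have r3 : 0 ≤ Q * ω * Qs * (δ * x) := by positivity
        have r4 : 0 ≤ Q * ω * Qs * ‖a‖ := by positivity
        have r5 : 0 ≤ Q * ω * (δ * x) := by positivity
        rw [hQ₂]
        linarith
      linarith
  have hcomp : ∀ t ∈ Icc 0 T, ‖W t‖ ≤ 2 * Kp * ω ∧
      ‖gapK c g H J a δ z zr (fun _ => 0) t‖ ≤ 2 * Kp / b * ω ∧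
      ‖(z t).2.2.2 - (zr t).2.2.2‖ ≤ 2 * Kp / b * ω ∧ ‖(z t).1 - (zr t).1‖ ≤ Qr * ω := by
    intro t ht
    have h1 := hVle t ht
    rw [hFe] at h1
    have h4 := hd.layer_nonneg t ht
    have h5 : 0 ≤ Kn * δ * ω * N t := by positivity
    have h6 : 0 ≤ b * ‖gapK c g H J a δ z zr (fun _ => 0) t‖ := by positivity
    have h7 : 0 ≤ b * ‖(z t).2.2.2 - (zr t).2.2.2‖ := by positivity
    have h8 : 0 ≤ K * δ * ‖gapU g z zr t‖ := by positivity
    have h9 := norm_nonneg (W t)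
    have g1 : ‖W t‖ ≤ 2 * Kp * ω := by linarith
    have g2 : ‖gapK c g H J a δ z zr (fun _ => 0) t‖ ≤ 2 * Kp / b * ω := by
      rw [div_mul_eq_mul_div, le_div_iff₀' hb0]; linarith
    have g3 : ‖(z t).2.2.2 - (zr t).2.2.2‖ ≤ 2 * Kp / b * ω := by
      rw [div_mul_eq_mul_div, le_div_iff₀' hb0]; linarith
    refine ⟨g1, g2, g3, ?_⟩
    refine (PairAt.norm_gap_r_le (δ := δ) (z := z) (zh := zr) (Φ := fun _ => 0) (τ := t) hb
      ha).trans ?_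
    calc _ ≤ 2 * C ^ 2 * (2 * Kp * ω + 2 * Kp / b * ω) := by gcongr
      _ = Qr * ω := by rw [hQr]; ring
  -- Again `gapU` has to be bounded on its own. Its forcing contains the layer error without a
  -- factor `δ`, of order one at the start but lasting only for a time of order `ω`.
  have hUle : ∀ t ∈ Icc 0 T, ‖gapU g z zr t‖ ≤ 2 * Ku * ω := by
    refine le_of_diniLE_of_layer (k := C⁻¹ / 2) cU.norm (by positivity) hlam hQ₃0 hδ hδ1 hω hKu0
      hKuQ hKul iU fun t ht => ?_
    have ht' : t ∈ Icc 0 T := ⟨ht.1, ht.2.le⟩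
    obtain ⟨ε, hP, -⟩ := hd.exists_pairAt hr hδ1 ht
    refine (hP.diniLE_gapU hb hδ.le (by linarith)).mono ?_
    refine mul_le_mul_of_nonneg_left ?_ hδ.le
    obtain ⟨-, g2, g3, g4⟩ := hcomp t ht'
    have g5 := hd.error_le t ht'
    have g6 := hNle t ht'
    have g7 := (EscState.norms_le (hrle1 t ht')).2.1
    have hx := Real.exp_pos (-(lam / ω) * t)
    simp only [norm_zero, mul_zero, add_zero, sub_zero]
    have hu0 := norm_nonneg (gapU g z zr t)
    set nu := ‖gapU g z zr t‖
    set x := Real.exp (-(lam / ω) * t)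
    have hθ3 : R + ‖a‖ + δ ≤ 1 := by linarith
    have e1 : (R + ‖a‖ + δ) * (‖gapK c g H J a δ z zr (fun _ => 0) t‖ +
        ‖(z t).2.2.2 - (zr t).2.2.2‖) ≤ 2 * Kp / b * ω + 2 * Kp / b * ω :=
      (mul_le_of_le_one_left (by positivity) hθ3).trans (add_le_add g2 g3)
    have e2 : ‖(zr t).2.1‖ * ‖(z t).1 - (zr t).1‖ ≤ Qr * ω :=
      (mul_le_of_le_one_left (norm_nonneg _) g7).trans g4
    have e3 : ‖a‖ * ‖(z t).1 - (zr t).1‖ ≤ Qr * ω :=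
      (mul_le_of_le_one_left (norm_nonneg _) hA1).trans g4
    have e4 : |e t| ≤ B * (x + Qs * ω) := by
      refine g5.trans ?_
      gcongr
      have : N 0 * x ≤ 1 * x := by gcongr
      linarith
    have e5 : (R + ‖a‖ + δ) * (δ * nu) ≤ δ * nu := mul_le_of_le_one_left (by positivity) hθ3
    have e6 : 40 * C ^ 5 * δ * nu ≤ C⁻¹ / 2 * nu := by gcongr
    have e7 : (R + ‖a‖ + δ) * (‖gapK c g H J a δ z zr (fun _ => 0) t‖ +
        ‖(z t).2.2.2 - (zr t).2.2.2‖) + ‖(zr t).2.1‖ * ‖(z t).1 - (zr t).1‖ +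
        ‖a‖ * ‖(z t).1 - (zr t).1‖ + |e t| ≤
        (2 * Kp / b + 2 * Kp / b + Qr + Qr + B * (1 + Qs)) * (ω + x) := by
      have r1 : 0 ≤ (2 * Kp / b + 2 * Kp / b + Qr + Qr + B * Qs) * x := by positivity
      have r2 : 0 ≤ B * ω := by positivity
      linarith
    have e8 := mul_le_mul_of_nonneg_left e7 (by positivity : 0 ≤ 40 * C ^ 5)
    have e9 := mul_le_mul_of_nonneg_left e5 (by positivity : 0 ≤ 40 * C ^ 5)
    rw [← mul_assoc, ← hQ₃] at e8
    linarith
  have g6 := hb.norm_sub_le_of_gaps (z := z) (zh := zr) (Φ := fun _ => 0) (τ := τ) ha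
    hδ.le hδ1 hA1 (hle1 τ hτ) (hrle1 τ hτ)
  obtain ⟨g1, g2, g3, -⟩ := hcomp τ hτ
  have g4 := hUle τ hτ
  simp only [norm_zero, mul_zero, add_zero] at g6
  calc _ ≤ _ := g6
    _ ≤ 13 * C ^ 5 * (2 * Kp * ω + 2 * Kp / b * ω + 2 * Kp / b * ω + 2 * Ku * ω) := by gcongr
    _ = _ := by ring

end Pair

/-! ### One constant for all data of the controller. -/

theorem HessianBounds.mono {E : Type*} [NormedAddCommGroup E] [NormedSpace ℝ E] {g : E → ℝ}
    {H : E →L[ℝ] E →L[ℝ] ℝ} {C D : ℝ} (h : HessianBounds g H C) (hCD : C ≤ D) :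
    HessianBounds g H D where
  zero := h.zero
  differentiable := h.differentiable
  fderiv_zero := h.fderiv_zero
  fderiv_lip s s' hs hs' := (h.fderiv_lip s s' hs hs').trans (by gcongr)
  shift s s' p R hs hs' hR hp := (h.shift s s' p R hs hs' hR hp).trans (by
    have : 0 ≤ R := (norm_nonneg _).trans hs
    gcongr)
  taylor p hp := (h.taylor p hp).trans (by gcongr)
  norm_le := h.norm_le.trans hCD

theorem eventually_inv_le {x : ℝ} (hx : 0 < x) : ∀ᶠ C : ℝ in atTop, C⁻¹ ≤ x :=
  tendsto_inv_atTop_zero.eventually_le_const hx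

/-- A positive definite form is coercive. -/
theorem exists_coercive {E : Type*} [NormedAddCommGroup E] [NormedSpace ℝ E]
    [FiniteDimensional ℝ E] (H : E →L[ℝ] E →L[ℝ] ℝ) (hH : ∀ v, v ≠ 0 → 0 < H v v) :
    ∃ m, 0 < m ∧ ∀ v, m * ‖v‖ ^ 2 ≤ H v v := by
  rcases subsingleton_or_nontrivial E with hE | hE
  · exact ⟨1, one_pos, fun v => by simp [Subsingleton.elim v 0]⟩
  have hne : (Metric.sphere (0 : E) 1).Nonempty := NormedSpace.sphere_nonempty.2 zero_le_one
  obtain ⟨w, hw, hmin⟩ := (isCompact_sphere (0 : E) 1).exists_isMinOn hne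
    (f := fun v => H v v) (by fun_prop)
  have hw1 : ‖w‖ = 1 := by simpa using hw
  refine ⟨H w w, hH w (norm_pos_iff.1 (by rw [hw1]; exact one_pos)), fun v => ?_⟩
  rcases eq_or_ne v 0 with rfl | hv
  · simp
  have hv0 : 0 < ‖v‖ := norm_pos_iff.2 hv
  have h1 : H w w ≤ H (‖v‖⁻¹ • v) (‖v‖⁻¹ • v) :=
    hmin (by simp [norm_smul, hv0.ne'])
  simp only [map_smul, smul_apply, smul_eq_mul] at h1
  calc _ ≤ ‖v‖⁻¹ * (‖v‖⁻¹ * H v v) * ‖v‖ ^ 2 := by gcongr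
    _ = H v v := by field_simp

/-- The normalization by the second moment is Lipschitz. -/
theorem EscConstants.eventually_normalization (c : EscConstants) (i : Fin 2) :
    ∀ᶠ C : ℝ in atTop, ∀ R q q' m m', R ≤ C⁻¹ → |m| ≤ R → |m'| ≤ R →
      |c.gain i * q / Real.sqrt (m + c.ε) - c.gain i * q' / Real.sqrt (m' + c.ε)
        - c.linGain i * (q - q')| ≤ C * (R * |q - q'| + |q'| * |m - m'|) := by
  have hε := c.ε_pos
  set φ : ℝ → ℝ := fun m => c.gain i / Real.sqrt (m + c.ε) with hφ
  have hdiff : ContDiffOn ℝ 1 φ (Ioi (-c.ε)) := by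
    intro m hm
    have hm' : 0 < m + c.ε := by linarith [mem_Ioi.1 hm]
    have h1 : ContDiffAt ℝ 1 (fun m => Real.sqrt (m + c.ε)) m :=
      (Real.contDiffAt_sqrt hm'.ne').comp m (contDiffAt_id.add contDiffAt_const)
    exact (contDiffAt_const.div h1 (Real.sqrt_pos.2 hm').ne').contDiffWithinAt
  obtain ⟨L, hL⟩ := hdiff.exists_lipschitzOnWith_of_isCompact_of_convex isOpen_Ioi
    (fun m hm => mem_Ioi.2 (by linarith [hm.1]) : Icc (-(c.ε / 2)) (c.ε / 2) ⊆ _) isCompact_Icc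
    (convex_Icc _ _)
  filter_upwards [eventually_inv_le (half_pos hε), eventually_ge_atTop (L : ℝ)] with C hCε hCL
  intro R q q' m m' hR hm hm'
  have hmem : ∀ x, |x| ≤ R → x ∈ Icc (-(c.ε / 2)) (c.ε / 2) := fun x hx =>
    abs_le.1 (hx.trans (hR.trans hCε))
  have hR0 : 0 ≤ R := (abs_nonneg _).trans hm
  have hC0 : 0 ≤ C := L.coe_nonneg.trans hCL
  have h1 := hL.dist_le_mul m (hmem m hm) 0 (hmem 0 (by simpa using hR0))
  have h2 := hL.dist_le_mul m (hmem m hm) m' (hmem m' hm')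
  rw [Real.dist_eq, Real.dist_eq] at h1 h2
  rw [sub_zero] at h1
  have hφ0 : φ 0 = c.linGain i := by simp [hφ, EscConstants.linGain]
  -- The normalization is frozen at `m = 0` for the gap of the gradient estimates, and its variation
  -- between `m` and `m'` is charged to `q'`.
  have h3 : c.gain i * q / Real.sqrt (m + c.ε) - c.gain i * q' / Real.sqrt (m' + c.ε)
      - c.linGain i * (q - q') = (φ m - φ 0) * (q - q') + (φ m - φ m') * q' := by
    rw [← hφ0]; simp only [hφ]; ring
  rw [h3]
  refine (abs_add_le _ _).trans ?_
  rw [abs_mul, abs_mul]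
  have h4 : |φ m - φ 0| ≤ C * R := h1.trans (by gcongr)
  have h5 : |φ m - φ m'| ≤ C * |m - m'| := h2.trans (by gcongr)
  calc _ ≤ C * R * |q - q'| + C * |m - m'| * |q'| := by gcongr
    _ = _ := by ring

theorem EscConstants.exists_primitive (c : EscConstants) (hfreq : c.freq 0 ≠ c.freq 1) :
    ∃ J : Fin 2 → Fin 2 → ℝ → ℝ, (∀ i j τ, HasDerivAt (J i j)
      (Real.sin (c.freq j * τ) * Real.sin (c.freq i * τ) - if i = j then 1 / 2 else 0) τ) ∧
      ∀ᶠ C : ℝ in atTop, ∀ i j τ, |J i j τ| ≤ C := by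
  have key : ∀ i j, HasBoundedPrimitive fun τ => Real.sin (c.freq j * τ) *
      Real.sin (c.freq i * τ) - if i = j then 1 / 2 else 0 := by
    intro i j
    by_cases hij : i = j
    · subst hij
      simpa using HasBoundedPrimitive.sin_mul_sin_self (c.freq_pos i).ne'
    · have hne : c.freq j ≠ c.freq i := by
        fin_cases i <;> fin_cases j <;> first | exact absurd rfl hij | exact hfreq | exact hfreq.symm
      simpa [hij] using HasBoundedPrimitive.sin_mul_sin (c.freq_pos j) (c.freq_pos i) hne
  choose J D hJ hD using key
  refine ⟨J, hJ, ?_⟩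
  refine eventually_all.2 fun i => eventually_all.2 fun j => ?_
  filter_upwards [eventually_ge_atTop (D i j)] with C hC τ
  exact (hD i j τ).trans hC

/-- Amplitudes of bounded ratio are admissible. -/
theorem EscConstants.eventually_admissibleAmplitude (c : EscConstants) (κ : ℝ) :
    ∀ᶠ C : ℝ in atTop, ∀ a : Plane, 0 < a 0 → 0 < a 1 → a 0 ≤ κ * a 1 → a 1 ≤ κ * a 0 →
      AdmissibleAmplitude c C a := by
  have h1 : ∀ᶠ C : ℝ in atTop, ∀ i, Real.sqrt ((1 + κ) / c.linGain i) ≤ C :=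
    eventually_all.2 fun i => eventually_ge_atTop _
  have h2 : ∀ᶠ C : ℝ in atTop, ∀ i, C⁻¹ ≤ Real.sqrt (1 / c.linGain i) :=
    eventually_all.2 fun i => eventually_inv_le
      (Real.sqrt_pos.2 (one_div_pos.2 (EscBounds.linGain_pos c i)))
  filter_upwards [h1, h2] with C hC1 hC2 a ha0 ha1 h01 h10
  have hpos : ∀ i, 0 < a i := fun i => by fin_cases i <;> assumption
  -- The bounded ratio makes both amplitudes comparable to `‖a‖`, so the weights lie between
  -- positive constants independent of `a`.
  have hle : ∀ i, ‖a‖ ≤ (1 + κ) * a i := by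
    have h3 : ‖a‖ ≤ a 0 + a 1 := by
      rw [EuclideanSpace.norm_eq, Fin.sum_univ_two]
      refine Real.sqrt_le_iff.2 ⟨by positivity, ?_⟩
      simp only [Real.norm_eq_abs, sq_abs]
      nlinarith [mul_pos ha0 ha1]
    intro i
    fin_cases i
    · change ‖a‖ ≤ (1 + κ) * a 0
      linarith
    · change ‖a‖ ≤ (1 + κ) * a 1
      linarith
  refine ⟨hpos, fun i => le_trans (Real.sqrt_le_sqrt ?_) (hC1 i),
    fun i => (hC2 i).trans (Real.sqrt_le_sqrt ?_)⟩
  · have hK := EscBounds.linGain_pos c i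
    have := hpos i
    rw [div_le_div_iff₀ (by positivity) hK]
    have := mul_le_mul_of_nonneg_left (hle i) hK.le
    linarith
  · have hK := EscBounds.linGain_pos c i
    have := hpos i
    rw [div_le_div_iff₀ hK (by positivity)]
    have := mul_le_mul_of_nonneg_left ((le_abs_self _).trans (Plane.abs_apply_le a i)) hK.le
    linarith

/-- Every bound, including the admissibility of the amplitudes, holds for all large `C`. Since these
are finitely many eventual statements along `atTop`, one constant serves all of them. -/
theorem exists_escBounds (c : EscConstants) (hfreq : c.freq 0 ≠ c.freq 1) {g : Plane → ℝ}
    (hg : ContDiff ℝ 3 g) (h0 : g 0 = 0) (h1 : fderiv ℝ g 0 = 0)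
    (hpos : ∀ v, v ≠ 0 → 0 < fderiv ℝ (fderiv ℝ g) 0 v v) (κ : ℝ) :
    ∃ J C, EscBounds c g (fderiv ℝ (fderiv ℝ g) 0) J C ∧
      ∀ a : Plane, 0 < a 0 → 0 < a 1 → a 0 ≤ κ * a 1 → a 1 ≤ κ * a 0 →
        AdmissibleAmplitude c C a := by
  obtain ⟨J, hJ, hJC⟩ := c.exists_primitive hfreq
  obtain ⟨C₀, -, hC₀⟩ := exists_hessianBounds hg h0 h1
  obtain ⟨m, hm, hco⟩ := exists_coercive _ hpos
  have hle : ∀ f : Fin 2 → ℝ, ∀ᶠ C : ℝ in atTop, ∀ i, f i ≤ C := fun f =>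
    eventually_all.2 fun i => eventually_ge_atTop _
  have hge : ∀ f : Fin 2 → ℝ, (∀ i, 0 < f i) → ∀ᶠ C : ℝ in atTop, ∀ i, C⁻¹ ≤ f i := fun f hf =>
    eventually_all.2 fun i => eventually_inv_le (hf i)
  have hev : ∀ᶠ C : ℝ in atTop, EscBounds c g (fderiv ℝ (fderiv ℝ g) 0) J C := by
    filter_upwards [eventually_ge_atTop 1, eventually_ge_atTop C₀, eventually_inv_le hm,
      hle c.lowpass, hle c.highpass, hle c.momentRate, hle c.linGain, hle c.freq,
      hge c.lowpass c.lowpass_pos, hge c.highpass c.highpass_pos,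
      hge c.momentRate c.momentRate_pos, hle fun i => (c.freq i)⁻¹, hle fun i => (c.lowpass i)⁻¹,
      eventually_all.2 c.eventually_normalization, hJC]
      with C e1 e2 e3 e4 e5 e6 e7 e8 e9 e10 e11 e12 e13 e14 e15
    exact ⟨e1, hC₀.mono e2, fun v => (mul_le_mul_of_nonneg_right e3 (sq_nonneg _)).trans (hco v),
      e4, e5, e6, e7, e8, e9, e10, e11, e12, e13, e14, hJ, e15⟩
  obtain ⟨C, hC⟩ := (hev.and (c.eventually_admissibleAmplitude κ)).exists
  exact ⟨J, C, hC⟩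

/-! ### The boundary layer of the plant. -/

/-- Local bounds for the plant `F`, with equilibria `l` and cost `h`: the size of the boundary
layer `x - l s` is measured by `N`. -/
structure PlantBounds (F : Plane → Plane → Plane) (h : Plane → ℝ) (l : Plane → Plane)
    (rstar : Plane) (N : Plane → ℝ) (lam B r : ℝ) : Prop where
  continuous : Continuous N
  norm_le : ∀ y, ‖y‖ ≤ N y
  le_norm : ∀ y, N y ≤ B * ‖y‖
  cost_le : ∀ x s, ‖x - l rstar‖ ≤ r → ‖s - rstar‖ ≤ r → |h x - h (l s)| ≤ B * N (x - l s)
  equilibrium_le : ∀ s, ‖s - rstar‖ ≤ r → ‖l s - l rstar‖ ≤ B * ‖s - rstar‖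
  dini : ∀ (x s : ℝ → Plane) (s' : Plane) (ω τ : ℝ), 0 < ω →
    HasDerivWithinAt x (ω⁻¹ • F (x τ) (s τ)) (Ici τ) τ → HasDerivWithinAt s s' (Ici τ) τ →
    ‖x τ - l rstar‖ ≤ r → ‖s τ - rstar‖ ≤ r →
    DiniLE (fun t => N (x t - l (s t))) (-(lam / ω) * N (x τ - l (s τ)) + B * ‖s'‖) τ

/-- Near a reference, the plant is close to its linearization, uniformly in the reference. -/
theorem exists_linearization_le {E G : Type*} [NormedAddCommGroup E] [NormedSpace ℝ E]
    [NormedAddCommGroup G] [NormedSpace ℝ G] {F : E → G → E}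
    (hF : ContDiff ℝ 1 (fun p : E × G => F p.1 p.2)) {l : G → E} (hl : Continuous l)
    (heq : ∀ s, F (l s) s = 0) (s₀ : G) {ν : ℝ} (hν : 0 < ν) :
    ∃ r, 0 < r ∧ ∀ x s, ‖x - l s₀‖ ≤ r → ‖s - s₀‖ ≤ r →
      ‖F x s - fderiv ℝ (fun x => F x s₀) (l s₀) (x - l s)‖ ≤ ν * ‖x - l s‖ := by
  set P : E × G → E := fun p => F p.1 p.2 with hP
  set ι := ContinuousLinearMap.inl ℝ E G with hι
  have hder : ∀ x s, HasFDerivAt (fun x => F x s) ((fderiv ℝ P (x, s)).comp ι) x := fun x s => by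
    have h1 := (hF.differentiable (by norm_num) (x, s)).hasFDerivAt
    have h2 : HasFDerivAt (fun x : E => (x, s)) ι x := hasFDerivAt_prodMk_left x s
    exact HasFDerivAt.comp (f := fun x : E => (x, s)) (g := P) x h1 h2
  have hcont : Continuous fun p : E × G => (fderiv ℝ P p).comp ι :=
    (hF.continuous_fderiv (by norm_num)).clm_comp continuous_const
  obtain ⟨r, hr, hball⟩ := Metric.continuousAt_iff.1 (hcont.continuousAt (x := (l s₀, s₀))) ν hν
  obtain ⟨r', hr', hball'⟩ := Metric.continuousAt_iff.1 (hl.continuousAt (x := s₀)) r hr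
  refine ⟨min (r / 2) (r' / 2), by positivity, fun x s hx hs => ?_⟩
  have hx1 : dist x (l s₀) < r := by
    rw [dist_eq_norm]; exact (hx.trans (min_le_left _ _)).trans_lt (by linarith)
  have hs1 : dist s s₀ < r := by
    rw [dist_eq_norm]; exact (hs.trans (min_le_left _ _)).trans_lt (by linarith)
  have hs2 : dist s s₀ < r' := by
    rw [dist_eq_norm]; exact (hs.trans (min_le_right _ _)).trans_lt (by linarith)
  have hfd : fderiv ℝ (fun x => F x s₀) (l s₀) = (fderiv ℝ P (l s₀, s₀)).comp ι :=
    (hder _ _).fderiv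
  -- Mean value inequality on the segment from `l s` to `x`, at fixed `s`. As `F (l s) s = 0`, the
  -- increment of `F` is its value at `x`, so the error is proportional to the distance from the
  -- moving equilibrium.
  have key := (convex_ball (l s₀) r).norm_image_sub_le_of_norm_hasFDerivWithin_le'
    (f := fun x => F x s) (f' := fun x => (fderiv ℝ P (x, s)).comp ι)
    (φ := (fderiv ℝ P (l s₀, s₀)).comp ι) (C := ν) (x := l s) (y := x)
    (fun y _ => (hder y s).hasFDerivWithinAt) (fun y hy => ?_) (hball' hs2) hx1
  · rw [heq, sub_zero] at key
    rw [hfd]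
    exact key
  · have h2 : dist (y, s) (l s₀, s₀) < r := by
      rw [Prod.dist_eq]; exact max_lt hy hs1
    have := hball h2
    rw [dist_eq_norm] at this
    exact this.le

/-- The linearization at `rstar` inherits the exponential decay, and the norm adapted to it is used
at all nearby references. The moving equilibrium enters only through the velocity of `l ∘ s`, which
is bounded by the velocity of the reference. -/
theorem exists_plantBounds {F : Plane → Plane → Plane} {h : Plane → ℝ} {l : Plane → Plane}
    (rstar : Plane) (hF : ContDiff ℝ 1 (fun p : Plane × Plane => F p.1 p.2))
    (hh : ContDiff ℝ 1 h) (hl : ContDiff ℝ 1 l) (heq : ∀ s, F (l s) s = 0)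
    (hstab : LocallyExpStableUniformly F l) :
    ∃ N lam B r, 0 < lam ∧ 0 < B ∧ 0 < r ∧ PlantBounds F h l rstar N lam B r := by
  obtain ⟨M, rate, radius, hM, hrate, hradius, hst⟩ := hstab
  have hF0 : ContDiff ℝ 1 (fun x => F x rstar) := hF.comp (contDiff_prodMk_left rstar)
  set A := fderiv ℝ (fun x => F x rstar) (l rstar) with hA
  obtain ⟨N, hN1, hN2, hadd, hdecay⟩ := exists_adapted_norm (A := A) (M := M) (rate := rate)
    fun y t ht => norm_exp_smul_fderiv_le_of_exp_stable hF0 (heq rstar) hM hrate hradius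
      (hst rstar) y ht
  -- With this tolerance the linearization error, measured in `N`, uses up half of the rate; this is
  -- why `lam` is `rate / 2`.
  obtain ⟨r, hr, hlin⟩ := exists_linearization_le hF hl.continuous heq rstar
    (by positivity : 0 < rate / (2 * M))
  obtain ⟨Ll, hLl⟩ := hl.contDiffOn.exists_lipschitzOnWith_of_isCompact_of_convex isOpen_univ
    (subset_univ _) (isCompact_closedBall rstar r) (convex_closedBall _ _)
  obtain ⟨D, hD⟩ := (isCompact_closedBall rstar r).exists_bound_of_continuousOn
    (hl.continuous_fderiv (by norm_num)).continuousOn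
  obtain ⟨Lh, hLh⟩ := hh.contDiffOn.exists_lipschitzOnWith_of_isCompact_of_convex isOpen_univ
    (subset_univ _) (isCompact_closedBall (l rstar) (r + Ll * r)) (convex_closedBall _ _)
  have hD0 : 0 ≤ D := (norm_nonneg _).trans (hD rstar (by simp [hr.le]))
  have hLl0 : (0 : ℝ) ≤ Ll := Ll.coe_nonneg
  have hLh0 : (0 : ℝ) ≤ Lh := Lh.coe_nonneg
  have hl' : ∀ s, ‖s - rstar‖ ≤ r → ‖l s - l rstar‖ ≤ Ll * ‖s - rstar‖ := fun s hs => by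
    have := hLl.dist_le_mul s (mem_closedBall_iff_norm.2 hs) rstar (by simp [hr.le])
    rwa [dist_eq_norm, dist_eq_norm] at this
  have hMD : 0 ≤ M * D := by positivity
  refine ⟨N, rate / 2, M + Ll + Lh + M * D, r, by positivity, by positivity, hr, ?_, hN1,
    fun y => (hN2 y).trans ?_, fun x s hx hs => ?_, fun s hs => (hl' s hs).trans ?_, ?_⟩
  · have : LipschitzWith M.toNNReal N := LipschitzWith.of_le_add_mul _ fun x y => by
      have h1 := hadd y (x - y)
      rw [add_sub_cancel] at h1
      have h2 := hN2 (x - y)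
      rw [Real.coe_toNNReal M hM.le, dist_eq_norm]
      linarith
    exact this.continuous
  · gcongr; linarith
  · have hs' : ‖l s - l rstar‖ ≤ r + Ll * r := by
      have h1 := hl' s hs
      have h2 : Ll * ‖s - rstar‖ ≤ Ll * r := by gcongr
      linarith
    have hx' : ‖x - l rstar‖ ≤ r + Ll * r := by
      have : 0 ≤ Ll * r := by positivity
      linarith
    have h1 := hLh.dist_le_mul x (mem_closedBall_iff_norm.2 hx') (l s)
      (mem_closedBall_iff_norm.2 hs')
    rw [Real.dist_eq, dist_eq_norm] at h1
    have h2 := hN1 (x - l s)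
    have h3 := norm_nonneg (x - l s)
    calc _ ≤ Lh * ‖x - l s‖ := h1
      _ ≤ _ := by
        gcongr
        linarith
  · gcongr; linarith
  · intro x s s' ω τ hω hx hs hxr hsr
    have hls : HasDerivWithinAt (fun t => l (s t)) (fderiv ℝ l (s τ) s') (Ici τ) τ :=
      (hl.differentiable (by norm_num) (s τ)).hasFDerivAt.comp_hasDerivWithinAt τ hs
    set y := x τ - l (s τ) with hy
    set b := ω⁻¹ • (F (x τ) (s τ) - A y) - fderiv ℝ l (s τ) s' with hb
    have hd : HasDerivWithinAt (fun t => x t - l (s t)) (ω⁻¹ • A (x τ - l (s τ)) + b) (Ici τ) τ :=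
      (hx.sub hls).congr_deriv (by rw [hb, ← hy, smul_sub]; abel)
    refine (DiniLE.of_adapted_norm hM.le hN2 hadd hdecay (by positivity) hd).mono ?_
    rw [← hy]
    have h1 : ‖b‖ ≤ ω⁻¹ * (rate / (2 * M) * N y) + D * ‖s'‖ := by
      refine (norm_sub_le _ _).trans (add_le_add ?_ ?_)
      · rw [norm_smul, Real.norm_of_nonneg (by positivity)]
        gcongr
        exact (hlin _ _ hxr hsr).trans (by gcongr; exact hN1 y)
      · exact ((fderiv ℝ l (s τ)).le_opNorm s').trans (by
          gcongr; exact hD _ (mem_closedBall_iff_norm.2 hsr))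
    have h2 : M * ‖b‖ ≤ M * (ω⁻¹ * (rate / (2 * M) * N y) + D * ‖s'‖) := by gcongr
    have h3 : M * (ω⁻¹ * (rate / (2 * M) * N y) + D * ‖s'‖) =
        rate / 2 / ω * N y + M * D * ‖s'‖ := by field_simp
    have h4 : -rate * ω⁻¹ * N y = -(rate / 2 / ω) * N y - rate / 2 / ω * N y := by
      field_simp; ring
    have h5 : 0 ≤ (M + Ll + Lh) * ‖s'‖ := by positivity
    linarith

theorem hasDerivAt_perturbation (c : EscConstants) (a : Plane) (τ : ℝ) :
    HasDerivAt (perturbation c a)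
      (WithLp.toLp 2 fun i => a i * (c.freq i * Real.cos (c.freq i * τ))) τ := by
  rw [← hasDerivWithinAt_univ, hasDerivWithinAt_iff_hasFDerivWithinAt,
    hasFDerivWithinAt_euclidean]
  intro i
  have h1 : HasDerivAt (fun t => a i * Real.sin (c.freq i * t))
      (a i * (c.freq i * Real.cos (c.freq i * τ))) τ := by
    have := (((hasDerivAt_id τ).const_mul (c.freq i)).sin).const_mul (a i)
    refine this.congr_deriv ?_
    simp only [id, mul_one]; ring
  exact (h1.hasFDerivAt.congr_fderiv (by ext; simp)).hasFDerivWithinAt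

/-- The controller of the full system is a driven trajectory. -/
theorem PlantBounds.drivenTrajectory {F : Plane → Plane → Plane} {h : Plane → ℝ}
    {l : Plane → Plane} {rstar : Plane} {Nm : Plane → ℝ} {lam B r : ℝ}
    (hp : PlantBounds F h l rstar Nm lam B r) (hl : Continuous l) (hB : 0 < B) {c : EscConstants}
    {g : Plane → ℝ} {H : Plane →L[ℝ] Plane →L[ℝ] ℝ} {J : Fin 2 → Fin 2 → ℝ → ℝ} {C : ℝ}
    (hb : EscBounds c g H J C) (hg : ∀ s, g s = h (l (rstar + s)) - h (l rstar))
    {a : Plane} {δ ω R T : ℝ} (hω : 0 < ω) (hδ : 0 ≤ δ) (hRr : R + ‖a‖ ≤ r) (hRC : R ≤ C⁻¹)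
    {x : ℝ → Plane} {z : ℝ → EscState} (hx : ContinuousOn x (Icc 0 T))
    (hz : ContinuousOn z (Icc 0 T))
    (hdx : ∀ τ ∈ Ico 0 T, HasDerivWithinAt x
      (ω⁻¹ • F (x τ) (rstar + (z τ).1 + perturbation c a τ)) (Ici τ) τ)
    (hdz : ∀ τ ∈ Ico 0 T, HasDerivWithinAt z
      (δ • escField c τ (h (x τ) - h (l rstar)) (z τ)) (Ici τ) τ)
    (hxR : ∀ τ ∈ Icc 0 T, ‖x τ - l rstar‖ ≤ R) (hzR : ∀ τ ∈ Icc 0 T, ‖z τ‖ ≤ R) :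
    DrivenTrajectory c g lam (4 * C * B) a δ ω R T z
      (fun τ => h (x τ) - h (l (rstar + (z τ).1 + perturbation c a τ)))
      (fun τ => Nm (x τ - l (rstar + (z τ).1 + perturbation c a τ))) := by
  have hC := hb.one_le
  have hA0 := norm_nonneg a
  have hBC : B ≤ 4 * C * B := le_mul_of_one_le_left hB.le (by linarith)
  have hpc : Continuous (perturbation c a) :=
    continuous_iff_continuousAt.2 fun t => (hasDerivAt_perturbation c a t).continuousAt
  have hNm0 : ∀ y, 0 ≤ Nm y := fun y => (norm_nonneg y).trans (hp.norm_le y)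
  have hsr : ∀ τ ∈ Icc 0 T, ‖rstar + (z τ).1 + perturbation c a τ - rstar‖ ≤ r := fun τ hτ => by
    have h1 : rstar + (z τ).1 + perturbation c a τ - rstar = (z τ).1 + perturbation c a τ := by
      abel
    rw [h1]
    refine (norm_add_le _ _).trans (le_trans ?_ hRr)
    exact add_le_add (EscState.norms_le (hzR τ hτ)).1 (norm_perturbation_le c a τ)
  have hxr : ∀ τ ∈ Icc 0 T, ‖x τ - l rstar‖ ≤ r := fun τ hτ => (hxR τ hτ).trans (by linarith)
  refine ⟨hz, fun τ hτ => ?_, hzR, ?_, fun τ _ => hNm0 _, fun τ hτ => ?_, fun τ hτ => ?_⟩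
  · refine (hdz τ hτ).congr_deriv ?_
    rw [hg, ← add_assoc]
    congr 2
    ring
  · refine hp.continuous.comp_continuousOn (hx.sub (hl.comp_continuousOn ?_))
    exact (continuousOn_const.add hz.fst).add hpc.continuousOn
  · exact (hp.cost_le _ _ (hxr τ hτ) (hsr τ hτ)).trans (by gcongr; exact hNm0 _)
  · have hτ' : τ ∈ Icc 0 T := ⟨hτ.1, hτ.2.le⟩
    -- The reference seen by the plant moves with the perturbation, at speed of order `‖a‖`, and
    -- with the integrators, at speed of order `δ * ‖q‖`. Bounding both by `4 * C` turns the plant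
    -- constant `B` into `4 * C * B`.
    have hds := ((hasDerivWithinAt_escState_fst (hdz τ hτ)).const_add rstar).add
      (hasDerivAt_perturbation c a τ).hasDerivWithinAt
    refine (hp.dini x _ _ ω τ hω (hdx τ hτ) hds (hxr τ hτ') (hsr τ hτ')).mono ?_
    have h1 := hb.norm_fst_le (τ := τ) hRC (z τ) (hzR τ hτ') (h (x τ) - h (l rstar))
    have h2 : ‖(WithLp.toLp 2 fun i => a i * (c.freq i * Real.cos (c.freq i * τ)) : Plane)‖ ≤
        2 * (‖a‖ * C) := Plane.norm_le_of_abs_le fun i => by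
      simp only [abs_mul]
      have e1 := Plane.abs_apply_le a i
      have e2 : |c.freq i| ≤ C := by rw [abs_of_pos (c.freq_pos i)]; exact hb.freq_le i
      have e3 := Real.abs_cos_le_one (c.freq i * τ)
      calc _ ≤ ‖a‖ * (C * 1) := by gcongr
        _ = _ := by ring
    have h3 : ‖δ • (escField c τ (h (x τ) - h (l rstar)) (z τ)).1 +
        (WithLp.toLp 2 fun i => a i * (c.freq i * Real.cos (c.freq i * τ)) : Plane)‖ ≤
        4 * C * (‖a‖ + δ * ‖(z τ).2.1‖) := by
      refine (norm_add_le _ _).trans ?_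
      rw [norm_smul, Real.norm_of_nonneg hδ]
      have e1 := mul_le_mul_of_nonneg_left h1 hδ
      have e2 : 0 ≤ ‖a‖ * C := by positivity
      linarith
    have h4 := mul_le_mul_of_nonneg_left h3 hB.le
    refine add_le_add_right (h4.trans (le_of_eq ?_)) _
    ring

theorem perturbation_zero (c : EscConstants) (a : Plane) : perturbation c a 0 = 0 := by
  ext i; simp [perturbation]

theorem contDiff_perturbation (c : EscConstants) (a : Plane) : ContDiff ℝ 1 (perturbation c a) := by
  rw [contDiff_euclidean]
  intro i
  simp only [perturbation]
  fun_prop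

theorem contDiffAt_escField (c : EscConstants) {E : Type*} [NormedAddCommGroup E]
    [NormedSpace ℝ E] {τ w : E → ℝ} {z : E → EscState} {p : E} (hτ : ContDiffAt ℝ 1 τ p)
    (hw : ContDiffAt ℝ 1 w p) (hz : ContDiffAt ℝ 1 z p) (hm : ∀ i, 0 < (z p).2.2.2 i + c.ε) :
    ContDiffAt ℝ 1 (fun y => escField c (τ y) (w y) (z y)) p := by
  have happ : ∀ {v : E → Plane}, ContDiffAt ℝ 1 v p → ∀ i, ContDiffAt ℝ 1 (fun y => v y i) p :=
    fun hv i => contDiffAt_euclidean.1 hv i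
  have hq : ContDiffAt ℝ 1 (fun y => (z y).2.1) p := hz.snd.fst
  have hη : ContDiffAt ℝ 1 (fun y => (z y).2.2.1) p := hz.snd.snd.fst
  have hmm : ContDiffAt ℝ 1 (fun y => (z y).2.2.2) p := hz.snd.snd.snd
  refine ContDiffAt.prodMk ?_ (ContDiffAt.prodMk ?_ (ContDiffAt.prodMk ?_ ?_)) <;>
    rw [contDiffAt_euclidean] <;> intro i <;> simp only
  · have h1 : ContDiffAt ℝ 1 (fun y => Real.sqrt ((z y).2.2.2 i + c.ε)) p :=
      ((happ hmm i).add contDiffAt_const).sqrt (hm i).ne'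
    exact (contDiffAt_const.mul (happ hq i)).div h1 (Real.sqrt_pos.2 (hm i)).ne'
  · exact ((contDiffAt_const.mul (hw.sub (happ hη i))).mul (contDiffAt_const.mul hτ).sin).sub
      (contDiffAt_const.mul (happ hq i))
  · exact (contDiffAt_const.mul (happ hη i)).add (contDiffAt_const.mul hw)
  · exact contDiffAt_const.mul ((happ hmm i).neg.add ((happ hq i).pow 2))

theorem EscConstants.moment_pos (c : EscConstants) {z : EscState} (hz : ‖z‖ < c.ε) (i : Fin 2) :
    0 < z.2.2.2 i + c.ε := by
  have h1 := (Plane.abs_apply_le z.2.2.2 i).trans (EscState.norms_le le_rfl).2.2.2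
  linarith [neg_abs_le (z.2.2.2 i)]

/-- The controller of the reduced system is an undriven trajectory. -/
theorem drivenTrajectory_reduced {h : Plane → ℝ} {l : Plane → Plane} {rstar : Plane}
    {c : EscConstants} {g : Plane → ℝ} (hg : ∀ s, g s = h (l (rstar + s)) - h (l rstar))
    {lam B : ℝ} (hB : 0 ≤ B) {a : Plane} {δ ω R T : ℝ} (hδ : 0 ≤ δ) {z : ℝ → EscState}
    (hz : ContinuousOn z (Icc 0 T))
    (hdz : ∀ τ ∈ Ico 0 T, HasDerivWithinAt z
      (δ • escField c τ (h (l (rstar + (z τ).1 + perturbation c a τ)) - h (l rstar)) (z τ))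
      (Ici τ) τ) (hzR : ∀ τ ∈ Icc 0 T, ‖z τ‖ ≤ R) :
    DrivenTrajectory c g lam B a δ ω R T z (fun _ => 0) (fun _ => 0) where
  continuousOn := hz
  hasDeriv τ hτ := by
    refine (hdz τ hτ).congr_deriv ?_
    rw [hg, add_zero, ← add_assoc]
  norm_le := hzR
  layer_continuousOn := continuousOn_const
  layer_nonneg _ _ := le_rfl
  error_le _ _ := by simp
  layer_dini τ _ := by
    refine ((hasDerivWithinAt_const τ (Ici τ) (0 : ℝ)).diniLE).mono ?_
    have := norm_nonneg a
    simp only [mul_zero, zero_add]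
    positivity

/-! ### Trapping near the optimum and smoothness of the closed-loop fields. -/

section Trapping

variable {F : Plane → Plane → Plane} {h : Plane → ℝ} {l : Plane → Plane} {rstar : Plane}
  {Nm : Plane → ℝ} {lam B r : ℝ} {c : EscConstants} {g : Plane → ℝ}
  {H : Plane →L[ℝ] Plane →L[ℝ] ℝ} {J : Fin 2 → Fin 2 → ℝ → ℝ} {C : ℝ}

/-- Trajectories of the full system that start near the optimum stay there. -/
theorem PlantBounds.exists_trapping (hp : PlantBounds F h l rstar Nm lam B r) (hl : Continuous l)
    (hlam : 0 < lam) (hB : 0 < B) (hb : EscBounds c g H J C)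
    (hg : ∀ s, g s = h (l (rstar + s)) - h (l rstar)) :
    ∃ P θ : ℝ, 1 ≤ P ∧ 0 < θ ∧ ∀ (a : Plane) (δ ω R T η : ℝ) (x : ℝ → Plane) (z : ℝ → EscState),
      AdmissibleAmplitude c C a → 0 < δ → 0 < ω → R + ‖a‖ ≤ r → R + ‖a‖ + δ + ω ≤ θ →
      ‖a‖ ≤ η → δ ≤ η → ω ≤ η → P * η ≤ 1 → 0 ≤ T →
      ContinuousOn x (Icc 0 T) → ContinuousOn z (Icc 0 T) →
      (∀ τ ∈ Ico 0 T, HasDerivWithinAt x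
        (ω⁻¹ • F (x τ) (rstar + (z τ).1 + perturbation c a τ)) (Ici τ) τ) →
      (∀ τ ∈ Ico 0 T, HasDerivWithinAt z
        (δ • escField c τ (h (x τ) - h (l rstar)) (z τ)) (Ici τ) τ) →
      (∀ τ ∈ Icc 0 T, ‖x τ - l rstar‖ ≤ R) → (∀ τ ∈ Icc 0 T, ‖z τ‖ ≤ R) →
      ‖x 0 - l rstar‖ ≤ η → ‖z 0‖ ≤ η →
      (∃ e N, DrivenTrajectory c g lam (4 * C * B) a δ ω R T z e N ∧ N 0 ≤ 1) ∧
        ∀ τ ∈ Icc 0 T, ‖x τ - l rstar‖ ≤ P * η ∧ ‖z τ‖ ≤ P * η := by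
  have hC0 := hb.pos
  obtain ⟨Q, k, θ, hQ, hk, hθ, hθC, hstab⟩ := hb.exists_single_stability (B := 4 * C * B) hlam
    (by positivity)
  set D := B * (1 + B) with hD
  set E := Q * (4 + D) with hE
  have hD0 : 0 < D := by positivity
  have hE0 : 0 < E := by positivity
  have hBE : 0 < B * (E + 1) := by positivity
  refine ⟨1 + D + E + Q + B * (E + 1), θ, by linarith, hθ, ?_⟩
  intro a δ ω R T η x z ha hδ hω hRr hRθ haη hδη hωη hPη hT hx hz hdx hdz hxR hzR hx0 hz0
  have hA0 := norm_nonneg a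
  have hη0 : 0 ≤ η := hA0.trans haη
  have h0T : (0 : ℝ) ∈ Icc 0 T := ⟨le_rfl, hT⟩
  have hd := hp.drivenTrajectory hl hB hb hg hω hδ.le hRr (by linarith) hx hz hdx hdz hxR hzR
  have hs : ∀ τ ∈ Icc 0 T, ‖rstar + (z τ).1 + perturbation c a τ - rstar‖ ≤ ‖(z τ).1‖ + ‖a‖ := by
    intro τ _
    have h1 : rstar + (z τ).1 + perturbation c a τ - rstar = (z τ).1 + perturbation c a τ := by
      abel
    rw [h1]
    exact (norm_add_le _ _).trans (by gcongr; exact norm_perturbation_le c a τ)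
  have hsr : ∀ τ ∈ Icc 0 T, ‖rstar + (z τ).1 + perturbation c a τ - rstar‖ ≤ r := fun τ hτ =>
    (hs τ hτ).trans (by linarith [(EscState.norms_le (hzR τ hτ)).1])
  set N : ℝ → ℝ := fun τ => Nm (x τ - l (rstar + (z τ).1 + perturbation c a τ)) with hN
  have hN0 : N 0 ≤ D * η := by
    refine (hp.le_norm _).trans ?_
    have h1 : ‖x 0 - l (rstar + (z 0).1 + perturbation c a 0)‖ ≤
        ‖x 0 - l rstar‖ + ‖l (rstar + (z 0).1 + perturbation c a 0) - l rstar‖ := by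
      rw [← norm_neg (l _ - l rstar), neg_sub]
      exact (le_of_eq (by congr 1; abel)).trans (norm_add_le _ _)
    have h2 := hp.equilibrium_le _ (hsr 0 h0T)
    have h3 : ‖rstar + (z 0).1 + perturbation c a 0 - rstar‖ ≤ η := by
      rw [perturbation_zero, add_zero, add_sub_cancel_left]
      exact (EscState.norms_le hz0).1
    have h4 : B * ‖rstar + (z 0).1 + perturbation c a 0 - rstar‖ ≤ B * η := by gcongr
    calc _ ≤ B * (η + B * η) := by gcongr; linarith
      _ = D * η := by rw [hD]; ring
  have e1 : 0 ≤ D * η := by positivity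
  have e2 : 0 ≤ E * η := by positivity
  have e3 : 0 ≤ Q * η := by positivity
  have e4 : 0 ≤ B * (E + 1) * η := by positivity
  have hN1 : N 0 ≤ 1 := by linarith
  have hN00 : 0 ≤ N 0 := hd.layer_nonneg 0 h0T
  refine ⟨⟨_, _, hd, hN1⟩, fun τ hτ => ?_⟩
  obtain ⟨s1, -, s3, -⟩ := hstab a δ ω R T z _ _ hd ha hδ hω hRθ hN1 τ hτ
  have hz1 : ‖z τ‖ ≤ E * η := by
    refine s3.trans ?_
    calc _ ≤ Q * (η + D * η + η + η + η) := by gcongr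
      _ = E * η := by rw [hE]; ring
  have hNτ : N τ ≤ (D + Q) * η := by
    have h1 : N 0 * Real.exp (-(lam / ω) * τ) ≤ N 0 :=
      mul_le_of_le_one_right hN00 (Real.exp_le_one_iff.2 (by
        nlinarith [mul_nonneg (div_pos hlam hω).le hτ.1]))
    have h2 : Q * ω ≤ Q * η := by gcongr
    have h3 : N τ ≤ N 0 * Real.exp (-(lam / ω) * τ) + Q * ω := s1
    linarith
  refine ⟨?_, by linarith⟩
  have h1 : ‖x τ - l rstar‖ ≤ ‖x τ - l (rstar + (z τ).1 + perturbation c a τ)‖ +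
      ‖l (rstar + (z τ).1 + perturbation c a τ) - l rstar‖ :=
    (le_of_eq (by congr 1; abel)).trans (norm_add_le _ _)
  have h2 : ‖x τ - l (rstar + (z τ).1 + perturbation c a τ)‖ ≤ N τ := hp.norm_le _
  have h3 : B * ‖rstar + (z τ).1 + perturbation c a τ - rstar‖ ≤ B * (E * η + η) := by
    gcongr
    exact (hs τ hτ).trans (add_le_add ((EscState.norms_le hz1).1) haη)
  have h4 := hp.equilibrium_le _ (hsr τ hτ)
  linarith

end Trapping

section Existence

variable {F : Plane → Plane → Plane} {h : Plane → ℝ} {l : Plane → Plane} {rstar : Plane}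

theorem contDiffOn_fullField (hF : ContDiff ℝ 1 (fun p : Plane × Plane => F p.1 p.2))
    (hh : ContDiff ℝ 1 h) (c : EscConstants) (a : Plane) (δ ω : ℝ) {R : ℝ} (hR : R ≤ c.ε) :
    ContDiffOn ℝ 1 (fun p : ℝ × (Plane × EscState) =>
      ((ω⁻¹ • F p.2.1 (rstar + p.2.2.1 + perturbation c a p.1),
        δ • escField c p.1 (h p.2.1 - h (l rstar)) p.2.2) : Plane × EscState))
      (univ ×ˢ Metric.ball (l rstar, (0 : EscState)) R) := by
  have hpert := contDiff_perturbation c a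
  intro p hp
  have hz : ‖p.2.2‖ < c.ε := by
    have h1 := mem_ball_iff_norm.1 hp.2
    have h2 : ‖p.2.2‖ ≤ ‖p.2 - (l rstar, (0 : EscState))‖ := by
      simpa using norm_snd_le (p.2 - (l rstar, (0 : EscState)))
    linarith
  have h1 : ContDiff ℝ 1 fun p : ℝ × (Plane × EscState) =>
      (p.2.1, rstar + p.2.2.1 + perturbation c a p.1) := by fun_prop
  have h2 : ContDiffAt ℝ 1 (fun p : ℝ × (Plane × EscState) =>
      F p.2.1 (rstar + p.2.2.1 + perturbation c a p.1)) p := (hF.comp h1).contDiffAt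
  have h3 : ContDiffAt ℝ 1 (fun p : ℝ × (Plane × EscState) =>
      escField c p.1 (h p.2.1 - h (l rstar)) p.2.2) p :=
    contDiffAt_escField c contDiffAt_fst (by fun_prop) (by fun_prop) (c.moment_pos hz)
  exact ((h2.const_smul ω⁻¹).prodMk (h3.const_smul δ)).contDiffWithinAt

theorem contDiffOn_reducedField (hh : ContDiff ℝ 1 h) (hl : ContDiff ℝ 1 l) (c : EscConstants)
    (a : Plane) (δ : ℝ) {R : ℝ} (hR : R ≤ c.ε) :
    ContDiffOn ℝ 1 (fun p : ℝ × EscState =>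
      δ • escField c p.1 (h (l (rstar + p.2.1 + perturbation c a p.1)) - h (l rstar)) p.2)
      (univ ×ˢ Metric.ball (0 : EscState) R) := by
  have hpert := contDiff_perturbation c a
  intro p hp
  have hz : ‖p.2‖ < c.ε := (mem_ball_zero_iff.1 hp.2).trans_le hR
  have h1 : ContDiffAt ℝ 1 (fun p : ℝ × EscState =>
      escField c p.1 (h (l (rstar + p.2.1 + perturbation c a p.1)) - h (l rstar)) p.2) p :=
    contDiffAt_escField c contDiffAt_fst (by fun_prop) (by fun_prop) (c.moment_pos hz)
  exact (h1.const_smul δ).contDiffWithinAt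

end Existence

/-! ### Choice of the constants and conclusion. -/

theorem mainTheorem2
    {n : ℕ}
    -- vehicle `dx/dt = f (x, u)`, control law `u = α (x, r)`, cost `y = h x`
    (f : Plane → EuclideanSpace ℝ (Fin n) → Plane)
    (α : Plane → Plane → EuclideanSpace ℝ (Fin n))
    (h : Plane → ℝ) (l : Plane → Plane) (rstar : Plane)
    (hf : ContDiff ℝ ((⊤ : ℕ∞) : WithTop ℕ∞) (fun p : Plane × EuclideanSpace ℝ (Fin n) => f p.1 p.2))
    (hα : ContDiff ℝ ((⊤ : ℕ∞) : WithTop ℕ∞) (fun p : Plane × Plane => α p.1 p.2))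
    (hh : ContDiff ℝ ((⊤ : ℕ∞) : WithTop ℕ∞) h)
    -- smooth map of equilibria
    (hl : ContDiff ℝ ((⊤ : ℕ∞) : WithTop ℕ∞) l)
    (heq : ∀ x r : Plane, f x (α x r) = 0 ↔ x = l r)
    -- local exponential stability of the equilibria, uniformly in the reference
    (hstab : LocallyExpStableUniformly (fun x r => f x (α x r)) l)
    -- nondegenerate local minimum of the cost at `rstar`
    (hgrad : fderiv ℝ (h ∘ l) rstar = 0)
    (hhess : ∀ w : Plane, w ≠ 0 → 0 < iteratedFDeriv ℝ 2 (h ∘ l) rstar ![w, w])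
    -- controller constants: distinct frequencies with a least common period
    (c : EscConstants) (hfreq : c.freq 0 ≠ c.freq 1)
    (period : ℝ)
    (hperiod : IsLeast {T : ℝ | 0 < T ∧
      ∀ i, Function.Periodic (fun τ => Real.sin (c.freq i * τ)) T} period)
    -- bound for the ratio of the two perturbation amplitudes
    (κ : ℝ) (hκ : 1 ≤ κ) :
    ∃ C : ℝ, 0 < C ∧ ∀ R : ℝ, 0 < R →
      ∃ ρ a₀ δ₀ ω₀ : ℝ, 0 < ρ ∧ 0 < a₀ ∧ 0 < δ₀ ∧ 0 < ω₀ ∧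
        ∀ (a : Plane) (δ ω : ℝ),
          0 < a 0 → 0 < a 1 → a 0 ≤ κ * a 1 → a 1 ≤ κ * a 0 → ‖a‖ < a₀ →
          0 < δ → δ < δ₀ → 0 < ω → ω < ω₀ →
          ∀ (x₀ : Plane) (z₀ : EscState), ‖x₀ - l rstar‖ < ρ → ‖z₀‖ < ρ →
            -- solutions exist for all time
            (∃ (x : ℝ → Plane) (z : ℝ → EscState), x 0 = x₀ ∧ z 0 = z₀ ∧
              IsFullSolution (fun x r => f x (α x r)) h l rstar c a δ ω x z) ∧
            (∃ zr : ℝ → EscState, zr 0 = z₀ ∧ IsReducedSolution h l rstar c a δ zr) ∧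
            ∀ (x : ℝ → Plane) (z : ℝ → EscState), x 0 = x₀ → z 0 = z₀ →
              IsFullSolution (fun x r => f x (α x r)) h l rstar c a δ ω x z →
              -- local stability
              (∀ τ : ℝ, 0 ≤ τ → ‖x τ - l rstar‖ < R ∧ ‖z τ‖ < R) ∧
              -- closeness to the reduced system, uniformly on `[0, ∞)`
              (∀ zr : ℝ → EscState, zr 0 = z₀ → IsReducedSolution h l rstar c a δ zr →
                ∀ τ : ℝ, 0 ≤ τ → ‖z τ - zr τ‖ ≤ C * ω) ∧
              -- convergence of the speed and sideslip errors
              (∃ T : ℝ, ∀ τ : ℝ, T ≤ τ → ∀ i, |(z τ).1 i| ≤ C * (ω + δ + ‖a‖ ^ 2)) := by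
  set F : Plane → Plane → Plane := fun x r => f x (α x r) with hFdef
  have hF : ContDiff ℝ 1 (fun p : Plane × Plane => F p.1 p.2) :=
    (hf.comp (contDiff_fst.prodMk hα)).of_le (by exact_mod_cast le_top)
  have hh1 : ContDiff ℝ 1 h := hh.of_le (by exact_mod_cast le_top)
  have hl1 : ContDiff ℝ 1 l := hl.of_le (by exact_mod_cast le_top)
  -- the cost in error coordinates
  set g : Plane → ℝ := fun s => h (l (rstar + s)) - h (l rstar) with hgdef
  have hg : ContDiff ℝ 3 g := by
    have h1 : ContDiff ℝ ((⊤ : ℕ∞) : WithTop ℕ∞) g :=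
      ((hh.comp hl).comp (contDiff_const.add contDiff_id)).sub contDiff_const
    exact_mod_cast contDiff_infty.1 h1 3
  have hgd : fderiv ℝ g = fun s => fderiv ℝ (h ∘ l) (rstar + s) := by
    funext s
    rw [hgdef, fderiv_sub_const]
    exact fderiv_comp_add_left (f := h ∘ l) rstar
  have hg1 : fderiv ℝ g 0 = 0 := by rw [hgd]; simpa using hgrad
  have hg2 : ∀ v, v ≠ 0 → 0 < fderiv ℝ (fderiv ℝ g) 0 v v := fun v hv => by
    have h1 := hhess v hv
    rw [iteratedFDeriv_two_apply] at h1
    rw [hgd, fderiv_comp_add_left (f := fderiv ℝ (h ∘ l)) rstar, add_zero]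
    simpa using h1
  obtain ⟨J, C, hb, hadm⟩ := exists_escBounds c hfreq hg (by simp [hgdef]) hg1 hg2 κ
  obtain ⟨Nm, lam, B, r, hlam, hB, hr, hp⟩ :=
    exists_plantBounds rstar hF hh1 hl1 (fun s => (heq _ _).2 rfl) hstab
  have hC0 := hb.pos
  have hB' : 0 < 4 * C * B := by positivity
  obtain ⟨P, θ₁, hP, hθ₁, htrap⟩ :=
    hp.exists_trapping hl.continuous hlam hB hb (fun s => rfl)
  obtain ⟨Q, k, θ₂, hQ, hk, hθ₂, -, hstable⟩ := hb.exists_single_stability hlam hB'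
  obtain ⟨Qc, θ₃, hQc, hθ₃, hclose⟩ := hb.exists_closeness hlam hB'
  -- The rates and constants are obtained before the radius of the ball is chosen, so the final
  -- constant does not depend on `R`.
  refine ⟨Qc + 2 * Q, by positivity, fun R hR => ?_⟩
  set θ := min θ₁ (min θ₂ θ₃) with hθ
  have hθ0 : 0 < θ := by positivity
  -- `c.ε / 3` keeps `m + ε` positive on the ball of radius `3 * R₁`, where the existence lemma
  -- requires a smooth field. `r / 2` leaves room for the perturbation in the domain of the plant
  -- bounds, and `θ / 4` for the four summands in the smallness conditions.
  set R₁ := min R (min (c.ε / 3) (min (r / 2) (θ / 4))) with hR₁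
  have hε := c.ε_pos
  have hR₁0 : 0 < R₁ := by positivity
  have hR₁R : R₁ ≤ R := min_le_left _ _
  have hR₁' := min_le_right R (min (c.ε / 3) (min (r / 2) (θ / 4)))
  have hR₁ε : R₁ ≤ c.ε / 3 := hR₁'.trans (min_le_left _ _)
  have hR₁r : R₁ ≤ r / 2 := hR₁'.trans ((min_le_right _ _).trans (min_le_left _ _))
  have hR₁θ : R₁ ≤ θ / 4 := hR₁'.trans ((min_le_right _ _).trans (min_le_right _ _))
  -- Twice the trapping factors of the full system, `P`, and of the reduced system, `4 * Q`, so that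
  -- both bounds come out strictly below `R₁`.
  set S := 2 * P + 8 * Q with hS
  have hS0 : 0 < S := by positivity
  set η := min (min R₁ 1 / S) R₁ with hη
  have hη0 : 0 < η := by positivity
  have hηS : S * η ≤ min R₁ 1 := by
    have : η ≤ min R₁ 1 / S := min_le_left _ _
    rwa [le_div_iff₀ hS0, mul_comm] at this
  have hηR : η ≤ R₁ := min_le_right _ _
  have hm1 : min R₁ 1 ≤ R₁ := min_le_left _ _
  have hm2 : min R₁ 1 ≤ 1 := min_le_right _ _
  have hPη : 0 < P * η := by positivity
  have hQη : 0 < Q * η := by positivity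
  have hSe : S * η = 2 * (P * η) + 8 * (Q * η) := by rw [hS]; ring
  refine ⟨η, η, η, η, hη0, hη0, hη0, hη0, ?_⟩
  intro a δ ω ha0 ha1 h01 h10 haη hδ hδη hω hωη x₀ z₀ hx₀ hz₀
  have ha := hadm a ha0 ha1 h01 h10
  have hA0 := norm_nonneg a
  have hθle : R₁ + ‖a‖ + δ + ω ≤ θ := by linarith
  have hle1 : R₁ + ‖a‖ + δ + ω ≤ θ₁ := hθle.trans (min_le_left _ _)
  have hle2 : R₁ + ‖a‖ + δ + ω ≤ θ₂ := hθle.trans ((min_le_right _ _).trans (min_le_left _ _))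
  have hle3 : R₁ + ‖a‖ + δ + ω ≤ θ₃ := hθle.trans ((min_le_right _ _).trans (min_le_right _ _))
  -- trapping for both systems
  have hfull : ∀ (T : ℝ) (x : ℝ → Plane) (z : ℝ → EscState), 0 ≤ T → x 0 = x₀ → z 0 = z₀ →
      ContinuousOn x (Icc 0 T) → ContinuousOn z (Icc 0 T) →
      (∀ τ ∈ Ico 0 T, HasDerivWithinAt x
        (ω⁻¹ • F (x τ) (rstar + (z τ).1 + perturbation c a τ)) (Ici τ) τ) →
      (∀ τ ∈ Ico 0 T, HasDerivWithinAt z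
        (δ • escField c τ (h (x τ) - h (l rstar)) (z τ)) (Ici τ) τ) →
      (∀ τ ∈ Icc 0 T, ‖(x τ, z τ) - (l rstar, (0 : EscState))‖ ≤ R₁) →
      (∃ e N, DrivenTrajectory c g lam (4 * C * B) a δ ω R₁ T z e N ∧ N 0 ≤ 1) ∧
        ∀ τ ∈ Icc 0 T, ‖(x τ, z τ) - (l rstar, (0 : EscState))‖ < R₁ := by
    intro T x z hT hx0 hz0 hx hz hdx hdz hle
    have hle' : ∀ τ ∈ Icc 0 T, ‖x τ - l rstar‖ ≤ R₁ ∧ ‖z τ‖ ≤ R₁ := fun τ hτ => by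
      have h1 := hle τ hτ
      rwa [Prod.mk_sub_mk, sub_zero, norm_prod_le_iff] at h1
    obtain ⟨h1, h2⟩ := htrap a δ ω R₁ T η x z ha hδ hω (by linarith) hle1 haη.le hδη.le hωη.le
      (by linarith) hT hx hz hdx hdz (fun τ hτ => (hle' τ hτ).1) (fun τ hτ => (hle' τ hτ).2)
      (by rw [hx0]; exact hx₀.le) (by rw [hz0]; exact hz₀.le)
    refine ⟨h1, fun τ hτ => ?_⟩
    simp only [Prod.mk_sub_mk, sub_zero, Prod.norm_mk, sup_lt_iff]
    exact ⟨(h2 τ hτ).1.trans_lt (by linarith), (h2 τ hτ).2.trans_lt (by linarith)⟩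
  have hred : ∀ (T : ℝ) (z : ℝ → EscState), 0 ≤ T → z 0 = z₀ → ContinuousOn z (Icc 0 T) →
      (∀ τ ∈ Ico 0 T, HasDerivWithinAt z
        (δ • escField c τ (h (l (rstar + (z τ).1 + perturbation c a τ)) - h (l rstar)) (z τ))
        (Ici τ) τ) →
      (∀ τ ∈ Icc 0 T, ‖z τ‖ ≤ R₁) →
      DrivenTrajectory c g lam (4 * C * B) a δ ω R₁ T z (fun _ => 0) (fun _ => 0) ∧
        ∀ τ ∈ Icc 0 T, ‖z τ‖ < R₁ := by
    intro T z hT hz0 hz hdz hle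
    have hd := drivenTrajectory_reduced (g := g) (lam := lam) (ω := ω) (fun s => rfl) hB'.le hδ.le
      hz hdz hle
    refine ⟨hd, fun τ hτ => ?_⟩
    have h1 := (hstable a δ ω R₁ T z _ _ hd ha hδ hω hle2 zero_le_one τ hτ).2.2.1
    rw [hz0, add_zero] at h1
    have h2 : Q * (‖z₀‖ + ‖a‖ + δ + ω) ≤ Q * (η + η + η + η) := by gcongr
    linarith
  have hball : ‖(x₀, z₀) - (l rstar, (0 : EscState))‖ < R₁ := by
    simp only [Prod.mk_sub_mk, sub_zero, Prod.norm_mk, sup_lt_iff]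
    exact ⟨hx₀.trans_le hηR, hz₀.trans_le hηR⟩
  refine ⟨?_, ?_, ?_⟩
  · obtain ⟨y, hy0, hy⟩ := exists_forall_hasDerivWithinAt_Ici_of_apriori hR₁0
      (contDiffOn_fullField (rstar := rstar) (l := l) hF hh1 c a δ ω (by linarith)) hball
      fun T y hT hy0 hdy hle => by
        have hd1 : ∀ t ∈ Icc 0 T, HasDerivWithinAt (fun t => (y t).1) _ (Icc 0 T) t :=
          fun t ht => (hdy t ht).fst
        have hd2 : ∀ t ∈ Icc 0 T, HasDerivWithinAt (fun t => (y t).2) _ (Icc 0 T) t :=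
          fun t ht => (hdy t ht).snd
        exact (hfull T (fun t => (y t).1) (fun t => (y t).2) hT (by rw [hy0]) (by rw [hy0])
          (fun t ht => (hd1 t ht).continuousWithinAt) (fun t ht => (hd2 t ht).continuousWithinAt)
          (fun t ht => (hd1 t ⟨ht.1, ht.2.le⟩).Ici_of_Icc ht)
          (fun t ht => (hd2 t ⟨ht.1, ht.2.le⟩).Ici_of_Icc ht) hle).2 T ⟨hT, le_rfl⟩
    exact ⟨fun t => (y t).1, fun t => (y t).2, congrArg Prod.fst hy0, congrArg Prod.snd hy0,
      fun τ hτ => ⟨(hy τ hτ).fst, (hy τ hτ).snd⟩⟩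
  · exact exists_forall_hasDerivWithinAt_Ici_of_apriori hR₁0
      (contDiffOn_reducedField (rstar := rstar) hh1 hl1 c a δ (by linarith))
      (by rw [sub_zero]; exact hz₀.trans_le hηR) fun T z hT hz0 hdz hle => by
        simp only [sub_zero] at hle ⊢
        exact (hred T z hT hz0 (fun t ht => (hdz t ht).continuousWithinAt)
          (fun t ht => (hdz t ⟨ht.1, ht.2.le⟩).Ici_of_Icc ht) hle).2 T ⟨hT, le_rfl⟩
  · intro x z hx0 hz0 hsol
    have hxc : ContinuousOn x (Ici 0) := fun t ht => (hsol t ht).1.continuousWithinAt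
    have hzc : ContinuousOn z (Ici 0) := fun t ht => (hsol t ht).2.continuousWithinAt
    have hfull' : ∀ T, 0 ≤ T →
        (∀ τ ∈ Icc 0 T, ‖(x τ, z τ) - (l rstar, (0 : EscState))‖ ≤ R₁) → _ := fun T hT hle =>
      hfull T x z hT hx0 hz0 (hxc.mono Icc_subset_Ici_self) (hzc.mono Icc_subset_Ici_self)
        (fun t ht => (hsol t ht.1).1.mono (Ici_subset_Ici.2 ht.1))
        (fun t ht => (hsol t ht.1).2.mono (Ici_subset_Ici.2 ht.1)) hle
    -- Any solution of the full system is confined to the `R₁`-ball. Hence the estimates,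
    -- conditional on confinement, hold on every interval `[0, T]` with the same constants.
    have hlt := forall_lt_of_bootstrap
      (F := fun τ => ‖(x τ, z τ) - (l rstar, (0 : EscState))‖) (b := R₁)
      ((hxc.prodMk hzc).sub continuousOn_const).norm
      (fun T hT hle => (hfull' T hT hle).2 T ⟨hT, le_rfl⟩) (by simp only [hx0, hz0]; exact hball)
    have hdriven : ∀ T, 0 ≤ T → ∃ e N,
        DrivenTrajectory c g lam (4 * C * B) a δ ω R₁ T z e N ∧ N 0 ≤ 1 := fun T hT =>
      (hfull' T hT fun τ hτ => (hlt τ hτ.1).le).1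
    refine ⟨fun τ hτ => ?_, fun zr hzr0 hrsol τ hτ => ?_, ?_⟩
    · have h1 := hlt τ hτ
      simp only [Prod.mk_sub_mk, sub_zero, Prod.norm_mk, sup_lt_iff] at h1
      exact ⟨h1.1.trans_le hR₁R, h1.2.trans_le hR₁R⟩
    · have hzrc : ContinuousOn zr (Ici 0) := fun t ht => (hrsol t ht).continuousWithinAt
      have hred' : ∀ T, 0 ≤ T → (∀ τ ∈ Icc 0 T, ‖zr τ‖ ≤ R₁) → _ := fun T hT hle =>
        hred T zr hT hzr0 (hzrc.mono Icc_subset_Ici_self)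
          (fun t ht => (hrsol t ht.1).mono (Ici_subset_Ici.2 ht.1)) hle
      have hltr := forall_lt_of_bootstrap (F := fun τ => ‖zr τ‖) (b := R₁) hzrc.norm
        (fun T hT hle => (hred' T hT hle).2 T ⟨hT, le_rfl⟩)
        (by simp only [hzr0]; exact hz₀.trans_le hηR)
      obtain ⟨e, N, hd, hN⟩ := hdriven τ hτ
      have hdr := (hred' τ hτ fun t ht => (hltr t ht.1).le).1
      refine (hclose a δ ω R₁ τ z zr e N hd hdr ha hδ hω hle3 hN (hz0.trans hzr0.symm) τ
        ⟨hτ, le_rfl⟩).trans ?_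
      gcongr
      linarith
    · have hA : 0 < ‖a‖ := norm_pos_iff.2 fun h => by simp [h] at ha0
      have hlim : Tendsto (fun τ : ℝ => Real.exp (-(k * δ * ‖a‖) * τ)) atTop (𝓝 0) :=
        Real.tendsto_exp_atBot.comp (tendsto_id.const_mul_atTop_of_neg (by
          have : 0 < k * δ * ‖a‖ := by positivity
          linarith))
      -- After `T` the transient is below the residual `‖a‖ ^ 2 + δ + ω`; this doubling accounts for
      -- the `2 * Q` in the final constant.
      obtain ⟨T, hT⟩ := eventually_atTop.1 ((hlim.eventually_le_const
        (by positivity : 0 < ‖a‖ ^ 2 + δ + ω)).and (eventually_ge_atTop 0))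
      refine ⟨T, fun τ hτ i => ?_⟩
      obtain ⟨hexp, hτ0⟩ := hT τ hτ
      obtain ⟨e, N, hd, hN⟩ := hdriven τ hτ0
      have h1 := (hstable a δ ω R₁ τ z e N hd ha hδ hω hle2 hN τ ⟨hτ0, le_rfl⟩).2.2.2
      refine (Plane.abs_apply_le _ i).trans (h1.trans ?_)
      have h2 := mul_le_mul_of_nonneg_left hexp hQ.le
      have h3 : 0 ≤ Qc * (ω + δ + ‖a‖ ^ 2) := by positivity
      linarith
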